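/- **Setting.** Let $\mathcal X,\mathcal A,\mathcal O$ be (discrete) sets of prompts, actions and observations, $H\ge 1$, $d_0$ a discrete distribution on $\mathcal X$. A state $s_h=(x,a_1,o_1,\dots,a_{h-1},o_{h-1})$ is the history of the first $h-1$ interactions; a policy $\pi=[\pi_h]$ gives distributions $\pi_h(\cdot|s_h)$ of $a_h$, a transition model $\mathbb P=[\mathbb P_h]$ gives distributions $\mathbb P_h(\cdot|s_h,a_h)$ of $o_h$, and $s_{h+1}=(s_h,a_h,o_h)$. A trajectory is $\tau=(x,a_1,o_1,\dots,o_{H-1},a_H)=(s_H,a_H)$; $\mathbb P^\pi(\tau)$ is its probability under $x\sim d_0,\pi,\mathbb P$, and $\mathrm{TV}(\{d_0,\mathbb P,\pi\},\{d_0,\mathbb P',\pi\})$ is the total variation distance of the two trajectory laws. Let $u^*$ be the true utility of trajectories, $\mathbb P^*$ the true transitions, $\eta>0$, $\pi_0$ a reference policy, and $$J(\pi)=\mathbb E_{d_0,\pi,\mathbb P^*}\Big[u^*(s_H,a_H)-\eta\sum_{h=1}^H D_{\mathrm{KL}}(\pi_h(\cdot|s_h),\pi_{0,h}(\cdot|s_h))\Big],\qquad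 \pi^*\in\operatorname{argmax}_\pi J(\pi).$$ Let $\mathcal U$ be a finite class of utilities with values in $[0,B]$ and $\mathcal P$ a finite class of transition models. Write $\sigma(z)=1/(1+e^{-z})$. **Algorithm** (depending on a constant $c_1$, on $T$ and on $\delta$). In round $t=1,\dots,T$, from the data $(\pi_i^1,\pi_i^2,\tau_i^1,\tau_i^2,z_i)_{i<t}$ of the previous rounds: (i) $\hat u_t$ maximizes $L_t(u)=\sum_{i<t}[z_i\log\sigma(u(\tau_i^1)-u(\tau_i^2))+(1-z_i)\log\sigma(u(\tau_i^2)-u(\tau_i^1))]$ over $\mathcal U$, and $\hat{\mathbb P}_t$ maximizes $L_t(\mathbb P)=\sum_{i<t}\sum_{j=1,2}\log\mathbb P^{\pi_i^j}(\tau_i^j)$ over $\mathcal P$ (with $\log 0=-\infty$); (ii) with $\hat V_{t,H+1}=0$, $\hat Q_{t,H}=\hat u_t$, $\hat Q_{t,h}(s_h,a_h)=[\hat{\mathbb P}_{t,h}\hat V_{t,h+1}](s_h,a_h):=\mathbb E_{o_h\sim\hat{\mathbb P}_{t,h}(\cdot|s_h,a_h)}[\hat V_{t,h+1}(s_{h+1})]$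 for $h<H$, the main policy is $\pi^1_{t,h}(a|s)\propto\pi_{0,h}(a|s)\exp(\hat Q_{t,h}(s,a)/\eta)$ and $\hat V_{t,h}(s)=\mathbb E_{a\sim\pi^1_{t,h}(\cdot|s)}[\hat Q_{t,h}(s,a)]-\eta D_{\mathrm{KL}}(\pi^1_{t,h}(\cdot|s),\pi_{0,h}(\cdot|s))$; (iii) with $\tilde{\mathcal U}_t=\{u\in\mathcal U:L_t(u)\ge L_t(\hat u_t)-c_1\log(|\mathcal U|T/\delta)\}$ and $\tilde{\mathcal P}_t=\{\mathbb P\in\mathcal P:L_t(\mathbb P)\ge L_t(\hat{\mathbb P}_t)-c_1\log(|\mathcal P|T/\delta)\}$, the exploration policy $\pi_t^2$ maximizes over $\pi$ $$\max_{\tilde u\in\tilde{\mathcal U}_t,\tilde{\mathbb P}\in\tilde{\mathcal P}_t}\ \mathbb E_{\pi,\tilde{\mathbb P}}[\tilde u]-\mathbb E_{\pi^1_t,\tilde{\mathbb P}}[\tilde u]-\big(\mathbb E_{\pi,\tilde{\mathbb P}}[\hat u_t]-\mathbb E_{\pi_t^1,\tilde{\mathbb P}}[\hat u_t]\big)+\sum_{h=1}^H\mathbb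 E_{\pi,\tilde{\mathbb P}}\big[\hat V_{t,h+1}(s_{h+1})-[\hat{\mathbb P}_{t,h}\hat V_{t,h+1}](s_h,a_h)\big]$$ (all expectations with $x\sim d_0$; in the case $h=H$ the summand is $0$); (iv) a prompt $x\sim d_0$ is drawn, then independent trajectories $\tau_t^1\sim(\pi_t^1,\mathbb P^*)$, $\tau_t^2\sim(\pi_t^2,\mathbb P^*)$ from $x$, and $z_t\in\{0,1\}$ with $\Pr(z_t=1)=\sigma(u^*(\tau_t^1)-u^*(\tau_t^2))$. Ties are resolved by any rule that is a function of the data. **Complexity measures.** $d_{\mathcal U}$ is the Eluder coefficient $\mathtt{EC}(1,\mathcal U-\mathcal U,T)$: the smallest $d\ge0$ such that, with $\bar u(\tau^1,\tau^2)=u(\tau^2)-u(\tau^1)$ for trajectories with the same prompt, for all such pairs $x_1,\dots,x_T$ and all $u_1,\dots,u_T\in\mathcal U$, $$\sum_{t=2}^T|\bar u_t(x_t)-\bar u^*(x_t)|\le\sqrt{d\sum_{t=2}^T\Big(1+\sum_{i=1}^{t-1}(\bar u_t(x_i)-\bar u^*(x_i))^2\Big)}.$$ The number $d_{\mathcal P}\ge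 0$ and the function $\xi$ satisfy the generalized Eluder-type condition: for all $T\in\mathbb N$, $\Delta>0$, all $\mathbb P'_1,\dots,\mathbb P'_T\in\mathcal P$ and all policies $\pi_1,\dots,\pi_T$, if $\sum_{i<t}\mathrm{TV}(\{d_0,\mathbb P'_t,\pi_i\},\{d_0,\mathbb P^*,\pi_i\})^2\le\Delta$ for all $t\in[T]$, then $\sum_{t\in[T]}\mathrm{TV}(\{d_0,\mathbb P'_t,\pi_t\},\{d_0,\mathbb P^*,\pi_t\})\le\xi(d_{\mathcal P},T,\Delta)$. **Theorem.** There are absolute constants $c_1,c_2,C>0$ such that the following holds whenever $u^*\in\mathcal U$, $\mathbb P^*\in\mathcal P$, $B\ge1$, $T\ge2$, $\delta\in(0,1]$. If the algorithm is run with $c_1$, then with probability at least $1-\delta$, $$\sum_{t=1}^T\big(J(\pi^*)-J(\pi_t^1)\big)\le C\Big(\kappa^{-1}B\sqrt{d_{\mathcal U}T\log(|\mathcal U|T/\delta)}+B^2H\,\xi\big(d_{\mathcal P},T,c_2\log(|\mathcal P|HT/\delta)\big)\Big)-\eta\sum_{t=1}^T\sum_{h=1}^H\mathbb E_{d_0,\pi^*,\mathbb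 P^*}\big[D_{\mathrm{KL}}(\pi^*_h(\cdot|s_h),\pi^1_{t,h}(\cdot|s_h))\big],$$ where $\kappa=1/(2+e^{B}+e^{-B})$. -/

import Mathlib

open scoped ENNReal

namespace MGSHF

noncomputable section

universe uX uA uO uZ

/-! ## Discrete probability -/

/-- Expectation of a real function under a discrete distribution. -/
def expect {Z : Type uZ} (p : PMF Z) (f : Z → ℝ) : ℝ := ∑' z, (p z).toReal * f z

/-- Total variation distance between two discrete distributions. -/
def tv {Z : Type uZ} (p q : PMF Z) : ℝ := (1 / 2) * ∑' z, |(p z).toReal - (q z).toReal|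

/-- Kullback-Leibler divergence of two discrete distributions
(every set of outcomes is measurable); it may be infinite. -/
def kl {Z : Type uZ} (p q : PMF Z) : ℝ≥0∞ :=
  letI : MeasurableSpace Z := ⊤
  InformationTheory.klDiv p.toMeasure q.toMeasure

/-- The Gibbs distribution `p₀(z) exp(q(z)/η) / ∑ z', p₀(z') exp(q(z')/η)`. The sum is positive,
and it is finite whenever `q` is bounded above (if it diverges, `p₀` is returned). -/
def gibbs {Z : Type uZ} (η : ℝ) (p₀ : PMF Z) (q : Z → ℝ) : PMF Z :=
  open scoped Classical in
  if h : (∑' z, p₀ z * ENNReal.ofReal (Real.exp (q z / η))) ≠ 0 ∧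
      (∑' z, p₀ z * ENNReal.ofReal (Real.exp (q z / η))) ≠ ∞
  then PMF.normalize (fun z => p₀ z * ENNReal.ofReal (Real.exp (q z / η))) h.1 h.2
  else p₀

/-! ## The multi-turn decision process -/

/-- A state is a prompt with the list of the (action, observation) pairs so far, the newest first.
The state `s_h` of step `h` carries a list of length `h - 1`, so that a function of the state
may depend on the step. -/
abbrev State (X : Type uX) (A : Type uA) (O : Type uO) := X × List (A × O)

/-- A trajectory `(x, a₁, o₁, …, o_{H-1}, a_H)` is a pair `(s_H, a_H)`. -/
abbrev Traj (X : Type uX) (A : Type uA) (O : Type uO) := State X A O × A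

abbrev Policy (X : Type uX) (A : Type uA) (O : Type uO) := State X A O → PMF A

/-- Transition kernels, given by the law of the observation `o_h` from `(s_h, a_h)`. -/
abbrev Transition (X : Type uX) (A : Type uA) (O : Type uO) := State X A O → A → PMF O

abbrev Utility (X : Type uX) (A : Type uA) (O : Type uO) := Traj X A O → ℝ

variable {X : Type uX} {A : Type uA} {O : Type uO}

/-- The next state `(s, a, o)`. -/
def push (s : State X A O) (a : A) (o : O) : State X A O := (s.1, (a, o) :: s.2)

/-- The pairs `(s_H, a_H)` that are trajectories of an episode of `H` steps. -/
def IsTraj (H : ℕ) (τ : Traj X A O) : Prop := τ.1.2.length + 1 = H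

/-- A model `(S, A, H, P, d₀, u)`. -/
structure Model (X : Type uX) (A : Type uA) (O : Type uO) where
  /-- episode length -/
  H : ℕ
  /-- prompt distribution -/
  d₀ : PMF X
  /-- transitions -/
  P : Transition X A O
  /-- utility of a trajectory -/
  u : Utility X A O

/-- Law of `(a, o)` at the state `s`: `a ∼ π(· | s)`, `o ∼ P(· | s, a)`. -/
def stepLaw (π : Policy X A O) (P : Transition X A O) (s : State X A O) : PMF (A × O) :=
  (π s).bind fun a => (P s a).map fun o => (a, o)

/-- Law of the state after `i` interactions (i.e. of `s_{i+1}`), from the prompt `x`. -/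
def stateLawFrom (π : Policy X A O) (P : Transition X A O) (x : X) : ℕ → PMF (State X A O)
  | 0 => PMF.pure (x, [])
  | i + 1 => (stateLawFrom π P x i).bind fun s => (stepLaw π P s).map fun ao => push s ao.1 ao.2

/-- Law of the trajectory of an episode of `H ≥ 1` steps, from the prompt `x`. -/
def trajLawFrom (π : Policy X A O) (P : Transition X A O) (H : ℕ) (x : X) : PMF (Traj X A O) :=
  (stateLawFrom π P x (H - 1)).bind fun s => (π s).map fun a => (s, a)

/-- Law of `s_{i+1}` for a prompt drawn from `d₀`. -/
def stateLaw (d₀ : PMF X) (π : Policy X A O) (P : Transition X A O) (i : ℕ) :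
    PMF (State X A O) :=
  d₀.bind fun x => stateLawFrom π P x i

/-- Law of `(s_{i+1}, a_{i+1}, o_{i+1})` for a prompt drawn from `d₀`. -/
def transitionLaw (d₀ : PMF X) (π : Policy X A O) (P : Transition X A O) (i : ℕ) :
    PMF (State X A O × A × O) :=
  (stateLaw d₀ π P i).bind fun s => (stepLaw π P s).map fun ao => (s, ao)

/-- Law of the trajectory for a prompt drawn from `d₀`. -/
def trajLaw (d₀ : PMF X) (π : Policy X A O) (P : Transition X A O) (H : ℕ) :
    PMF (Traj X A O) :=
  d₀.bind fun x => trajLawFrom π P H x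

/-- `∑_{h ∈ [H]} E_{d₀, π, P} [KL(π_h(· | s_h), π'_h(· | s_h))]`. -/
def klAlong (M : Model X A O) (π π' : Policy X A O) : ℝ≥0∞ :=
  ∑ i ∈ Finset.range M.H, ∑' s, stateLaw M.d₀ π M.P i s * kl (π s) (π' s)

/-- The KL-regularized objective `J(π; M, π_ref)`, which is `-∞` if the penalty is infinite. -/
def J (η : ℝ) (M : Model X A O) (πref π : Policy X A O) : EReal :=
  ((expect (trajLaw M.d₀ π M.P M.H) M.u : ℝ) : EReal)
    - ((ENNReal.ofReal η * klAlong M π πref : ℝ≥0∞) : EReal)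

/-- `π` attains the maximum of the KL-regularized objective over all policies. -/
def IsOptimal (η : ℝ) (M : Model X A O) (πref π : Policy X A O) : Prop :=
  ∀ π' : Policy X A O, J η M πref π' ≤ J η M πref π

/-! ## Planning: the Gibbs oracle -/

/-- The `Q`-value at `(s, a)` from the `V`-value of the next step, with `k + 1` steps to go. -/
def qStep (M : Model X A O) (k : ℕ) (Vnext : State X A O → ℝ) (s : State X A O) (a : A) : ℝ :=
  if k = 0 then M.u (s, a) else expect (M.P s a) fun o => Vnext (push s a o)

/-- The `V`-value with `k` steps to go (`k = H + 1 - h` at step `h`): `V_{H+1} = 0` and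
`V_h(s) = E_{a ∼ π_{M,h}(· | s)}[Q_h(s, a)] - η KL(π_{M,h}(· | s), π_{ref,h}(· | s))` with `π_{M,h}`
the Gibbs distribution of `Q_h`. -/
def valueToGo (η : ℝ) (M : Model X A O) (πref : Policy X A O) : ℕ → State X A O → ℝ
  | 0, _ => 0
  | k + 1, s =>
    expect (gibbs η (πref s) (qStep M k (valueToGo η M πref k) s))
        (qStep M k (valueToGo η M πref k) s)
      - η * (kl (gibbs η (πref s) (qStep M k (valueToGo η M πref k) s)) (πref s)).toReal

/-- `V_{M,h}(s)` at a state `s` of step `h = s.2.length + 1 ≤ H + 1`. -/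
def V (η : ℝ) (M : Model X A O) (πref : Policy X A O) (s : State X A O) : ℝ :=
  valueToGo η M πref (M.H - s.2.length) s

/-- `Q_{M,h}(s, a)` at a state `s` of step `h = s.2.length + 1 ≤ H`. -/
def Q (η : ℝ) (M : Model X A O) (πref : Policy X A O) (s : State X A O) (a : A) : ℝ :=
  if s.2.length + 1 = M.H then M.u (s, a)
  else expect (M.P s a) fun o => V η M πref (push s a o)

/-- The output of the planning oracle: `π_{M,h}(a | s) ∝ π_{ref,h}(a | s) exp(Q_{M,h}(s, a) / η)`
at the states of the steps `h ≤ H` (and `π_ref` at longer histories, which never occur). -/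
def gibbsPolicy (η : ℝ) (M : Model X A O) (πref : Policy X A O) : Policy X A O := fun s =>
  if s.2.length < M.H then gibbs η (πref s) (Q η M πref s) else πref s

/-! ## Data and maximum likelihood -/

/-- The data of one round: the two policies, the two trajectories sampled by them,
and the preference signal (`true` if the first trajectory is preferred). -/
structure Sample (X : Type uX) (A : Type uA) (O : Type uO) where
  pol₁ : Policy X A O
  pol₂ : Policy X A O
  traj₁ : Traj X A O
  traj₂ : Traj X A O
  pref : Bool

/-- Data sets, the newest round first. -/
abbrev Data (X : Type uX) (A : Type uA) (O : Type uO) := List (Sample X A O)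

/-- The Bradley-Terry preference signal: `true` with probability `σ(u(τ₁) - u(τ₂))`. -/
def preferenceLaw (u : Utility X A O) (τ₁ τ₂ : Traj X A O) : PMF Bool :=
  PMF.ofFintype
    (fun z => if z then ENNReal.ofReal (Real.sigmoid (u τ₁ - u τ₂))
      else ENNReal.ofReal (1 - Real.sigmoid (u τ₁ - u τ₂)))
    (by
      simp only [Fintype.sum_bool, if_true, Bool.false_eq_true, if_false]
      rw [← ENNReal.ofReal_add (Real.sigmoid_nonneg _)
        (sub_nonneg.2 (Real.sigmoid_le_one _))]
      simp)

/-- One round of interaction with the true model: two trajectories that share a prompt,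
and a preference signal. -/
def roundLaw (M : Model X A O) (π₁ π₂ : Policy X A O) : PMF (Sample X A O) :=
  M.d₀.bind fun x =>
    (trajLawFrom π₁ M.P M.H x).bind fun τ₁ =>
      (trajLawFrom π₂ M.P M.H x).bind fun τ₂ =>
        (preferenceLaw M.u τ₁ τ₂).map fun z => ⟨π₁, π₂, τ₁, τ₂, z⟩

/-- Log-likelihood of a utility. -/
def rewardLogLik (D : Data X A O) (u : Utility X A O) : ℝ :=
  (D.map fun e =>
    if e.pref then Real.log (Real.sigmoid (u e.traj₁ - u e.traj₂))
    else Real.log (Real.sigmoid (u e.traj₂ - u e.traj₁))).sum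

/-- Log-likelihood `∑ log P^π(τ)` of a transition model over all the pairs `(π, τ)` in the data;
`log 0 = -∞`. -/
def transitionLogLik (H : ℕ) (d₀ : PMF X) (D : Data X A O) (P : Transition X A O) : EReal :=
  (D.map fun e =>
    ENNReal.log (trajLaw d₀ e.pol₁ P H e.traj₁) + ENNReal.log (trajLaw d₀ e.pol₂ P H e.traj₂)).sum

/-- The utilities of `U` whose log-likelihood is within `β` of that of `uHat`. -/
def rewardConf (U : Finset (Utility X A O)) (D : Data X A O) (uHat : Utility X A O) (β : ℝ) :
    Set (Utility X A O) :=
  {u | u ∈ U ∧ rewardLogLik D uHat - β ≤ rewardLogLik D u}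

/-- The transitions of `Ps` whose log-likelihood is within `β` of that of `PHat`. -/
def transitionConf (H : ℕ) (d₀ : PMF X) (Ps : Finset (Transition X A O)) (D : Data X A O)
    (PHat : Transition X A O) (β : ℝ) : Set (Transition X A O) :=
  {P | P ∈ Ps ∧ transitionLogLik H d₀ D PHat - (β : EReal) ≤ transitionLogLik H d₀ D P}

/-! ## Exploration and the online algorithm -/

/-- The uncertainty of `π` relative to the main policy `π₁`, for candidates `u'`, `P'`; `MHat` is the
estimated model `(uHat, PHat)`, and `V` its `V`-values with respect to `πref`. -/
def uncertainty (η : ℝ) (MHat : Model X A O) (πref π₁ : Policy X A O)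
    (π : Policy X A O) (u' : Utility X A O) (P' : Transition X A O) : ℝ :=
  expect (trajLaw MHat.d₀ π P' MHat.H) u' - expect (trajLaw MHat.d₀ π₁ P' MHat.H) u'
    - (expect (trajLaw MHat.d₀ π P' MHat.H) MHat.u - expect (trajLaw MHat.d₀ π₁ P' MHat.H) MHat.u)
  + ∑ i ∈ Finset.range MHat.H, expect (transitionLaw MHat.d₀ π P' i) fun sao =>
      V η MHat πref (push sao.1 sao.2.1 sao.2.2)
        - expect (MHat.P sao.1 sao.2.1) fun o => V η MHat πref (push sao.1 sao.2.1 o)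

/-- `π₂` maximizes `max_{u' ∈ Ut, P' ∈ Pt} uncertainty(π, u', P')` over all policies `π`. -/
def IsExploration (η : ℝ) (MHat : Model X A O) (πref π₁ : Policy X A O)
    (Ut : Set (Utility X A O)) (Pt : Set (Transition X A O)) (π₂ : Policy X A O) : Prop :=
  ∃ u₂ ∈ Ut, ∃ P₂ ∈ Pt, ∀ π : Policy X A O, ∀ u' ∈ Ut, ∀ P' ∈ Pt,
    uncertainty η MHat πref π₁ π u' P' ≤ uncertainty η MHat πref π₁ π₂ u₂ P₂

/-- The choices made from the data of the previous rounds (a rule that resolves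
the ties of the three maximizations). -/
structure Learner (X : Type uX) (A : Type uA) (O : Type uO) where
  /-- estimated utility -/
  uHat : Data X A O → Utility X A O
  /-- estimated transitions -/
  PHat : Data X A O → Transition X A O
  /-- exploration policy -/
  explore : Data X A O → Policy X A O

/-- The estimated model; the episode length and the prompt distribution are those of `M`. -/
def Learner.model (L : Learner X A O) (M : Model X A O) (D : Data X A O) : Model X A O :=
  { M with P := L.PHat D, u := L.uHat D }

/-- The main policy: the oracle's output for the estimated model and the reference `π₀`. -/
def Learner.main (L : Learner X A O) (M : Model X A O) (η : ℝ) (π₀ : Policy X A O)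
    (D : Data X A O) : Policy X A O :=
  gibbsPolicy η (L.model M D) π₀

/-- Law of the data of the first `t` rounds in the true model `M`. -/
def dataLaw (L : Learner X A O) (M : Model X A O) (η : ℝ) (π₀ : Policy X A O) :
    ℕ → PMF (Data X A O)
  | 0 => PMF.pure []
  | t + 1 => (dataLaw L M η π₀ t).bind fun D =>
      (roundLaw M (L.main M η π₀ D) (L.explore D)).map fun e => e :: D

/-- The learner runs the online algorithm for `T` rounds: in each round, from the data `D` of the
previous ones, `uHat` and `PHat` are maximum likelihood estimates over `U` and `Ps`, and the exploration
policy maximizes the uncertainty over the confidence sets of widths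
`c₁ log(|U| T / δ)` and `c₁ log(|Ps| T / δ)`. -/
def Learner.Follows (L : Learner X A O) (M : Model X A O) (η : ℝ) (π₀ : Policy X A O)
    (U : Finset (Utility X A O)) (Ps : Finset (Transition X A O)) (c₁ δ : ℝ) (T : ℕ) : Prop :=
  ∀ t < T, ∀ D ∈ (dataLaw L M η π₀ t).support,
    (L.uHat D ∈ U ∧ ∀ u ∈ U, rewardLogLik D u ≤ rewardLogLik D (L.uHat D)) ∧
    (L.PHat D ∈ Ps ∧
      ∀ P ∈ Ps, transitionLogLik M.H M.d₀ D P ≤ transitionLogLik M.H M.d₀ D (L.PHat D)) ∧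
    IsExploration η (L.model M D) π₀ (L.main M η π₀ D)
      (rewardConf U D (L.uHat D) (c₁ * Real.log (U.card * T / δ)))
      (transitionConf M.H M.d₀ Ps D (L.PHat D) (c₁ * Real.log (Ps.card * T / δ)))
      (L.explore D)

/-- Regret `∑_t (J(π*) - J(π¹_t))` of the main policies recorded in the data. -/
def regret (η : ℝ) (M : Model X A O) (π₀ πstar : Policy X A O) (D : Data X A O) : EReal :=
  (D.map fun e => J η M π₀ πstar - J η M π₀ e.pol₁).sum

/-- `∑_t ∑_h E_{d₀, π*, P*} [KL(π*_h(· | s_h), π¹_{t,h}(· | s_h))]`. -/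
def klToMain (M : Model X A O) (πstar : Policy X A O) (D : Data X A O) : ℝ≥0∞ :=
  (D.map fun e => klAlong M πstar e.pol₁).sum

/-! ## Complexity measures -/

/-- The Eluder coefficient `EC(lam, F, T)` relative to the true function `fstar`: the smallest
`d ≥ 0` such that
`∑_{t=2}^T |f_t(x_t) - f*(x_t)| ≤ √(d ∑_{t=2}^T (lam + ∑_{i<t} (f_t(x_i) - f*(x_i))²))`
for all points `x_1, …, x_T` and all functions `f_1, …, f_T ∈ F`. -/
def eluderCoeff {Z : Type uZ} (lam : ℝ) (F : Set (Z → ℝ)) (fstar : Z → ℝ) (T : ℕ) : ℝ :=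
  sInf {d : ℝ | 0 ≤ d ∧ ∀ (x : ℕ → Z) (f : ℕ → Z → ℝ), (∀ t ∈ Finset.Icc 1 T, f t ∈ F) →
    ∑ t ∈ Finset.Icc 2 T, |f t (x t) - fstar (x t)| ≤
      √(d * ∑ t ∈ Finset.Icc 2 T,
        (lam + ∑ i ∈ Finset.Ico 1 t, (f t (x i) - fstar (x i)) ^ 2))}

/-- Pairs of trajectories with the same prompt. -/
def TrajPair (X : Type uX) (A : Type uA) (O : Type uO) (H : ℕ) :=
  {p : Traj X A O × Traj X A O // IsTraj H p.1 ∧ IsTraj H p.2 ∧ p.1.1.1 = p.2.1.1}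

/-- The utility difference `(τ¹, τ²) ↦ u(τ²) - u(τ¹)`. -/
def utilityDiff (H : ℕ) (u : Utility X A O) : TrajPair X A O H → ℝ :=
  fun p => u p.1.2 - u p.1.1

/-- `d_U = EC(1, U - U, T)`. -/
def dU (H : ℕ) (U : Finset (Utility X A O)) (ustar : Utility X A O) (T : ℕ) : ℝ :=
  eluderCoeff 1 (utilityDiff H '' (U : Set (Utility X A O))) (utilityDiff H ustar) T

/-- The generalized Eluder-type condition with parameters `d`, `ξ`, for a class `Ps` of transitions
and the true transitions `M.P`. -/
def GeneralizedEluder (M : Model X A O) (Ps : Finset (Transition X A O)) (d : ℝ)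
    (ξ : ℝ → ℕ → ℝ → ℝ) : Prop :=
  0 ≤ d ∧ ∀ (T : ℕ) (Δ : ℝ), 0 < Δ →
    ∀ (P' : ℕ → Transition X A O) (π : ℕ → Policy X A O), (∀ t ∈ Finset.Icc 1 T, P' t ∈ Ps) →
    (∀ t ∈ Finset.Icc 1 T, ∑ i ∈ Finset.Ico 1 t,
      tv (trajLaw M.d₀ (π i) (P' t) M.H) (trajLaw M.d₀ (π i) M.P M.H) ^ 2 ≤ Δ) →
    ∑ t ∈ Finset.Icc 1 T, tv (trajLaw M.d₀ (π t) (P' t) M.H) (trajLaw M.d₀ (π t) M.P M.H)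
      ≤ ξ d T Δ

end

end MGSHF

/-! The proof separates a deterministic inequality for one round from a statistical statement about
all rounds.

One round. Let `g` be the main policy, the Gibbs policy of the estimated model. The Gibbs
variational identity with its exact defect (`expect_eq_gibbsValue_add_kl`), applied at each step and
telescoped, writes the regularized estimated utility of any policy `π` of finite penalty as the
planner's initial value, minus `η KL(π, g)`, plus the Bellman gap of `π` (`expect_sub_kl_eq`). For
`π*` minus `g` the initial values cancel and the negative KL term of the theorem appears. What
remains of the regret is the uncertainty of `π*` at the true pair, up to the Bellman gap of `g`.
Once the truth lies in the confidence sets, optimism bounds this uncertainty by that of the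
exploration policy `π₂` at its own optimistic pair. Values lie in `[0, B]`, so replacing transitions
costs `O(BH)` trajectory total variations (`regret_round_le`). The rest is an expected difference of
utility gaps on the pairs actually sampled (`expect_sub_expect_le`).

All rounds. Three kinds of nonnegative supermartingales with initial value 1 are used: the square
root of a likelihood ratio, compensated by the squared distance of preference probabilities for
utilities and by the squared total variation for transitions, and an exponential process comparing
conditional means of gaps with observed gaps. The likelihood processes are averaged over their
finite classes, everything is added, and Ville's inequality is applied once
(`le_toOuterMeasure_withinBudget`). On the resulting event, at every round, the truth lies in both
confidence sets and each of their members has in-sample error of order the logarithm.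

The generalized Eluder condition then sums the total variations to `ξ`. The Eluder coefficient sums
the observed gaps to `κ⁻¹ √(d_U T log)`, and concentration passes to expected gaps. Concentration
leaves a term of size (range of the gaps) times log. It is absorbed even for small `d_U`, since the
Eluder inequality at constant sequences bounds the range by `3 B √d_U` (`abs_pairDiff_le`). -/

namespace MGSHF

noncomputable section

universe uX uA uO uZ

variable {X : Type uX} {A : Type uA} {O : Type uO}

/-! ### Expectations under discrete distributions -/

section Expectation

variable {Z Y : Type*}

theorem toReal_pmf_eq_zero {p : PMF Z} {z : Z} (hz : z ∉ p.support) : (p z).toReal = 0 := by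
  rw [(p.apply_eq_zero_iff z).2 hz, ENNReal.toReal_zero]

theorem summable_toReal_pmf (p : PMF Z) : Summable fun z => (p z).toReal :=
  ENNReal.summable_toReal p.tsum_coe_ne_top

theorem tsum_toReal_pmf (p : PMF Z) : ∑' z, (p z).toReal = 1 := by
  rw [← ENNReal.tsum_toReal_eq fun z => p.apply_ne_top z, p.tsum_coe, ENNReal.toReal_one]

/-- `f` is summable against `p`. -/
def Summ (p : PMF Z) (f : Z → ℝ) : Prop := Summable fun z => (p z).toReal * f z

theorem summ_of_bound {p : PMF Z} {f : Z → ℝ} {C : ℝ} (h : ∀ z ∈ p.support, |f z| ≤ C) :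
    Summ p f := by
  refine Summable.of_norm_bounded ((summable_toReal_pmf p).mul_right C) fun z => ?_
  by_cases hz : z ∈ p.support
  · rw [Real.norm_eq_abs, abs_mul, abs_of_nonneg ENNReal.toReal_nonneg]
    exact mul_le_mul_of_nonneg_left (h z hz) ENNReal.toReal_nonneg
  · simp [toReal_pmf_eq_zero hz]

theorem expect_congr {p : PMF Z} {f g : Z → ℝ} (h : ∀ z ∈ p.support, f z = g z) :
    expect p f = expect p g := by
  refine tsum_congr fun z => ?_
  by_cases hz : z ∈ p.support
  · rw [h z hz]
  · rw [toReal_pmf_eq_zero hz, zero_mul, zero_mul]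

theorem Summ.add {p : PMF Z} {f g : Z → ℝ} (hf : Summ p f) (hg : Summ p g) :
    Summ p fun z => f z + g z := by
  have := Summable.add hf hg
  simpa only [Summ, mul_add] using this

theorem Summ.sub {p : PMF Z} {f g : Z → ℝ} (hf : Summ p f) (hg : Summ p g) :
    Summ p fun z => f z - g z := by
  have := Summable.sub hf hg
  simpa only [Summ, mul_sub] using this

theorem Summ.const_mul {p : PMF Z} {f : Z → ℝ} (hf : Summ p f) (c : ℝ) :
    Summ p fun z => c * f z := by
  have := Summable.mul_left c hf
  simpa only [Summ, mul_left_comm] using this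

theorem summ_const (p : PMF Z) (c : ℝ) : Summ p fun _ => c :=
  (summable_toReal_pmf p).mul_right c

theorem expect_add {p : PMF Z} {f g : Z → ℝ} (hf : Summ p f) (hg : Summ p g) :
    expect p (fun z => f z + g z) = expect p f + expect p g := by
  simp only [expect, mul_add]
  exact Summable.tsum_add hf hg

theorem expect_sub {p : PMF Z} {f g : Z → ℝ} (hf : Summ p f) (hg : Summ p g) :
    expect p (fun z => f z - g z) = expect p f - expect p g := by
  simp only [expect, mul_sub]
  exact Summable.tsum_sub hf hg

theorem expect_const_mul (p : PMF Z) (f : Z → ℝ) (c : ℝ) :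
    expect p (fun z => c * f z) = c * expect p f := by
  simp only [expect, mul_left_comm _ c]
  exact tsum_mul_left

theorem expect_const (p : PMF Z) (c : ℝ) : expect p (fun _ => c) = c := by
  simp only [expect]
  rw [tsum_mul_right, tsum_toReal_pmf, one_mul]

theorem expect_mono {p : PMF Z} {f g : Z → ℝ} (hf : Summ p f) (hg : Summ p g)
    (h : ∀ z ∈ p.support, f z ≤ g z) : expect p f ≤ expect p g := by
  refine Summable.tsum_le_tsum (fun z => ?_) hf hg
  by_cases hz : z ∈ p.support
  · exact mul_le_mul_of_nonneg_left (h z hz) ENNReal.toReal_nonneg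
  · rw [toReal_pmf_eq_zero hz, zero_mul, zero_mul]

theorem expect_mem_Icc {p : PMF Z} {f : Z → ℝ} {a b : ℝ}
    (h : ∀ z ∈ p.support, f z ∈ Set.Icc a b) : expect p f ∈ Set.Icc a b := by
  have hs : Summ p f := summ_of_bound (C := max |a| |b|) fun z hz =>
    abs_le_max_abs_abs (h z hz).1 (h z hz).2
  constructor
  · rw [← expect_const p a]
    exact expect_mono (summ_const p a) hs fun z hz => (h z hz).1
  · rw [← expect_const p b]
    exact expect_mono hs (summ_const p b) fun z hz => (h z hz).2

/-- Fubini: a bound on the support alone dominates the double series by a multiple of the joint law.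
-/
theorem expect_bind {p : PMF Z} {k : Z → PMF Y} {f : Y → ℝ} {C : ℝ}
    (h : ∀ y ∈ (p.bind k).support, |f y| ≤ C) :
    expect (p.bind k) f = expect p fun z => expect (k z) f := by
  have hbound : ∀ z y, |(p z).toReal * ((k z y).toReal * f y)| ≤
      (p z).toReal * ((k z y).toReal * C) := by
    intro z y
    rw [abs_mul, abs_mul, abs_of_nonneg ENNReal.toReal_nonneg,
      abs_of_nonneg (ENNReal.toReal_nonneg (a := k z y))]
    by_cases hz : z ∈ p.support
    · by_cases hy : y ∈ (k z).support
      · exact mul_le_mul_of_nonneg_left (mul_le_mul_of_nonneg_left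
          (h y ((PMF.mem_support_bind_iff p k y).2 ⟨z, hz, hy⟩)) ENNReal.toReal_nonneg)
          ENNReal.toReal_nonneg
      · rw [toReal_pmf_eq_zero hy, zero_mul, zero_mul]
    · rw [toReal_pmf_eq_zero hz, zero_mul, zero_mul]
  have hprod : Summable fun w : Z × Y => (p w.1).toReal * ((k w.1 w.2).toReal * 1) := by
    simp only [mul_one]
    refine (summable_prod_of_nonneg fun w =>
      mul_nonneg ENNReal.toReal_nonneg ENNReal.toReal_nonneg).2 ⟨fun z => ?_, ?_⟩
    · exact Summable.mul_left (p z).toReal (summable_toReal_pmf (k z))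
    · simp only [tsum_mul_left, tsum_toReal_pmf, mul_one]
      exact summable_toReal_pmf p
  have hsum : Summable (Function.uncurry fun z y => (p z).toReal * ((k z y).toReal * f y)) := by
    refine Summable.of_norm_bounded (hprod.mul_right C) fun w => ?_
    refine (hbound w.1 w.2).trans_eq ?_
    ring
  calc expect (p.bind k) f = ∑' y, ∑' z, (p z).toReal * ((k z y).toReal * f y) := by
        refine tsum_congr fun y => ?_
        rw [PMF.bind_apply, ENNReal.tsum_toReal_eq fun z =>
          ENNReal.mul_ne_top (p.apply_ne_top z) ((k z).apply_ne_top y), ← tsum_mul_right]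
        refine tsum_congr fun z => ?_
        rw [ENNReal.toReal_mul, mul_assoc]
    _ = ∑' z, ∑' y, (p z).toReal * ((k z y).toReal * f y) := hsum.tsum_comm
    _ = expect p fun z => expect (k z) f := by
        simp only [tsum_mul_left, expect]

theorem expect_pure (z : Z) (f : Z → ℝ) : expect (PMF.pure z) f = f z := by
  rw [expect, tsum_eq_single z]
  · simp
  · intro y hy
    simp [PMF.pure_apply, hy]

theorem expect_map {p : PMF Z} {g : Z → Y} {f : Y → ℝ} {C : ℝ}
    (h : ∀ z ∈ p.support, |f (g z)| ≤ C) :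
    expect (p.map g) f = expect p fun z => f (g z) := by
  rw [← PMF.bind_pure_comp, expect_bind (C := C)]
  · simp only [Function.comp_apply, expect_pure]
  · intro y hy
    rw [PMF.bind_pure_comp] at hy
    obtain ⟨z, hz, rfl⟩ := (PMF.mem_support_map_iff g p y).1 hy
    exact h z hz

/-- Expectation of an extended nonnegative function under a discrete distribution. -/
def lexpect (p : PMF Z) (F : Z → ℝ≥0∞) : ℝ≥0∞ := ∑' z, p z * F z

theorem lexpect_mono {p : PMF Z} {F G : Z → ℝ≥0∞} (h : ∀ z ∈ p.support, F z ≤ G z) :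
    lexpect p F ≤ lexpect p G := by
  refine ENNReal.tsum_le_tsum fun z => ?_
  by_cases hz : z ∈ p.support
  · exact mul_le_mul_right (h z hz) _
  · rw [(p.apply_eq_zero_iff z).2 hz, zero_mul, zero_mul]

theorem lexpect_congr {p : PMF Z} {F G : Z → ℝ≥0∞} (h : ∀ z ∈ p.support, F z = G z) :
    lexpect p F = lexpect p G :=
  le_antisymm (lexpect_mono fun z hz => (h z hz).le) (lexpect_mono fun z hz => (h z hz).ge)

theorem lexpect_const (p : PMF Z) (c : ℝ≥0∞) : lexpect p (fun _ => c) = c := by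
  rw [lexpect, ENNReal.tsum_mul_right, p.tsum_coe, one_mul]

theorem lexpect_const_mul (p : PMF Z) (F : Z → ℝ≥0∞) (c : ℝ≥0∞) :
    lexpect p (fun z => c * F z) = c * lexpect p F := by
  simp only [lexpect, mul_left_comm _ c]
  exact ENNReal.tsum_mul_left

theorem lexpect_add (p : PMF Z) (F G : Z → ℝ≥0∞) :
    lexpect p (fun z => F z + G z) = lexpect p F + lexpect p G := by
  simp only [lexpect, mul_add]
  exact ENNReal.tsum_add

theorem lexpect_sum {ι : Type*} (p : PMF Z) (s : Finset ι) (F : ι → Z → ℝ≥0∞) :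
    lexpect p (fun z => ∑ i ∈ s, F i z) = ∑ i ∈ s, lexpect p (F i) := by
  simp only [lexpect, Finset.mul_sum]
  exact Summable.tsum_finsetSum fun i _ => ENNReal.summable

theorem lexpect_bind (p : PMF Z) (k : Z → PMF Y) (F : Y → ℝ≥0∞) :
    lexpect (p.bind k) F = lexpect p fun z => lexpect (k z) F := by
  simp only [lexpect, PMF.bind_apply, ← ENNReal.tsum_mul_left, ← ENNReal.tsum_mul_right]
  rw [ENNReal.tsum_comm]
  simp only [mul_assoc]

theorem lexpect_pure (z : Z) (F : Z → ℝ≥0∞) : lexpect (PMF.pure z) F = F z := by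
  rw [lexpect, tsum_eq_single z]
  · simp
  · intro y hy
    simp [PMF.pure_apply, hy]

theorem lexpect_map (p : PMF Z) (g : Z → Y) (F : Y → ℝ≥0∞) :
    lexpect (p.map g) F = lexpect p fun z => F (g z) := by
  rw [← PMF.bind_pure_comp, lexpect_bind]
  simp only [Function.comp_apply, lexpect_pure]

theorem lexpect_ofReal {p : PMF Z} {f : Z → ℝ} (hf : Summ p f)
    (h : ∀ z ∈ p.support, 0 ≤ f z) :
    lexpect p (fun z => ENNReal.ofReal (f z)) = ENNReal.ofReal (expect p f) := by
  rw [expect, ENNReal.ofReal_tsum_of_nonneg _ hf]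
  · refine tsum_congr fun z => ?_
    rw [ENNReal.ofReal_mul ENNReal.toReal_nonneg, ENNReal.ofReal_toReal (p.apply_ne_top z)]
  · intro z
    by_cases hz : z ∈ p.support
    · exact mul_nonneg ENNReal.toReal_nonneg (h z hz)
    · rw [toReal_pmf_eq_zero hz, zero_mul]

theorem summ_toReal_of_lexpect_ne_top {p : PMF Z} {F : Z → ℝ≥0∞} (h : lexpect p F ≠ ∞) :
    Summ p fun z => (F z).toReal := by
  have := ENNReal.summable_toReal h
  simpa only [Summ, ENNReal.toReal_mul] using this

theorem ne_top_of_lexpect_ne_top {p : PMF Z} {F : Z → ℝ≥0∞} (h : lexpect p F ≠ ∞) {z : Z}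
    (hz : z ∈ p.support) : F z ≠ ∞ := by
  intro hF
  refine h (ENNReal.tsum_eq_top_of_eq_top ⟨z, ?_⟩)
  rw [hF, ENNReal.mul_top hz]

theorem toReal_lexpect {p : PMF Z} {F : Z → ℝ≥0∞} (h : lexpect p F ≠ ∞) :
    (lexpect p F).toReal = expect p fun z => (F z).toReal := by
  rw [lexpect, ENNReal.tsum_toReal_eq fun z => ENNReal.ne_top_of_tsum_ne_top h z]
  simp only [ENNReal.toReal_mul, expect]

end Expectation

/-! ### Total variation -/

section TotalVariation

variable {Z : Type*}

theorem summable_abs_sub_pmf (p q : PMF Z) : Summable fun z => |(p z).toReal - (q z).toReal| :=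
  ((summable_toReal_pmf p).sub (summable_toReal_pmf q)).abs

theorem tv_nonneg (p q : PMF Z) : 0 ≤ tv p q :=
  mul_nonneg (by norm_num) (tsum_nonneg fun _ => abs_nonneg _)

theorem tv_comm (p q : PMF Z) : tv p q = tv q p := by
  simp only [tv, abs_sub_comm]

theorem tv_triangle (p q r : PMF Z) : tv p r ≤ tv p q + tv q r := by
  simp only [tv, ← mul_add]
  rw [← Summable.tsum_add (summable_abs_sub_pmf p q) (summable_abs_sub_pmf q r)]
  refine mul_le_mul_of_nonneg_left ?_ (by norm_num)
  exact Summable.tsum_le_tsum (fun z => abs_sub_le _ _ _) (summable_abs_sub_pmf p r)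
    ((summable_abs_sub_pmf p q).add (summable_abs_sub_pmf q r))

/-- The factor 2 undoes the 1/2 in `tv`; outside both supports the summand vanishes, so no bound on
`f` is needed there. -/
theorem abs_expect_sub_le {p q : PMF Z} {f : Z → ℝ} {C : ℝ}
    (hp : ∀ z ∈ p.support, |f z| ≤ C) (hq : ∀ z ∈ q.support, |f z| ≤ C) :
    |expect p f - expect q f| ≤ 2 * C * tv p q := by
  have key : ∀ z, |(p z).toReal * f z - (q z).toReal * f z| ≤
      C * |(p z).toReal - (q z).toReal| := by
    intro z
    rw [← sub_mul, abs_mul, mul_comm]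
    by_cases hz : z ∈ p.support
    · exact mul_le_mul_of_nonneg_right (hp z hz) (abs_nonneg _)
    · by_cases hz' : z ∈ q.support
      · exact mul_le_mul_of_nonneg_right (hq z hz') (abs_nonneg _)
      · simp [toReal_pmf_eq_zero hz, toReal_pmf_eq_zero hz']
  have hs := (summable_abs_sub_pmf p q).mul_left C
  have hs' : Summable fun z => |(p z).toReal * f z - (q z).toReal * f z| :=
    Summable.of_nonneg_of_le (fun _ => abs_nonneg _) key hs
  calc |expect p f - expect q f|
      = |∑' z, ((p z).toReal * f z - (q z).toReal * f z)| := by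
        have h1 : Summable fun z => (p z).toReal * f z := summ_of_bound hp
        have h2 : Summable fun z => (q z).toReal * f z := summ_of_bound hq
        rw [expect, expect, h1.tsum_sub h2]
    _ ≤ ∑' z, |(p z).toReal * f z - (q z).toReal * f z| := by
        have := norm_tsum_le_tsum_norm (f := fun z => (p z).toReal * f z - (q z).toReal * f z) hs'
        rwa [Real.norm_eq_abs] at this
    _ ≤ ∑' z, C * |(p z).toReal - (q z).toReal| := hs'.tsum_le_tsum key hs
    _ = 2 * C * tv p q := by rw [tsum_mul_left, tv]; ring

theorem sqrt_mul_le_half_add {a b : ℝ} (ha : 0 ≤ a) (hb : 0 ≤ b) : √(a * b) ≤ (a + b) / 2 := by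
  rw [Real.sqrt_mul ha]
  nlinarith [sq_nonneg (√a - √b), Real.sq_sqrt ha, Real.sq_sqrt hb]

theorem summable_sqrt_mul (p q : PMF Z) : Summable fun z => √((p z).toReal * (q z).toReal) :=
  Summable.of_nonneg_of_le (fun _ => Real.sqrt_nonneg _)
    (fun _ => sqrt_mul_le_half_add ENNReal.toReal_nonneg ENNReal.toReal_nonneg)
    (((summable_toReal_pmf p).add (summable_toReal_pmf q)).div_const 2)

/-- The squared total variation is at most twice the squared Hellinger distance. -/
theorem tsum_sqrt_mul_le (p q : PMF Z) :
    ∑' z, √((p z).toReal * (q z).toReal) ≤ 1 - tv p q ^ 2 / 2 := by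
  set bc := ∑' z, √((p z).toReal * (q z).toReal) with hbc
  have hs := summable_sqrt_mul p q
  have hsp := summable_toReal_pmf p
  have hsq := summable_toReal_pmf q
  have hbc1 : bc ≤ 1 := by
    have := Summable.tsum_le_tsum
      (fun z => sqrt_mul_le_half_add (ENNReal.toReal_nonneg (a := p z))
        (ENNReal.toReal_nonneg (a := q z))) hs ((hsp.add hsq).div_const 2)
    rw [tsum_div_const, hsp.tsum_add hsq, tsum_toReal_pmf, tsum_toReal_pmf] at this
    linarith
  rcases (tv_nonneg p q).eq_or_lt with h0 | h0
  · rw [← h0]; linarith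
  set s := tv p q with hsdef
  -- A pointwise substitute for Cauchy–Schwarz: with `a`, `b` the square roots of the masses, `|a² -
  -- b²| = |a - b| (a + b)` is split by AM-GM with weight `s = tv p q`. Both squares sum to
  -- expressions in the affinity `bc`.
  have key : ∀ z, |(p z).toReal - (q z).toReal| ≤
      ((p z).toReal + (q z).toReal - 2 * √((p z).toReal * (q z).toReal)) * s⁻¹
        + ((p z).toReal + (q z).toReal + 2 * √((p z).toReal * (q z).toReal)) * (s / 4) := by
    intro z
    set a := √(p z).toReal
    set b := √(q z).toReal
    have ha : (p z).toReal = a ^ 2 := (Real.sq_sqrt ENNReal.toReal_nonneg).symm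
    have hb : (q z).toReal = b ^ 2 := (Real.sq_sqrt ENNReal.toReal_nonneg).symm
    have ha0 : 0 ≤ a := Real.sqrt_nonneg _
    have hb0 : 0 ≤ b := Real.sqrt_nonneg _
    have hab : √((p z).toReal * (q z).toReal) = a * b := Real.sqrt_mul ENNReal.toReal_nonneg _
    rw [hab, ha, hb]
    have e1 : |a ^ 2 - b ^ 2| = |a - b| * (a + b) := by
      rw [show a ^ 2 - b ^ 2 = (a - b) * (a + b) by ring, abs_mul,
        abs_of_nonneg (add_nonneg ha0 hb0)]
    rw [e1]
    have e2 : (a ^ 2 + b ^ 2 - 2 * (a * b)) = |a - b| ^ 2 := by rw [sq_abs]; ring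
    have e3 : (a ^ 2 + b ^ 2 + 2 * (a * b)) = (a + b) ^ 2 := by ring
    rw [e2, e3]
    set x := |a - b|
    set y := a + b
    have e4 : x ^ 2 * s⁻¹ + y ^ 2 * (s / 4) - x * y = s⁻¹ * (x - s * y / 2) ^ 2 := by
      field_simp; ring
    have : 0 ≤ s⁻¹ * (x - s * y / 2) ^ 2 := by positivity
    linarith
  have hm : Summable fun z =>
      ((p z).toReal + (q z).toReal - 2 * √((p z).toReal * (q z).toReal)) :=
    (hsp.add hsq).sub (hs.mul_left 2)
  have hpl : Summable fun z =>
      ((p z).toReal + (q z).toReal + 2 * √((p z).toReal * (q z).toReal)) :=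
    (hsp.add hsq).add (hs.mul_left 2)
  have h := Summable.tsum_le_tsum key (summable_abs_sub_pmf p q)
    ((hm.mul_right _).add (hpl.mul_right _))
  rw [(hm.mul_right _).tsum_add (hpl.mul_right _), tsum_mul_right, tsum_mul_right,
    (hsp.add hsq).tsum_sub (hs.mul_left 2), (hsp.add hsq).tsum_add (hs.mul_left 2),
    hsp.tsum_add hsq, tsum_toReal_pmf, tsum_toReal_pmf, tsum_mul_left, ← hbc] at h
  have htv : ∑' z, |(p z).toReal - (q z).toReal| = 2 * s := by rw [hsdef, tv]; ring
  rw [htv] at h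
  -- The second sum is `(2 + 2 bc) s / 4`, at most `s` because `bc ≤ 1`.
  have h2 : 2 * s ≤ (2 - 2 * bc) * s⁻¹ + s := by nlinarith
  have h3 : s * s ≤ 2 - 2 * bc := by
    have : s ≤ (2 - 2 * bc) * s⁻¹ := by linarith
    rwa [← div_eq_mul_inv, le_div_iff₀ h0] at this
  nlinarith

end TotalVariation

/-! ### Gibbs distributions -/

section Gibbs

open MeasureTheory InformationTheory

variable {Z : Type uZ}

theorem toMeasure_eq_sum_dirac [MeasurableSpace Z] (p : PMF Z) :
    p.toMeasure = Measure.sum fun z => p z • Measure.dirac z := by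
  ext s hs
  rw [p.toMeasure_apply hs, Measure.sum_apply _ hs]
  refine tsum_congr fun z => ?_
  rw [Measure.smul_apply, Measure.dirac_apply' _ hs, smul_eq_mul]
  by_cases hz : z ∈ s <;> simp [hz]

theorem lintegral_toMeasure [MeasurableSpace Z] [MeasurableSingletonClass Z] (p : PMF Z)
    (f : Z → ℝ≥0∞) : ∫⁻ z, f z ∂p.toMeasure = ∑' z, p z * f z := by
  rw [toMeasure_eq_sum_dirac, lintegral_sum_measure]
  refine tsum_congr fun z => ?_
  rw [lintegral_smul_measure, lintegral_dirac, smul_eq_mul]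

variable {η B : ℝ} {p₀ : PMF Z} {q : Z → ℝ}

theorem tsum_exp_ne_zero (η : ℝ) (p₀ : PMF Z) (q : Z → ℝ) :
    (∑' z, p₀ z * ENNReal.ofReal (Real.exp (q z / η))) ≠ 0 := by
  intro h
  obtain ⟨z, hz⟩ := p₀.support_nonempty
  have := ENNReal.tsum_eq_zero.1 h z
  rw [mul_eq_zero, ENNReal.ofReal_eq_zero, not_le.2 (Real.exp_pos _) |> iff_false_intro] at this
  exact hz (this.resolve_right id)

theorem exp_div_le (hη : 0 < η) (hq : ∀ z, q z ∈ Set.Icc 0 B) (z : Z) :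
    Real.exp (q z / η) ≤ Real.exp (B / η) :=
  Real.exp_le_exp.2 (div_le_div_of_nonneg_right (hq z).2 hη.le)

theorem tsum_exp_ne_top (hη : 0 < η) (hq : ∀ z, q z ∈ Set.Icc 0 B) :
    (∑' z, p₀ z * ENNReal.ofReal (Real.exp (q z / η))) ≠ ∞ := by
  have h : lexpect p₀ (fun z => ENNReal.ofReal (Real.exp (q z / η))) ≤
      ENNReal.ofReal (Real.exp (B / η)) := by
    rw [← lexpect_const p₀ (ENNReal.ofReal (Real.exp (B / η)))]
    exact lexpect_mono fun z _ => ENNReal.ofReal_le_ofReal (exp_div_le hη hq z)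
  exact ne_top_of_le_ne_top ENNReal.ofReal_ne_top h

theorem integrable_toMeasure_of_mem_Icc [MeasurableSpace Z] [DiscreteMeasurableSpace Z]
    {a b : ℝ} (p : PMF Z) {f : Z → ℝ} (hf : ∀ z, f z ∈ Set.Icc a b) :
    Integrable f p.toMeasure :=
  Integrable.of_mem_Icc a b (Measurable.of_discrete).aemeasurable (Filter.Eventually.of_forall hf)

theorem integral_toMeasure [MeasurableSpace Z] [DiscreteMeasurableSpace Z]
    {p : PMF Z} {f : Z → ℝ} (hf : Integrable f p.toMeasure) :
    ∫ z, f z ∂p.toMeasure = expect p f := by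
  rw [p.integral_eq_tsum f hf]
  rfl

theorem exp_div_mem_Icc (hη : 0 < η) (hq : ∀ z, q z ∈ Set.Icc 0 B) (z : Z) :
    Real.exp (q z / η) ∈ Set.Icc 1 (Real.exp (B / η)) :=
  ⟨Real.one_le_exp (div_nonneg (hq z).1 hη.le), exp_div_le hη hq z⟩

/-- Identifies the Gibbs distribution with an exponential tilt, for which log-likelihood ratios are
known explicitly. -/
theorem gibbs_toMeasure [MeasurableSpace Z] [DiscreteMeasurableSpace Z]
    (hη : 0 < η) (hq : ∀ z, q z ∈ Set.Icc 0 B) :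
    (gibbs η p₀ q).toMeasure = p₀.toMeasure.tilted fun z => q z / η := by
  have hint := integrable_toMeasure_of_mem_Icc p₀ (exp_div_mem_Icc hη hq)
  have hZ : (∑' z, p₀ z * ENNReal.ofReal (Real.exp (q z / η))) =
      ENNReal.ofReal (∫ z, Real.exp (q z / η) ∂p₀.toMeasure) := by
    rw [ofReal_integral_eq_lintegral_ofReal hint
      (Filter.Eventually.of_forall fun z => (Real.exp_pos _).le), lintegral_toMeasure]
  have hZpos : 0 < ∫ z, Real.exp (q z / η) ∂p₀.toMeasure := by
    have := tsum_exp_ne_zero η p₀ q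
    rwa [hZ, Ne, ENNReal.ofReal_eq_zero, not_le] at this
  ext s hs
  rw [PMF.toMeasure_apply _ hs, tilted_apply' _ _ hs, ← lintegral_indicator hs,
    lintegral_toMeasure]
  refine tsum_congr fun z => ?_
  by_cases hz : z ∈ s
  · rw [Set.indicator_of_mem hz, Set.indicator_of_mem hz, gibbs,
      dif_pos ⟨tsum_exp_ne_zero η p₀ q, tsum_exp_ne_top hη hq⟩, PMF.normalize_apply, hZ,
      ENNReal.ofReal_div_of_pos hZpos, mul_assoc, ← div_eq_mul_inv]
  · rw [Set.indicator_of_notMem hz, Set.indicator_of_notMem hz, mul_zero]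

theorem kl_self (p : PMF Z) : kl p p = 0 :=
  let _ : MeasurableSpace Z := ⊤
  klDiv_self p.toMeasure

theorem kl_gibbs_self_ne_top (hη : 0 < η) (hq : ∀ z, q z ∈ Set.Icc 0 B) :
    kl (gibbs η p₀ q) p₀ ≠ ∞ := by
  let _ : MeasurableSpace Z := ⊤
  have hint := integrable_toMeasure_of_mem_Icc p₀ (exp_div_mem_Icc hη hq)
  have hq' : ∀ z, q z / η ∈ Set.Icc 0 (B / η) := fun z =>
    ⟨div_nonneg (hq z).1 hη.le, div_le_div_of_nonneg_right (hq z).2 hη.le⟩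
  refine klDiv_ne_top_iff.2 ?_
  rw [gibbs_toMeasure hη hq]
  refine ⟨tilted_absolutelyContinuous _ _, ?_⟩
  have h := log_rnDeriv_tilted_left_self (μ := p₀.toMeasure) (f := fun z => q z / η) hint
  have h' := (tilted_absolutelyContinuous p₀.toMeasure fun z => q z / η).ae_le h
  refine Integrable.congr ?_ (Filter.EventuallyEq.symm h')
  rw [← gibbs_toMeasure hη hq]
  exact (integrable_toMeasure_of_mem_Icc _ hq').sub (integrable_const _)

theorem kl_gibbs_ne_top (hη : 0 < η) (hq : ∀ z, q z ∈ Set.Icc 0 B) {p : PMF Z}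
    (hp : kl p p₀ ≠ ∞) : kl p (gibbs η p₀ q) ≠ ∞ := by
  let _ : MeasurableSpace Z := ⊤
  have hint := integrable_toMeasure_of_mem_Icc p₀ (exp_div_mem_Icc hη hq)
  have hq' : ∀ z, q z / η ∈ Set.Icc 0 (B / η) := fun z =>
    ⟨div_nonneg (hq z).1 hη.le, div_le_div_of_nonneg_right (hq z).2 hη.le⟩
  obtain ⟨hac, hllr⟩ := klDiv_ne_top_iff.1 hp
  refine klDiv_ne_top_iff.2 ?_
  rw [gibbs_toMeasure hη hq]
  exact ⟨hac.trans (absolutelyContinuous_tilted hint),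
    integrable_llr_tilted_right hac (integrable_toMeasure_of_mem_Icc p hq') hllr hint⟩

/-- The value `E_g[q] - η KL(g, p₀)` of the Gibbs distribution `g`. -/
def gibbsValue (η : ℝ) (p₀ : PMF Z) (q : Z → ℝ) : ℝ :=
  expect (gibbs η p₀ q) q - η * (kl (gibbs η p₀ q) p₀).toReal

/-- The log-density of `p` relative to the Gibbs law is that relative to `p₀`, minus `q / η`, plus
the log partition function; integrate under `p`. Finiteness of `kl p p₀` allows the integral to be
split. -/
theorem expect_eq_log_add_kl (hη : 0 < η) (hq : ∀ z, q z ∈ Set.Icc 0 B) {p : PMF Z}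
    (hp : kl p p₀ ≠ ∞) :
    expect p q = η * Real.log (expect p₀ fun z => Real.exp (q z / η))
      + η * (kl p p₀).toReal - η * (kl p (gibbs η p₀ q)).toReal := by
  let _ : MeasurableSpace Z := ⊤
  have hint := integrable_toMeasure_of_mem_Icc p₀ (exp_div_mem_Icc hη hq)
  have hq' : ∀ z, q z / η ∈ Set.Icc 0 (B / η) := fun z =>
    ⟨div_nonneg (hq z).1 hη.le, div_le_div_of_nonneg_right (hq z).2 hη.le⟩
  have hintq := integrable_toMeasure_of_mem_Icc p hq'
  obtain ⟨hac, hllr⟩ := klDiv_ne_top_iff.1 hp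
  obtain ⟨hac', -⟩ := klDiv_ne_top_iff.1 (kl_gibbs_ne_top hη hq hp)
  have h1 : (kl p p₀).toReal = ∫ z, llr p.toMeasure p₀.toMeasure z ∂p.toMeasure :=
    toReal_klDiv_of_measure_eq hac (by simp)
  have h2 : (kl p (gibbs η p₀ q)).toReal =
      ∫ z, llr p.toMeasure (gibbs η p₀ q).toMeasure z ∂p.toMeasure :=
    toReal_klDiv_of_measure_eq hac' (by simp)
  rw [gibbs_toMeasure hη hq, integral_llr_tilted_right hac hintq hint hllr,
    integral_toMeasure hint, integral_toMeasure hintq, ← h1] at h2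
  have h3 : expect p (fun z => q z / η) = η⁻¹ * expect p q := by
    rw [← expect_const_mul]
    simp only [div_eq_inv_mul]
  rw [h2, h3]
  field_simp
  ring

theorem gibbsValue_eq (hη : 0 < η) (hq : ∀ z, q z ∈ Set.Icc 0 B) :
    gibbsValue η p₀ q = η * Real.log (expect p₀ fun z => Real.exp (q z / η)) := by
  rw [gibbsValue, expect_eq_log_add_kl hη hq (kl_gibbs_self_ne_top hη hq), kl_self]
  simp

theorem expect_eq_gibbsValue_add_kl (hη : 0 < η) (hq : ∀ z, q z ∈ Set.Icc 0 B) {p : PMF Z}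
    (hp : kl p p₀ ≠ ∞) :
    expect p q = gibbsValue η p₀ q
      + η * (kl p p₀).toReal - η * (kl p (gibbs η p₀ q)).toReal := by
  rw [gibbsValue_eq hη hq, expect_eq_log_add_kl hη hq hp]

/-- The value is the soft maximum `η log E[exp(q / η)]`, which stays in the range of `q` for every
`η`. Hence planner values remain in `[0, B]` through the recursion, and the penalty adds no factor
of `H` or `1 / η`. -/
theorem gibbsValue_mem_Icc (hη : 0 < η) (hq : ∀ z, q z ∈ Set.Icc 0 B) :
    gibbsValue η p₀ q ∈ Set.Icc 0 B := by
  have h := expect_mem_Icc (p := p₀) fun z _ => exp_div_mem_Icc hη hq z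
  rw [gibbsValue_eq hη hq]
  refine ⟨mul_nonneg hη.le (Real.log_nonneg h.1), ?_⟩
  have := Real.log_le_log (by linarith [h.1]) h.2
  rw [Real.log_exp, le_div_iff₀ hη] at this
  linarith

/-- The value is nonnegative and the expected `q` is at most `B`, so the penalty `η KL` cannot
exceed `B`. -/
theorem kl_gibbs_self_le (hη : 0 < η) (hq : ∀ z, q z ∈ Set.Icc 0 B) :
    kl (gibbs η p₀ q) p₀ ≤ ENNReal.ofReal (B / η) := by
  rw [← ENNReal.ofReal_toReal (kl_gibbs_self_ne_top hη hq)]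
  refine ENNReal.ofReal_le_ofReal ?_
  have h1 := (gibbsValue_mem_Icc (p₀ := p₀) hη hq).1
  have h2 := (expect_mem_Icc (p := gibbs η p₀ q) fun z _ => hq z).2
  rw [gibbsValue] at h1
  rw [le_div_iff₀ hη]
  linarith

theorem kl_gibbs_le (hη : 0 < η) (hq : ∀ z, q z ∈ Set.Icc 0 B) (p : PMF Z) :
    kl p (gibbs η p₀ q) ≤ kl p p₀ + ENNReal.ofReal (B / η) := by
  by_cases hp : kl p p₀ = ∞
  · rw [hp, top_add]; exact le_top
  have h := expect_eq_gibbsValue_add_kl hη hq hp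
  have h1 := (gibbsValue_mem_Icc (p₀ := p₀) hη hq).2
  have h2 := (expect_mem_Icc (p := p) fun z _ => hq z).1
  have hB : 0 ≤ B := (gibbsValue_mem_Icc (p₀ := p₀) hη hq).1.trans h1
  rw [← ENNReal.ofReal_toReal (kl_gibbs_ne_top hη hq hp), ← ENNReal.ofReal_toReal hp,
    ← ENNReal.ofReal_add ENNReal.toReal_nonneg (div_nonneg hB hη.le)]
  refine ENNReal.ofReal_le_ofReal ?_
  rw [← sub_le_iff_le_add', le_div_iff₀ hη]
  linarith

end Gibbs

/-! ### Laws of states and trajectories -/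

section Laws

theorem of_mem_support_stateLawFrom {π : Policy X A O} {P : Transition X A O} {x : X} {i : ℕ}
    {s : State X A O} (hs : s ∈ (stateLawFrom π P x i).support) : s.1 = x ∧ s.2.length = i := by
  induction i generalizing s with
  | zero =>
    rw [stateLawFrom, PMF.support_pure, Set.mem_singleton_iff] at hs
    subst hs
    exact ⟨rfl, rfl⟩
  | succ i ih =>
    obtain ⟨s', hs', h⟩ := (PMF.mem_support_bind_iff _ _ _).1 hs
    obtain ⟨ao, -, rfl⟩ := (PMF.mem_support_map_iff _ _ _).1 h
    obtain ⟨h1, h2⟩ := ih hs'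
    exact ⟨h1, by simp [push, h2]⟩

theorem length_of_mem_support_stateLaw {d₀ : PMF X} {π : Policy X A O} {P : Transition X A O}
    {i : ℕ} {s : State X A O} (hs : s ∈ (stateLaw d₀ π P i).support) : s.2.length = i := by
  obtain ⟨x, -, hx⟩ := (PMF.mem_support_bind_iff _ _ _).1 hs
  exact (of_mem_support_stateLawFrom hx).2

theorem of_mem_support_trajLawFrom {π : Policy X A O} {P : Transition X A O} {H : ℕ} (hH : 1 ≤ H)
    {x : X} {τ : Traj X A O} (hτ : τ ∈ (trajLawFrom π P H x).support) :
    IsTraj H τ ∧ τ.1.1 = x := by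
  obtain ⟨s, hs, h⟩ := (PMF.mem_support_bind_iff _ _ _).1 hτ
  obtain ⟨a, -, rfl⟩ := (PMF.mem_support_map_iff _ _ _).1 h
  obtain ⟨h1, h2⟩ := of_mem_support_stateLawFrom hs
  refine ⟨?_, h1⟩
  simp only [IsTraj, h2]
  omega

theorem isTraj_of_mem_support_trajLaw {d₀ : PMF X} {π : Policy X A O} {P : Transition X A O}
    {H : ℕ} (hH : 1 ≤ H) {τ : Traj X A O} (hτ : τ ∈ (trajLaw d₀ π P H).support) :
    IsTraj H τ := by
  obtain ⟨x, -, hx⟩ := (PMF.mem_support_bind_iff _ _ _).1 hτ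
  exact (of_mem_support_trajLawFrom hH hx).1

variable (d₀ : PMF X) (π : Policy X A O) (P : Transition X A O)

theorem trajLaw_eq_bind (H : ℕ) :
    trajLaw d₀ π P H = (stateLaw d₀ π P (H - 1)).bind fun s => (π s).map fun a => (s, a) := by
  simp only [trajLaw, trajLawFrom, stateLaw, PMF.bind_bind]

theorem stateLaw_succ (i : ℕ) : stateLaw d₀ π P (i + 1) =
    (transitionLaw d₀ π P i).map fun sao => push sao.1 sao.2.1 sao.2.2 := by
  simp only [stateLaw, stateLawFrom, transitionLaw, PMF.bind_bind, PMF.map_bind, PMF.map_comp]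
  rfl

theorem map_fst_transitionLaw (i : ℕ) :
    (transitionLaw d₀ π P i).map Prod.fst = stateLaw d₀ π P i := by
  simp only [transitionLaw, PMF.map_bind, PMF.map_comp]
  have : ∀ s : State X A O, (Prod.fst ∘ fun ao : A × O => (s, ao)) = Function.const _ s :=
    fun _ => rfl
  simp only [this, PMF.map_const, PMF.bind_pure]

theorem length_of_mem_support_transitionLaw {d₀ : PMF X} {π : Policy X A O}
    {P : Transition X A O} {i : ℕ} {sao : State X A O × A × O}
    (h : sao ∈ (transitionLaw d₀ π P i).support) : sao.1.2.length = i := by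
  have : sao.1 ∈ ((transitionLaw d₀ π P i).map Prod.fst).support :=
    (PMF.mem_support_map_iff _ _ _).2 ⟨sao, h, rfl⟩
  rw [map_fst_transitionLaw] at this
  exact length_of_mem_support_stateLaw this

theorem map_tail_stateLaw_succ (i : ℕ) :
    (stateLaw d₀ π P (i + 1)).map (fun s => (s.1, s.2.tail)) = stateLaw d₀ π P i := by
  rw [stateLaw_succ, PMF.map_comp, ← map_fst_transitionLaw]
  rfl

theorem map_drop_stateLaw (i j : ℕ) :
    (stateLaw d₀ π P (i + j)).map (fun s => (s.1, s.2.drop j)) = stateLaw d₀ π P i := by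
  induction j with
  | zero =>
    simp only [List.drop_zero, Nat.add_zero]
    exact PMF.map_id _
  | succ j ih =>
    rw [← ih, ← map_tail_stateLaw_succ d₀ π P (i + j), PMF.map_comp]
    congr 1
    funext s
    simp [List.drop_tail]

theorem map_fst_trajLaw (H : ℕ) :
    (trajLaw d₀ π P H).map Prod.fst = stateLaw d₀ π P (H - 1) := by
  rw [trajLaw_eq_bind, PMF.map_bind]
  simp only [PMF.map_comp]
  have : ∀ s : State X A O, (Prod.fst ∘ fun a : A => (s, a)) = Function.const _ s :=
    fun _ => rfl
  simp only [this, PMF.map_const, PMF.bind_pure]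

/-- Histories are stored newest first and a trajectory holds `H - 1` pairs, so dropping the `H - 1 -
i` newest recovers the state after `i` interactions. State laws are thus marginals of the trajectory
law, and trajectory total variation controls them all. -/
theorem stateLaw_eq_map_trajLaw {i H : ℕ} (hi : i < H) : stateLaw d₀ π P i =
    (trajLaw d₀ π P H).map fun τ => (τ.1.1, τ.1.2.drop (H - 1 - i)) := by
  have h := map_drop_stateLaw d₀ π P i (H - 1 - i)
  rw [show i + (H - 1 - i) = H - 1 by omega, ← map_fst_trajLaw, PMF.map_comp] at h
  exact h.symm

variable {d₀ π P}

theorem expect_trajLaw {H : ℕ} (hH : 1 ≤ H) {f : Traj X A O → ℝ} {C : ℝ}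
    (hf : ∀ τ, IsTraj H τ → |f τ| ≤ C) :
    expect (trajLaw d₀ π P H) f =
      expect (stateLaw d₀ π P (H - 1)) fun s => expect (π s) fun a => f (s, a) := by
  have hb : ∀ τ ∈ (trajLaw d₀ π P H).support, |f τ| ≤ C := fun τ hτ =>
    hf τ (isTraj_of_mem_support_trajLaw hH hτ)
  rw [trajLaw_eq_bind] at hb ⊢
  rw [expect_bind hb]
  refine expect_congr fun s hs => expect_map (C := C) fun a _ => hf _ ?_
  have := length_of_mem_support_stateLaw hs
  simp only [IsTraj]
  omega

theorem expect_transitionLaw {i : ℕ} {f : State X A O × A × O → ℝ} {C : ℝ}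
    (hf : ∀ s a o, s.2.length = i → |f (s, a, o)| ≤ C) :
    expect (transitionLaw d₀ π P i) f = expect (stateLaw d₀ π P i) fun s =>
      expect (π s) fun a => expect (P s a) fun o => f (s, a, o) := by
  rw [transitionLaw, expect_bind (C := C)]
  · refine expect_congr fun s hs => ?_
    have hl := length_of_mem_support_stateLaw hs
    rw [expect_map (C := C) fun ao _ => hf s ao.1 ao.2 hl, stepLaw,
      expect_bind (C := C) fun ao _ => hf s ao.1 ao.2 hl]
    refine expect_congr fun a _ => expect_map (C := C) fun o _ => hf s a o hl
  · intro y hy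
    obtain ⟨s, hs, h⟩ := (PMF.mem_support_bind_iff _ _ _).1 hy
    obtain ⟨ao, -, rfl⟩ := (PMF.mem_support_map_iff _ _ _).1 h
    exact hf s ao.1 ao.2 (length_of_mem_support_stateLaw hs)

theorem expect_stateLaw_succ {i : ℕ} {f : State X A O → ℝ} {C : ℝ}
    (hf : ∀ s : State X A O, s.2.length = i + 1 → |f s| ≤ C) :
    expect (stateLaw d₀ π P (i + 1)) f =
      expect (transitionLaw d₀ π P i) fun sao => f (push sao.1 sao.2.1 sao.2.2) := by
  rw [stateLaw_succ, expect_map (C := C)]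
  intro sao hsao
  exact hf _ (by simp [push, length_of_mem_support_transitionLaw hsao])

theorem abs_expect_trajLaw_sub_le {P' : Transition X A O} {H : ℕ} (hH : 1 ≤ H)
    {f : Traj X A O → ℝ} {C : ℝ} (hf : ∀ τ, IsTraj H τ → |f τ| ≤ C) :
    |expect (trajLaw d₀ π P H) f - expect (trajLaw d₀ π P' H) f| ≤
      2 * C * tv (trajLaw d₀ π P H) (trajLaw d₀ π P' H) :=
  abs_expect_sub_le (fun τ hτ => hf τ (isTraj_of_mem_support_trajLaw hH hτ))
    fun τ hτ => hf τ (isTraj_of_mem_support_trajLaw hH hτ)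

theorem abs_expect_stateLaw_sub_le {P' : Transition X A O} {i H : ℕ} (hi : i < H)
    {f : State X A O → ℝ} {C : ℝ} (hf : ∀ s : State X A O, s.2.length = i → |f s| ≤ C) :
    |expect (stateLaw d₀ π P i) f - expect (stateLaw d₀ π P' i) f| ≤
      2 * C * tv (trajLaw d₀ π P H) (trajLaw d₀ π P' H) := by
  have hH : 1 ≤ H := by omega
  have hb : ∀ τ : Traj X A O, IsTraj H τ → |f (τ.1.1, τ.1.2.drop (H - 1 - i))| ≤ C := by
    intro τ hτ
    refine hf _ ?_
    simp only [IsTraj] at hτ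
    simp only [List.length_drop]
    omega
  rw [stateLaw_eq_map_trajLaw d₀ π P hi, stateLaw_eq_map_trajLaw d₀ π P' hi,
    expect_map fun τ hτ => hb τ (isTraj_of_mem_support_trajLaw hH hτ),
    expect_map fun τ hτ => hb τ (isTraj_of_mem_support_trajLaw hH hτ)]
  exact abs_expect_trajLaw_sub_le hH hb

end Laws

/-! ### Planning -/

section Planning

variable {η B : ℝ} {N : Model X A O} {πref : Policy X A O}

theorem qStep_mem_Icc (hu : ∀ τ, IsTraj N.H τ → N.u τ ∈ Set.Icc 0 B) {k : ℕ}
    {W : State X A O → ℝ} {s : State X A O} (hs : s.2.length + (k + 1) = N.H)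
    (hW : ∀ s' : State X A O, s'.2.length + k = N.H → W s' ∈ Set.Icc 0 B) (a : A) :
    qStep N k W s a ∈ Set.Icc 0 B := by
  unfold qStep
  split_ifs with hk
  · subst hk
    exact hu _ hs
  · refine expect_mem_Icc fun o _ => hW _ ?_
    simp only [push, List.length_cons]
    omega

theorem valueToGo_mem_Icc (hη : 0 < η) (hB : 0 ≤ B)
    (hu : ∀ τ, IsTraj N.H τ → N.u τ ∈ Set.Icc 0 B) {k : ℕ} {s : State X A O}
    (hs : s.2.length + k = N.H) : valueToGo η N πref k s ∈ Set.Icc 0 B := by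
  induction k generalizing s with
  | zero => exact ⟨le_rfl, hB⟩
  | succ k ih => exact gibbsValue_mem_Icc hη (qStep_mem_Icc hu hs fun s' hs' => ih hs')

theorem V_mem_Icc (hη : 0 < η) (hB : 0 ≤ B)
    (hu : ∀ τ, IsTraj N.H τ → N.u τ ∈ Set.Icc 0 B) {s : State X A O}
    (hs : s.2.length ≤ N.H) : V η N πref s ∈ Set.Icc 0 B :=
  valueToGo_mem_Icc hη hB hu (by omega)

theorem V_eq_zero {s : State X A O} (hs : s.2.length = N.H) : V η N πref s = 0 := by
  rw [V, hs, Nat.sub_self, valueToGo]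

theorem Q_mem_Icc (hη : 0 < η) (hB : 0 ≤ B)
    (hu : ∀ τ, IsTraj N.H τ → N.u τ ∈ Set.Icc 0 B) {s : State X A O}
    (hs : s.2.length < N.H) (a : A) : Q η N πref s a ∈ Set.Icc 0 B := by
  unfold Q
  split_ifs with h
  · exact hu _ h
  · refine expect_mem_Icc fun o _ => V_mem_Icc hη hB hu ?_
    simp only [push, List.length_cons]
    omega

/-- Reconciles the recursion by steps to go with the description of `Q` by history length. -/
theorem V_eq_gibbsValue {s : State X A O} (hs : s.2.length < N.H) :
    V η N πref s = gibbsValue η (πref s) (Q η N πref s) := by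
  obtain ⟨k, hk⟩ : ∃ k, N.H - s.2.length = k + 1 := ⟨N.H - s.2.length - 1, by omega⟩
  have hq : qStep N k (valueToGo η N πref k) s = Q η N πref s := by
    funext a
    unfold qStep Q
    by_cases h : k = 0
    · rw [if_pos h, if_pos (by omega)]
    · rw [if_neg h, if_neg (by omega)]
      refine expect_congr fun o _ => ?_
      rw [V]
      congr 1
      simp only [push, List.length_cons]
      omega
  rw [V, hk, valueToGo, hq, gibbsValue]

theorem gibbsPolicy_eq {s : State X A O} (hs : s.2.length < N.H) :
    gibbsPolicy η N πref s = gibbs η (πref s) (Q η N πref s) := by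
  rw [gibbsPolicy, if_pos hs]

/-- `∑_h E_{π, P} [V_{h+1}(s_{h+1}) - [P_N V_{h+1}](s_h, a_h)]` for the values `V` of the model `N`. -/
def bellmanGap (η : ℝ) (N : Model X A O) (πref π : Policy X A O) (P : Transition X A O) : ℝ :=
  ∑ i ∈ Finset.range N.H, expect (transitionLaw N.d₀ π P i) fun sao =>
    V η N πref (push sao.1 sao.2.1 sao.2.2)
      - expect (N.P sao.1 sao.2.1) fun o => V η N πref (push sao.1 sao.2.1 o)

theorem expect_V_push_mem_Icc (hη : 0 < η) (hB : 0 ≤ B)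
    (hu : ∀ τ, IsTraj N.H τ → N.u τ ∈ Set.Icc 0 B) {s : State X A O}
    (hs : s.2.length < N.H) (a : A) :
    expect (N.P s a) (fun o => V η N πref (push s a o)) ∈ Set.Icc 0 B :=
  expect_mem_Icc fun o _ => V_mem_Icc hη hB hu (by simp only [push, List.length_cons]; omega)

theorem abs_le_of_mem_Icc {a B : ℝ} (ha : a ∈ Set.Icc 0 B) : |a| ≤ B :=
  abs_le.2 ⟨by linarith [ha.1, ha.2], ha.2⟩

theorem abs_sub_le_of_mem_Icc {a b B : ℝ} (ha : a ∈ Set.Icc 0 B) (hb : b ∈ Set.Icc 0 B) :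
    |a - b| ≤ B :=
  abs_le.2 ⟨by linarith [ha.1, hb.2], by linarith [ha.2, hb.1]⟩

/-- The one-step Bellman error has mean zero under the transitions `N.P`. Its mean under `P` is
therefore a difference of expectations of one function of the next state under two laws, with values
in `[-B, B]`. -/
theorem abs_expect_transitionLaw_le (hη : 0 < η) (hB : 0 ≤ B)
    (hu : ∀ τ, IsTraj N.H τ → N.u τ ∈ Set.Icc 0 B) (π : Policy X A O) (P : Transition X A O)
    {i : ℕ} (hi : i < N.H) :
    |expect (transitionLaw N.d₀ π P i) fun sao =>
      V η N πref (push sao.1 sao.2.1 sao.2.2)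
        - expect (N.P sao.1 sao.2.1) fun o => V η N πref (push sao.1 sao.2.1 o)| ≤
      2 * B * tv (trajLaw N.d₀ π P N.H) (trajLaw N.d₀ π N.P N.H) := by
  have hV : ∀ (s : State X A O) a o, s.2.length = i → V η N πref (push s a o) ∈ Set.Icc 0 B :=
    fun s a o hs => V_mem_Icc hη hB hu (by simp only [push, List.length_cons]; omega)
  have hPV : ∀ (s : State X A O) a, s.2.length = i →
      expect (N.P s a) (fun o => V η N πref (push s a o)) ∈ Set.Icc 0 B :=
    fun s a hs => expect_V_push_mem_Icc hη hB hu (by omega) a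
  have hnn : 0 ≤ 2 * B * tv (trajLaw N.d₀ π P N.H) (trajLaw N.d₀ π N.P N.H) :=
    mul_nonneg (by linarith) (tv_nonneg _ _)
  -- The last step is separate: the trajectory does not contain the final observation, but there the
  -- next value is zero.
  rcases Nat.lt_or_ge (i + 1) N.H with hi' | hi'
  -- The Bellman error as a function of the next state: the newest pair of the history gives back
  -- the action and the previous state. The value at the empty history is never used.
  · let G : State X A O → ℝ := fun s => match s.2 with
      | [] => 0
      | (a, _) :: l => V η N πref s - expect (N.P (s.1, l) a) fun o => V η N πref (push (s.1, l) a o)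
    have hG : ∀ s : State X A O, s.2.length = i + 1 → |G s| ≤ B := by
      rintro ⟨x, l⟩ hs
      match l, hs with
      | (a, o) :: l, hs =>
        have hl : l.length = i := by simpa using hs
        exact abs_sub_le_of_mem_Icc (hV (x, l) a o hl) (hPV (x, l) a hl)
    have hzero : expect (stateLaw N.d₀ π N.P (i + 1)) G = 0 := by
      rw [expect_stateLaw_succ hG, expect_transitionLaw (C := B) fun s a o hs =>
        hG (push s a o) (by simp only [push, List.length_cons]; omega),
        ← expect_const (stateLaw N.d₀ π N.P i) 0]
      refine expect_congr fun s hs => ?_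
      have hl := length_of_mem_support_stateLaw hs
      rw [← expect_const (π s) 0]
      refine expect_congr fun a _ => ?_
      change expect (N.P s a) (fun o => V η N πref (push s a o)
        - expect (N.P s a) fun o => V η N πref (push s a o)) = 0
      rw [expect_sub (summ_of_bound (C := B) fun o _ => abs_le_of_mem_Icc (hV s a o hl))
        (summ_const _ _), expect_const, sub_self]
    have h := abs_expect_stateLaw_sub_le (d₀ := N.d₀) (π := π) (P := P) (P' := N.P) hi' hG
    rw [hzero, sub_zero, expect_stateLaw_succ hG] at h
    exact h
  · refine le_of_eq_of_le ?_ hnn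
    rw [abs_eq_zero, ← expect_const (transitionLaw N.d₀ π P i) 0]
    refine expect_congr fun sao hsao => ?_
    have hl := length_of_mem_support_transitionLaw hsao
    have h0 : ∀ a o, V η N πref (push sao.1 a o) = 0 := fun a o =>
      V_eq_zero (by simp only [push, List.length_cons]; omega)
    simp only [h0, expect_const, sub_zero]

theorem abs_bellmanGap_le (hη : 0 < η) (hB : 0 ≤ B)
    (hu : ∀ τ, IsTraj N.H τ → N.u τ ∈ Set.Icc 0 B) (π : Policy X A O) (P : Transition X A O) :
    |bellmanGap η N πref π P| ≤
      2 * B * N.H * tv (trajLaw N.d₀ π P N.H) (trajLaw N.d₀ π N.P N.H) := by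
  refine (Finset.abs_sum_le_sum_abs _ _).trans ?_
  refine (Finset.sum_le_sum fun i hi => abs_expect_transitionLaw_le hη hB hu π P
    (Finset.mem_range.1 hi)).trans_eq ?_
  rw [Finset.sum_const, Finset.card_range, nsmul_eq_mul]
  ring

/-- The KL-regularized value of `π` under the transitions `P`, in terms of the value of the planner
for the model `N`. -/
theorem expect_sub_kl_eq (hη : 0 < η) (hB : 0 ≤ B) (hH : 1 ≤ N.H)
    (hu : ∀ τ, IsTraj N.H τ → N.u τ ∈ Set.Icc 0 B) {π : Policy X A O} {P : Transition X A O}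
    (hkl : ∀ i < N.H, lexpect (stateLaw N.d₀ π P i) (fun s => kl (π s) (πref s)) ≠ ∞) :
    expect (trajLaw N.d₀ π P N.H) N.u
      - η * (∑ i ∈ Finset.range N.H,
          expect (stateLaw N.d₀ π P i) fun s => (kl (π s) (πref s)).toReal) =
    expect (stateLaw N.d₀ π P 0) (V η N πref)
      - η * (∑ i ∈ Finset.range N.H,
          expect (stateLaw N.d₀ π P i) fun s => (kl (π s) (gibbsPolicy η N πref s)).toReal)
      + bellmanGap η N πref π P := by
  set v : ℕ → ℝ := fun i => expect (stateLaw N.d₀ π P i) (V η N πref) with hv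
  set qv : ℕ → ℝ := fun i => expect (stateLaw N.d₀ π P i) fun s =>
    expect (π s) (Q η N πref s) with hqv
  set k₀ : ℕ → ℝ := fun i => expect (stateLaw N.d₀ π P i) fun s => (kl (π s) (πref s)).toReal
  set k₁ : ℕ → ℝ := fun i => expect (stateLaw N.d₀ π P i) fun s =>
    (kl (π s) (gibbsPolicy η N πref s)).toReal
  have hQ : ∀ i < N.H, ∀ s ∈ (stateLaw N.d₀ π P i).support, ∀ a,
      Q η N πref s a ∈ Set.Icc 0 B := fun i hi s hs a =>
    Q_mem_Icc hη hB hu (by rw [length_of_mem_support_stateLaw hs]; exact hi) a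
  have hVI : ∀ i ≤ N.H, ∀ s ∈ (stateLaw N.d₀ π P i).support,
      V η N πref s ∈ Set.Icc 0 B := fun i hi s hs =>
    V_mem_Icc hη hB hu (by rw [length_of_mem_support_stateLaw hs]; exact hi)
  have hstep : ∀ i < N.H, qv i = v i + η * k₀ i - η * k₁ i := by
    intro i hi
    have hsV : Summ (stateLaw N.d₀ π P i) (V η N πref) :=
      summ_of_bound fun s hs => abs_le_of_mem_Icc (hVI i hi.le s hs)
    have hsQ : Summ (stateLaw N.d₀ π P i) fun s => expect (π s) (Q η N πref s) :=
      summ_of_bound (C := B) fun s hs =>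
        abs_le_of_mem_Icc (expect_mem_Icc fun a _ => hQ i hi s hs a)
    have hs0 := summ_toReal_of_lexpect_ne_top (hkl i hi)
    -- The identity is solved for the KL to the Gibbs policy, so its expectation is computed from
    -- three summable terms and its own summability need not be shown first.
    have hpt : ∀ s ∈ (stateLaw N.d₀ π P i).support,
        η * (kl (π s) (gibbsPolicy η N πref s)).toReal =
          V η N πref s + η * (kl (π s) (πref s)).toReal - expect (π s) (Q η N πref s) := by
      intro s hs
      have hl : s.2.length < N.H := by rw [length_of_mem_support_stateLaw hs]; exact hi
      rw [expect_eq_gibbsValue_add_kl hη (hQ i hi s hs) (ne_top_of_lexpect_ne_top (hkl i hi) hs),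
        V_eq_gibbsValue hl, gibbsPolicy_eq hl]
      ring
    have h1 := expect_congr hpt
    rw [expect_const_mul, expect_sub (hsV.add (hs0.const_mul η)) hsQ,
      expect_add hsV (hs0.const_mul η), expect_const_mul] at h1
    simp only [v, qv, k₀, k₁]
    linarith
  obtain ⟨n, hn⟩ : ∃ n, N.H = n + 1 := ⟨N.H - 1, by omega⟩
  have hlast : expect (trajLaw N.d₀ π P N.H) N.u = qv n := by
    rw [expect_trajLaw hH fun τ hτ => abs_le_of_mem_Icc (hu τ hτ), hn, Nat.add_sub_cancel]
    refine expect_congr fun s hs => expect_congr fun a _ => ?_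
    rw [Q, if_pos (by rw [length_of_mem_support_stateLaw hs, hn])]
  -- For `h < H` the planner's backup is `Q_h` itself, so each summand is `E[V_{h+1}] - E[Q_h]`; the
  -- summand of the last step is zero.
  have hgap : bellmanGap η N πref π P = ∑ i ∈ Finset.range n, (v (i + 1) - qv i) := by
    rw [bellmanGap, hn, Finset.sum_range_succ]
    have hz : expect (transitionLaw N.d₀ π P n) (fun sao =>
        V η N πref (push sao.1 sao.2.1 sao.2.2)
          - expect (N.P sao.1 sao.2.1) fun o => V η N πref (push sao.1 sao.2.1 o)) = 0 := by
      rw [← expect_const (transitionLaw N.d₀ π P n) 0]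
      refine expect_congr fun sao hsao => ?_
      have hl := length_of_mem_support_transitionLaw hsao
      have h0 : ∀ a o, V η N πref (push sao.1 a o) = 0 := fun a o =>
        V_eq_zero (by simp only [push, List.length_cons]; omega)
      simp only [h0, expect_const, sub_zero]
    rw [hz, add_zero]
    refine Finset.sum_congr rfl fun i hi => ?_
    have hi' : i < n := Finset.mem_range.1 hi
    have hV : ∀ (s : State X A O) a o, s.2.length = i →
        V η N πref (push s a o) ∈ Set.Icc 0 B :=
      fun s a o hs => V_mem_Icc hη hB hu (by simp only [push, List.length_cons]; omega)
    have hPV : ∀ (s : State X A O) a, s.2.length = i →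
        expect (N.P s a) (fun o => V η N πref (push s a o)) ∈ Set.Icc 0 B :=
      fun s a hs => expect_V_push_mem_Icc hη hB hu (by omega) a
    have hsupp : ∀ sao ∈ (transitionLaw N.d₀ π P i).support, sao.1.2.length = i :=
      fun _ => length_of_mem_support_transitionLaw
    rw [expect_sub
      (summ_of_bound (C := B) fun sao h => abs_le_of_mem_Icc (hV _ _ _ (hsupp sao h)))
      (summ_of_bound (C := B) fun sao h => abs_le_of_mem_Icc (hPV _ _ (hsupp sao h)))]
    congr 1
    · exact (expect_stateLaw_succ (f := V η N πref) (C := B) fun s hs =>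
        abs_le_of_mem_Icc (V_mem_Icc hη hB hu (by omega))).symm
    · rw [expect_transitionLaw (C := B) fun s a o hs => abs_le_of_mem_Icc (hPV s a hs)]
      refine expect_congr fun s hs => expect_congr fun a _ => ?_
      rw [Q, if_neg (by rw [length_of_mem_support_stateLaw hs]; omega)]
      exact expect_const (P s a) (expect (N.P s a) fun o => V η N πref (push s a o))
  -- Inserting the per-step identity turns `E[V_{h+1}] - E[Q_h]` into a telescoping difference of
  -- values plus KL terms.
  have htel : ∑ i ∈ Finset.range n, (v (i + 1) - qv i) =
      (v n - v 0) - η * ∑ i ∈ Finset.range n, k₀ i + η * ∑ i ∈ Finset.range n, k₁ i := by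
    rw [← Finset.sum_range_sub v n, Finset.mul_sum, Finset.mul_sum, ← Finset.sum_sub_distrib,
      ← Finset.sum_add_distrib]
    refine Finset.sum_congr rfl fun i hi => ?_
    rw [hstep i (by rw [hn]; exact (Finset.mem_range.1 hi).trans (Nat.lt_succ_self n))]
    ring
  have hqn := hstep n (by omega)
  rw [hlast, hgap, htel, hn, Finset.sum_range_succ, Finset.sum_range_succ, hqn]
  ring

end Planning

/-! ### Regret of the main policy in one round -/

section OneRound

variable {η B : ℝ} {M : Model X A O} {π₀ : Policy X A O}

theorem lexpect_ne_top_of_klAlong_ne_top {π π' : Policy X A O} (h : klAlong M π π' ≠ ∞) :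
    ∀ i < M.H, lexpect (stateLaw M.d₀ π M.P i) (fun s => kl (π s) (π' s)) ≠ ∞ := fun i hi =>
  (ENNReal.sum_ne_top.1 h) i (Finset.mem_range.2 hi)

theorem toReal_klAlong {π π' : Policy X A O} (h : klAlong M π π' ≠ ∞) :
    (klAlong M π π').toReal = ∑ i ∈ Finset.range M.H,
      expect (stateLaw M.d₀ π M.P i) fun s => (kl (π s) (π' s)).toReal := by
  refine (ENNReal.toReal_sum fun i hi =>
    lexpect_ne_top_of_klAlong_ne_top h i (Finset.mem_range.1 hi)).trans ?_
  exact Finset.sum_congr rfl fun i hi =>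
    toReal_lexpect (lexpect_ne_top_of_klAlong_ne_top h i (Finset.mem_range.1 hi))

theorem klAlong_self (π : Policy X A O) : klAlong M π π = 0 := by
  simp [klAlong, kl_self]

theorem coe_ofReal_mul (hη : 0 ≤ η) {k : ℝ≥0∞} (hk : k ≠ ∞) :
    ((ENNReal.ofReal η * k : ℝ≥0∞) : EReal) = ((η * k.toReal : ℝ) : EReal) := by
  rw [← ENNReal.ofReal_toReal hk, ← ENNReal.ofReal_mul hη, EReal.coe_ennreal_ofReal,
    ENNReal.toReal_ofReal ENNReal.toReal_nonneg,
    max_eq_left (mul_nonneg hη ENNReal.toReal_nonneg)]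

theorem J_eq_coe (hη : 0 ≤ η) {π : Policy X A O} (h : klAlong M π π₀ ≠ ∞) :
    J η M π₀ π = ((expect (trajLaw M.d₀ π M.P M.H) M.u - η * (klAlong M π π₀).toReal : ℝ) :
      EReal) := by
  rw [J, coe_ofReal_mul hη h, EReal.coe_sub]

/-- The reference policy has zero penalty, hence a finite objective; a policy of infinite penalty
has objective `-∞` and cannot be optimal. -/
theorem klAlong_ne_top_of_isOptimal (hη : 0 < η) {π : Policy X A O} (h : IsOptimal η M π₀ π) :
    klAlong M π π₀ ≠ ∞ := by
  intro htop
  have h' := h π₀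
  rw [J_eq_coe hη.le (by rw [klAlong_self]; exact ENNReal.zero_ne_top), J, htop,
    ENNReal.mul_top (by simpa using hη), EReal.coe_ennreal_top, EReal.sub_top] at h'
  exact EReal.coe_ne_bot _ (le_bot_iff.1 h')

variable {P' : Transition X A O} {u' : Utility X A O}

theorem klAlong_gibbsPolicy_ne_top (hη : 0 < η) (hB : 0 ≤ B)
    (hu : ∀ τ, IsTraj M.H τ → u' τ ∈ Set.Icc 0 B) :
    klAlong M (gibbsPolicy η { M with P := P', u := u' } π₀) π₀ ≠ ∞ := by
  refine ENNReal.sum_ne_top.2 fun i hi => ?_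
  have hi' := Finset.mem_range.1 hi
  set N : Model X A O := { M with P := P', u := u' }
  have h : lexpect (stateLaw M.d₀ (gibbsPolicy η N π₀) M.P i)
      (fun s => kl (gibbsPolicy η N π₀ s) (π₀ s)) ≤ ENNReal.ofReal (B / η) := by
    rw [← lexpect_const (stateLaw M.d₀ (gibbsPolicy η N π₀) M.P i) (ENNReal.ofReal (B / η))]
    refine lexpect_mono fun s hs => ?_
    have hl : s.2.length < N.H := by rw [length_of_mem_support_stateLaw hs]; exact hi'
    rw [gibbsPolicy_eq hl]
    exact kl_gibbs_self_le hη (Q_mem_Icc hη hB hu hl)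
  exact ne_top_of_le_ne_top ENNReal.ofReal_ne_top h

theorem klAlong_to_gibbsPolicy_ne_top (hη : 0 < η) (hB : 0 ≤ B)
    (hu : ∀ τ, IsTraj M.H τ → u' τ ∈ Set.Icc 0 B) {π : Policy X A O}
    (hπ : klAlong M π π₀ ≠ ∞) :
    klAlong M π (gibbsPolicy η { M with P := P', u := u' } π₀) ≠ ∞ := by
  refine ENNReal.sum_ne_top.2 fun i hi => ?_
  have hi' := Finset.mem_range.1 hi
  set N : Model X A O := { M with P := P', u := u' }
  have h : lexpect (stateLaw M.d₀ π M.P i) (fun s => kl (π s) (gibbsPolicy η N π₀ s)) ≤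
      lexpect (stateLaw M.d₀ π M.P i) (fun s => kl (π s) (π₀ s)) + ENNReal.ofReal (B / η) := by
    rw [← lexpect_const (stateLaw M.d₀ π M.P i) (ENNReal.ofReal (B / η)), ← lexpect_add]
    refine lexpect_mono fun s hs => ?_
    have hl : s.2.length < N.H := by rw [length_of_mem_support_stateLaw hs]; exact hi'
    rw [gibbsPolicy_eq hl]
    exact kl_gibbs_le hη (Q_mem_Icc hη hB hu hl) _
  exact ne_top_of_le_ne_top (ENNReal.add_ne_top.2
    ⟨lexpect_ne_top_of_klAlong_ne_top hπ i hi', ENNReal.ofReal_ne_top⟩) h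

/-- Total variation distance of the trajectory laws of `π` under `P'` and under the true model. -/
def tvTraj (M : Model X A O) (π : Policy X A O) (P' : Transition X A O) : ℝ :=
  tv (trajLaw M.d₀ π P' M.H) (trajLaw M.d₀ π M.P M.H)

theorem tvTraj_nonneg (π : Policy X A O) : 0 ≤ tvTraj M π P' := tv_nonneg _ _

/-- Subtracting the planner identity for `g` from that for `πstar` leaves Bellman gaps and `-η
KL(πstar, g)`. With the gap of `πstar`, the difference between `M.u` and `u'` forms the left side of
`hopt`; after optimism, `P₂` is exchanged for the true transitions. -/
theorem regret_round_le (hη : 0 < η) (hB : 0 ≤ B) (hH : 1 ≤ M.H)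
    (hu' : ∀ τ, IsTraj M.H τ → u' τ ∈ Set.Icc 0 B)
    {πstar π₂ : Policy X A O} (hπ : klAlong M πstar π₀ ≠ ∞)
    {u₂ : Utility X A O} {P₂ : Transition X A O}
    (hu₂ : ∀ τ, IsTraj M.H τ → u₂ τ ∈ Set.Icc 0 B) {g : Policy X A O}
    (hg : g = gibbsPolicy η { M with P := P', u := u' } π₀)
    (hopt : uncertainty η { M with P := P', u := u' } π₀ g πstar M.u M.P ≤
      uncertainty η { M with P := P', u := u' } π₀ g π₂ u₂ P₂) :
    (expect (trajLaw M.d₀ πstar M.P M.H) M.u - η * (klAlong M πstar π₀).toReal)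
      - (expect (trajLaw M.d₀ g M.P M.H) M.u - η * (klAlong M g π₀).toReal) ≤
    expect (trajLaw M.d₀ π₂ M.P M.H) (fun τ => u₂ τ - u' τ)
      - expect (trajLaw M.d₀ g M.P M.H) (fun τ => u₂ τ - u' τ)
      + 4 * B * M.H * (tvTraj M g P₂ + tvTraj M π₂ P₂ + tvTraj M g P' + tvTraj M π₂ P')
      - η * (klAlong M πstar g).toReal := by
  have hgfin : klAlong M g π₀ ≠ ∞ := by rw [hg]; exact klAlong_gibbsPolicy_ne_top hη hB hu'
  have hsg : klAlong M πstar g ≠ ∞ := by rw [hg]; exact klAlong_to_gibbsPolicy_ne_top hη hB hu' hπ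
  set N : Model X A O := { M with P := P', u := u' } with hN
  have huN : ∀ τ, IsTraj N.H τ → N.u τ ∈ Set.Icc 0 B := hu'
  have e1 := expect_sub_kl_eq (N := N) (P := M.P) hη hB hH huN
    (lexpect_ne_top_of_klAlong_ne_top hπ)
  have e2 := expect_sub_kl_eq (N := N) (P := M.P) hη hB hH huN
    (lexpect_ne_top_of_klAlong_ne_top hgfin)
  rw [← hg] at e1 e2
  change expect (trajLaw M.d₀ πstar M.P M.H) u' - η * (∑ i ∈ Finset.range M.H,
    expect (stateLaw M.d₀ πstar M.P i) fun s => (kl (πstar s) (π₀ s)).toReal) =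
    expect (stateLaw M.d₀ πstar M.P 0) (V η N π₀) - η * (∑ i ∈ Finset.range M.H,
    expect (stateLaw M.d₀ πstar M.P i) fun s => (kl (πstar s) (g s)).toReal) + _ at e1
  change expect (trajLaw M.d₀ g M.P M.H) u' - η * (∑ i ∈ Finset.range M.H,
    expect (stateLaw M.d₀ g M.P i) fun s => (kl (g s) (π₀ s)).toReal) =
    expect (stateLaw M.d₀ g M.P 0) (V η N π₀) - η * (∑ i ∈ Finset.range M.H,
    expect (stateLaw M.d₀ g M.P i) fun s => (kl (g s) (g s)).toReal) + _ at e2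
  have hgg : klAlong M g g = 0 := klAlong_self g
  rw [← toReal_klAlong hπ, ← toReal_klAlong hsg] at e1
  rw [← toReal_klAlong hgfin, ← toReal_klAlong (by rw [hgg]; exact ENNReal.zero_ne_top), hgg,
    ENNReal.toReal_zero, mul_zero] at e2
  -- The first state is the prompt, whose law depends on no policy, so the initial values cancel.
  have e0 : stateLaw M.d₀ πstar M.P 0 = stateLaw M.d₀ g M.P 0 := rfl
  rw [e0] at e1
  change expect (trajLaw M.d₀ πstar M.P M.H) M.u - expect (trajLaw M.d₀ g M.P M.H) M.u
    - (expect (trajLaw M.d₀ πstar M.P M.H) u' - expect (trajLaw M.d₀ g M.P M.H) u')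
    + bellmanGap η N π₀ πstar M.P ≤
    expect (trajLaw M.d₀ π₂ P₂ M.H) u₂ - expect (trajLaw M.d₀ g P₂ M.H) u₂
    - (expect (trajLaw M.d₀ π₂ P₂ M.H) u' - expect (trajLaw M.d₀ g P₂ M.H) u')
    + bellmanGap η N π₀ π₂ P₂ at hopt
  have hsub : ∀ (π : Policy X A O) (P : Transition X A O),
      expect (trajLaw M.d₀ π P M.H) (fun τ => u₂ τ - u' τ) =
        expect (trajLaw M.d₀ π P M.H) u₂ - expect (trajLaw M.d₀ π P M.H) u' := fun π P =>
    expect_sub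
      (summ_of_bound fun τ hτ => abs_le_of_mem_Icc (hu₂ τ (isTraj_of_mem_support_trajLaw hH hτ)))
      (summ_of_bound fun τ hτ => abs_le_of_mem_Icc (hu' τ (isTraj_of_mem_support_trajLaw hH hτ)))
  have hd : ∀ τ, IsTraj M.H τ → |u₂ τ - u' τ| ≤ B := fun τ hτ =>
    abs_sub_le_of_mem_Icc (hu₂ τ hτ) (hu' τ hτ)
  have b1 := abs_expect_trajLaw_sub_le (d₀ := M.d₀) (π := π₂) (P := P₂) (P' := M.P) hH hd
  have b2 := abs_expect_trajLaw_sub_le (d₀ := M.d₀) (π := g) (P := P₂) (P' := M.P) hH hd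
  have b3 := abs_bellmanGap_le (πref := π₀) hη hB huN π₂ P₂
  have b4 := abs_bellmanGap_le (πref := π₀) hη hB huN g M.P
  change _ ≤ 2 * B * M.H * tv (trajLaw M.d₀ π₂ P₂ M.H) (trajLaw M.d₀ π₂ P' M.H) at b3
  change _ ≤ 2 * B * M.H * tv (trajLaw M.d₀ g M.P M.H) (trajLaw M.d₀ g P' M.H) at b4
  -- The gap of `π₂` under `P₂` compares `P₂` with `P'`, while only distances to the truth are
  -- summable over rounds.
  have b5 := tv_triangle (trajLaw M.d₀ π₂ P₂ M.H) (trajLaw M.d₀ π₂ M.P M.H)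
    (trajLaw M.d₀ π₂ P' M.H)
  rw [tv_comm (trajLaw M.d₀ π₂ M.P M.H)] at b5
  rw [tv_comm] at b4
  change |_| ≤ 2 * B * tvTraj M π₂ P₂ at b1
  change |_| ≤ 2 * B * tvTraj M g P₂ at b2
  change |_| ≤ 2 * B * M.H * tvTraj M g P' at b4
  change _ ≤ tvTraj M π₂ P₂ + tvTraj M π₂ P' at b5
  have hBH : 0 ≤ 2 * B * M.H := by positivity
  have hH' : (1 : ℝ) ≤ M.H := by exact_mod_cast hH
  have b6 := mul_le_mul_of_nonneg_left b5 hBH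
  have n1 := tvTraj_nonneg (M := M) (P' := P₂) π₂
  have n2 := tvTraj_nonneg (M := M) (P' := P₂) g
  have n3 := tvTraj_nonneg (M := M) (P' := P') π₂
  have n4 := tvTraj_nonneg (M := M) (P' := P') g
  -- The distance for `(π₂, P₂)` occurs twice, in the change of transitions and in the Bellman gap:
  -- hence the 4. The other three occur once, with coefficient at most `2 B H`.
  have b7 : 2 * B * tvTraj M π₂ P₂ ≤ 2 * B * M.H * tvTraj M π₂ P₂ :=
    mul_le_mul_of_nonneg_right (le_mul_of_one_le_right (by linarith) hH') n1
  have b8 : 2 * B * tvTraj M g P₂ ≤ 2 * B * M.H * tvTraj M g P₂ :=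
    mul_le_mul_of_nonneg_right (le_mul_of_one_le_right (by linarith) hH') n2
  have m1 := mul_nonneg hBH n1
  have m2 := mul_nonneg hBH n2
  have m3 := mul_nonneg hBH n3
  have m4 := mul_nonneg hBH n4
  rw [hsub, hsub] at b1 b2 ⊢
  have c1 := (abs_le.1 b1).2
  have c2 := (abs_le.1 b2).1
  have c3 := (abs_le.1 b3).2
  have c4 := (abs_le.1 b4).1
  linarith

end OneRound

/-! ### The law of the data -/

section DataLaw

variable {L : Learner X A O} {M : Model X A O} {η : ℝ} {π₀ : Policy X A O}

/-- Law of the next round, given the data of the previous ones. -/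
def stepRound (L : Learner X A O) (M : Model X A O) (η : ℝ) (π₀ : Policy X A O)
    (D : Data X A O) : PMF (Sample X A O) :=
  roundLaw M (L.main M η π₀ D) (L.explore D)

theorem lexpect_dataLaw_succ (n : ℕ) (F : Data X A O → ℝ≥0∞) :
    lexpect (dataLaw L M η π₀ (n + 1)) F =
      lexpect (dataLaw L M η π₀ n) fun D =>
        lexpect (stepRound L M η π₀ D) fun e => F (e :: D) := by
  rw [dataLaw, lexpect_bind]
  simp only [lexpect_map, stepRound]

theorem length_of_mem_support_dataLaw {n : ℕ} {D : Data X A O}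
    (hD : D ∈ (dataLaw L M η π₀ n).support) : D.length = n := by
  induction n generalizing D with
  | zero =>
    rw [dataLaw, PMF.support_pure, Set.mem_singleton_iff] at hD
    rw [hD, List.length_nil]
  | succ n ih =>
    obtain ⟨D', hD', h⟩ := (PMF.mem_support_bind_iff _ _ _).1 hD
    obtain ⟨e, -, rfl⟩ := (PMF.mem_support_map_iff _ _ _).1 h
    rw [List.length_cons, ih hD']

/-- Data are stored newest first, so the suffixes of a data set are its earlier states of knowledge
and `e` is the round played from `D'`. -/
theorem of_cons_suffix_of_mem_support_dataLaw {n : ℕ} {D D' : Data X A O} {e : Sample X A O}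
    (hD : D ∈ (dataLaw L M η π₀ n).support) (h : e :: D' <:+ D) :
    D'.length < n ∧ D' ∈ (dataLaw L M η π₀ D'.length).support ∧
      e ∈ (stepRound L M η π₀ D').support := by
  induction n generalizing D with
  | zero =>
    rw [dataLaw, PMF.support_pure, Set.mem_singleton_iff] at hD
    subst hD
    simp at h
  | succ n ih =>
    obtain ⟨D₁, hD₁, h₁⟩ := (PMF.mem_support_bind_iff _ _ _).1 hD
    obtain ⟨e₁, he₁, rfl⟩ := (PMF.mem_support_map_iff _ _ _).1 h₁
    rcases List.suffix_cons_iff.1 h with h | h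
    · obtain ⟨rfl, rfl⟩ := List.cons_eq_cons.1 h
      have := length_of_mem_support_dataLaw hD₁
      rw [this]
      exact ⟨Nat.lt_succ_self n, hD₁, he₁⟩
    · obtain ⟨h1, h2⟩ := ih hD₁ h
      exact ⟨h1.trans (Nat.lt_succ_self n), h2⟩

theorem of_mem_support_roundLaw (hH : 1 ≤ M.H) {π₁ π₂ : Policy X A O} {e : Sample X A O}
    (he : e ∈ (roundLaw M π₁ π₂).support) :
    (e.pol₁ = π₁ ∧ e.pol₂ = π₂) ∧
      (IsTraj M.H e.traj₁ ∧ IsTraj M.H e.traj₂ ∧ e.traj₁.1.1 = e.traj₂.1.1) ∧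
      e.traj₁ ∈ (trajLaw M.d₀ π₁ M.P M.H).support ∧
      e.traj₂ ∈ (trajLaw M.d₀ π₂ M.P M.H).support := by
  obtain ⟨x, hx, h⟩ := (PMF.mem_support_bind_iff _ _ _).1 he
  obtain ⟨τ₁, h₁, h⟩ := (PMF.mem_support_bind_iff _ _ _).1 h
  obtain ⟨τ₂, h₂, h⟩ := (PMF.mem_support_bind_iff _ _ _).1 h
  obtain ⟨z, -, rfl⟩ := (PMF.mem_support_map_iff _ _ _).1 h
  obtain ⟨a₁, b₁⟩ := of_mem_support_trajLawFrom hH h₁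
  obtain ⟨a₂, b₂⟩ := of_mem_support_trajLawFrom hH h₂
  exact ⟨⟨rfl, rfl⟩, ⟨a₁, a₂, b₁.trans b₂.symm⟩,
    (PMF.mem_support_bind_iff _ _ _).2 ⟨x, hx, h₁⟩, (PMF.mem_support_bind_iff _ _ _).2 ⟨x, hx, h₂⟩⟩

theorem map_traj₁_roundLaw (π₁ π₂ : Policy X A O) :
    (roundLaw M π₁ π₂).map Sample.traj₁ = trajLaw M.d₀ π₁ M.P M.H := by
  simp only [roundLaw, PMF.map_bind, PMF.map_comp, trajLaw]
  congr 1
  funext x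
  conv_rhs => rw [← PMF.bind_pure (trajLawFrom π₁ M.P M.H x)]
  congr 1
  funext τ₁
  have : ∀ τ₂ : Traj X A O, (Sample.traj₁ ∘ fun z => (⟨π₁, π₂, τ₁, τ₂, z⟩ : Sample X A O)) =
    Function.const _ τ₁ := fun _ => rfl
  simp only [this, PMF.map_const, PMF.bind_const]

theorem map_traj₂_roundLaw (π₁ π₂ : Policy X A O) :
    (roundLaw M π₁ π₂).map Sample.traj₂ = trajLaw M.d₀ π₂ M.P M.H := by
  simp only [roundLaw, PMF.map_bind, PMF.map_comp, trajLaw]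
  congr 1
  funext x
  have : ∀ τ₁ τ₂ : Traj X A O, (Sample.traj₂ ∘ fun z => (⟨π₁, π₂, τ₁, τ₂, z⟩ : Sample X A O)) =
    Function.const _ τ₂ := fun _ _ => rfl
  simp only [this, PMF.map_const, PMF.bind_const, PMF.bind_pure]

end DataLaw

/-! ### A maximal inequality -/

section Maximal

variable {L : Learner X A O} {M : Model X A O} {η : ℝ} {π₀ : Policy X A O}

/-- A nonnegative supermartingale along the data. -/
def IsSupermart (L : Learner X A O) (M : Model X A O) (η : ℝ) (π₀ : Policy X A O)
    (W : Data X A O → ℝ≥0∞) : Prop :=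
  ∀ D, lexpect (stepRound L M η π₀ D) (fun e => W (e :: D)) ≤ W D

open scoped Classical in
/-- The process `W`, stopped when it reaches the level `c`. -/
def stoppedAt (W : Data X A O → ℝ≥0∞) (c : ℝ≥0∞) : Data X A O → ℝ≥0∞
  | [] => W []
  | e :: D => if c ≤ stoppedAt W c D then stoppedAt W c D else W (e :: D)

/-- The stopped process freezes at its first crossing, so its final value remembers every earlier
crossing. -/
theorem le_stoppedAt {W : Data X A O → ℝ≥0∞} {c : ℝ≥0∞} {D D' : Data X A O} (h : D' <:+ D)
    (hc : c ≤ W D') : c ≤ stoppedAt W c D := by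
  induction D with
  | nil =>
    rw [List.suffix_nil.1 h] at hc
    exact hc
  | cons e D ih =>
    rw [stoppedAt]
    split_ifs with h1
    · exact h1
    · rcases List.suffix_cons_iff.1 h with h | h
      · rwa [← h]
      · exact absurd (ih h) h1

theorem stoppedAt_eq {W : Data X A O → ℝ≥0∞} {c : ℝ≥0∞} {D : Data X A O}
    (h : ¬ c ≤ stoppedAt W c D) : stoppedAt W c D = W D := by
  cases D with
  | nil => rfl
  | cons e D =>
    rw [stoppedAt] at h ⊢
    split_ifs at h ⊢ with h1
    · exact absurd h1 h
    · rfl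

theorem IsSupermart.stoppedAt {W : Data X A O → ℝ≥0∞} (hW : IsSupermart L M η π₀ W) (c : ℝ≥0∞) :
    IsSupermart L M η π₀ (stoppedAt W c) := by
  intro D
  simp only [MGSHF.stoppedAt]
  split_ifs with h
  · rw [lexpect_const]
  · rw [stoppedAt_eq h]
    exact hW D

theorem IsSupermart.lexpect_dataLaw_le {W : Data X A O → ℝ≥0∞} (hW : IsSupermart L M η π₀ W)
    (n : ℕ) : lexpect (dataLaw L M η π₀ n) W ≤ W [] := by
  induction n with
  | zero => rw [dataLaw, lexpect_pure]
  | succ n ih =>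
    rw [lexpect_dataLaw_succ]
    exact (lexpect_mono fun D _ => hW D).trans ih

/-- Ville's inequality. -/
theorem IsSupermart.maximal {W : Data X A O → ℝ≥0∞} (hW : IsSupermart L M η π₀ W) (c : ℝ≥0∞)
    (n : ℕ) :
    c * (dataLaw L M η π₀ n).toOuterMeasure {D | ∃ D', D' <:+ D ∧ c ≤ W D'} ≤ W [] := by
  -- Markov's inequality for the stopped process.
  refine le_trans ?_ ((hW.stoppedAt c).lexpect_dataLaw_le n)
  rw [PMF.toOuterMeasure_apply, ← ENNReal.tsum_mul_left]
  refine ENNReal.tsum_le_tsum fun D => ?_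
  by_cases hD : D ∈ {D | ∃ D', D' <:+ D ∧ c ≤ W D'}
  · rw [Set.indicator_of_mem hD, mul_comm]
    obtain ⟨D', h, hc⟩ := hD
    exact mul_le_mul_right (le_stoppedAt h hc) _
  · rw [Set.indicator_of_notMem hD, mul_zero]
    exact zero_le

theorem IsSupermart.add {W W' : Data X A O → ℝ≥0∞} (hW : IsSupermart L M η π₀ W)
    (hW' : IsSupermart L M η π₀ W') : IsSupermart L M η π₀ fun D => W D + W' D := by
  intro D
  rw [lexpect_add]
  exact add_le_add (hW D) (hW' D)

theorem IsSupermart.const_mul {W : Data X A O → ℝ≥0∞} (hW : IsSupermart L M η π₀ W) (c : ℝ≥0∞) :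
    IsSupermart L M η π₀ fun D => c * W D := by
  intro D
  rw [lexpect_const_mul]
  exact mul_le_mul_right (hW D) c

theorem IsSupermart.sum {ι : Type*} {s : Finset ι} {W : ι → Data X A O → ℝ≥0∞}
    (hW : ∀ i ∈ s, IsSupermart L M η π₀ (W i)) :
    IsSupermart L M η π₀ fun D => ∑ i ∈ s, W i D := by
  intro D
  rw [lexpect_sum]
  exact Finset.sum_le_sum fun i hi => hW i hi D

/-- The product of a function along the rounds of the data. -/
def prodAlong (φ : Data X A O → Sample X A O → ℝ≥0∞) : Data X A O → ℝ≥0∞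
  | [] => 1
  | e :: D => φ D e * prodAlong φ D

/-- The sum of a function along the rounds of the data. -/
def sumAlong (ψ : Data X A O → Sample X A O → ℝ) : Data X A O → ℝ
  | [] => 0
  | e :: D => ψ D e + sumAlong ψ D

theorem isSupermart_prodAlong {φ : Data X A O → Sample X A O → ℝ≥0∞}
    (h : ∀ D, lexpect (stepRound L M η π₀ D) (φ D) ≤ 1) : IsSupermart L M η π₀ (prodAlong φ) := by
  intro D
  simp only [prodAlong, mul_comm _ (prodAlong φ D)]
  rw [lexpect_const_mul]
  exact mul_le_of_le_one_right' (h D)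

/-- The comparison is required only along the given data: in the application the exponent contains
real logarithms of likelihoods, meaningful only where these are positive. -/
theorem exp_sumAlong_le_prodAlong {φ : Data X A O → Sample X A O → ℝ≥0∞}
    {ψ : Data X A O → Sample X A O → ℝ} {D : Data X A O}
    (h : ∀ e D', e :: D' <:+ D → ENNReal.ofReal (Real.exp (ψ D' e)) ≤ φ D' e) :
    ENNReal.ofReal (Real.exp (sumAlong ψ D)) ≤ prodAlong φ D := by
  induction D with
  | nil => simp [sumAlong, prodAlong]
  | cons e D ih =>
    rw [sumAlong, prodAlong, Real.exp_add, ENNReal.ofReal_mul (Real.exp_pos _).le]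
    exact mul_le_mul' (h e D List.suffix_rfl)
      (ih fun e' D' h' => h e' D' (h'.trans (List.suffix_cons e D)))

theorem sumAlong_add (ψ ψ' : Data X A O → Sample X A O → ℝ) (D : Data X A O) :
    sumAlong (fun D e => ψ D e + ψ' D e) D = sumAlong ψ D + sumAlong ψ' D := by
  induction D with
  | nil => simp [sumAlong]
  | cons e D ih => simp only [sumAlong, ih]; ring

theorem sumAlong_sub (ψ ψ' : Data X A O → Sample X A O → ℝ) (D : Data X A O) :
    sumAlong (fun D e => ψ D e - ψ' D e) D = sumAlong ψ D - sumAlong ψ' D := by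
  induction D with
  | nil => simp [sumAlong]
  | cons e D ih => simp only [sumAlong, ih]; ring

theorem sumAlong_const_mul (c : ℝ) (ψ : Data X A O → Sample X A O → ℝ) (D : Data X A O) :
    sumAlong (fun D e => c * ψ D e) D = c * sumAlong ψ D := by
  induction D with
  | nil => simp [sumAlong]
  | cons e D ih => simp only [sumAlong, ih]; ring

end Maximal

/-! ### Likelihood ratios -/

section Likelihood

variable {L : Learner X A O} {M : Model X A O} {η : ℝ} {π₀ : Policy X A O}

theorem mul_exp_half_log_sub {p q : ℝ} (hp : 0 < p) (hq : 0 < q) :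
    q * Real.exp (1 / 2 * (Real.log p - Real.log q)) = √(p * q) := by
  rw [eq_comm, Real.sqrt_eq_iff_mul_self_eq (by positivity) (by positivity)]
  have : Real.exp (1 / 2 * (Real.log p - Real.log q)) *
      Real.exp (1 / 2 * (Real.log p - Real.log q)) = p / q := by
    rw [← Real.exp_add, ← add_mul, add_halves, one_mul, Real.exp_sub, Real.exp_log hp,
      Real.exp_log hq]
  rw [mul_mul_mul_comm, this]
  field_simp

/-- The AM-GM defect is `(√p - √q)² / 2`, and `(p - q)² = (√p - √q)² (√p + √q)²` is at most `4 (√p -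
√q)²` on `[0, 1]`. -/
theorem sqrt_mul_le_half_add_sub {p q : ℝ} (hp : 0 ≤ p) (hq : 0 ≤ q) (hp' : p ≤ 1) (hq' : q ≤ 1) :
    √(p * q) ≤ (p + q) / 2 - (p - q) ^ 2 / 8 := by
  rw [Real.sqrt_mul hp]
  obtain ⟨a, ha0, rfl⟩ : ∃ a, 0 ≤ a ∧ p = a ^ 2 := ⟨√p, Real.sqrt_nonneg p, (Real.sq_sqrt hp).symm⟩
  obtain ⟨b, hb0, rfl⟩ : ∃ b, 0 ≤ b ∧ q = b ^ 2 := ⟨√q, Real.sqrt_nonneg q, (Real.sq_sqrt hq).symm⟩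
  rw [Real.sqrt_sq ha0, Real.sqrt_sq hb0]
  have ha : a ≤ 1 := by nlinarith
  have hb : b ≤ 1 := by nlinarith
  have h : (a + b) ^ 2 ≤ 4 := by nlinarith
  nlinarith [mul_nonneg (sub_nonneg.2 h) (sq_nonneg (a - b))]

/-- Summed over the two outcomes, the affinity is at most `1 - (p - q)² / 4`, hence at most `exp(-(p
- q)² / 4)`, which the compensator cancels. -/
theorem bernoulli_likelihood_le {p q : ℝ} (hp : 0 < p) (hq : 0 < q) (hp' : p < 1) (hq' : q < 1) :
    q * Real.exp (1 / 2 * (Real.log p - Real.log q) + (p - q) ^ 2 / 4)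
      + (1 - q) * Real.exp (1 / 2 * (Real.log (1 - p) - Real.log (1 - q)) + (p - q) ^ 2 / 4)
      ≤ 1 := by
  rw [Real.exp_add, Real.exp_add, ← mul_assoc, ← mul_assoc, mul_exp_half_log_sub hp hq,
    mul_exp_half_log_sub (sub_pos.2 hp') (sub_pos.2 hq'), ← add_mul]
  have h1 := sqrt_mul_le_half_add_sub hp.le hq.le hp'.le hq'.le
  have h2 := sqrt_mul_le_half_add_sub (sub_pos.2 hp').le (sub_pos.2 hq').le
    (by linarith) (by linarith)
  have h3 : √(p * q) + √((1 - p) * (1 - q)) ≤ Real.exp (-((p - q) ^ 2 / 4)) := by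
    have h4 := Real.add_one_le_exp (-((p - q) ^ 2 / 4))
    nlinarith
  calc _ ≤ Real.exp (-((p - q) ^ 2 / 4)) * Real.exp ((p - q) ^ 2 / 4) :=
        mul_le_mul_of_nonneg_right h3 (Real.exp_pos _).le
    _ = 1 := by rw [← Real.exp_add, neg_add_cancel, Real.exp_zero]

/-- Log-likelihood of a utility in one round. -/
def rewardLog (u : Utility X A O) (e : Sample X A O) : ℝ :=
  if e.pref then Real.log (Real.sigmoid (u e.traj₁ - u e.traj₂))
    else Real.log (Real.sigmoid (u e.traj₂ - u e.traj₁))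

/-- Squared distance of the preference probabilities of two utilities. -/
def prefSqDist (u u' : Utility X A O) (e : Sample X A O) : ℝ :=
  (Real.sigmoid (u e.traj₁ - u e.traj₂) - Real.sigmoid (u' e.traj₁ - u' e.traj₂)) ^ 2

/-- Given the two trajectories, the signal is Bernoulli under the true utility, so the bound holds
conditionally on them. -/
theorem isSupermart_reward (u : Utility X A O) :
    IsSupermart L M η π₀ (prodAlong fun _ e => ENNReal.ofReal (Real.exp
      (1 / 2 * (rewardLog u e - rewardLog M.u e) + prefSqDist u M.u e / 4))) := by
  refine isSupermart_prodAlong fun D => ?_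
  rw [stepRound, roundLaw]
  simp only [lexpect_bind, lexpect_map]
  refine (lexpect_mono fun x _ => (lexpect_mono fun τ₁ _ => (lexpect_mono fun τ₂ _ => ?_).trans_eq
    (lexpect_const _ 1)).trans_eq (lexpect_const _ 1)).trans_eq (lexpect_const _ 1)
  have hneg : ∀ v : Utility X A O, Real.sigmoid (v τ₂ - v τ₁) = 1 - Real.sigmoid (v τ₁ - v τ₂) :=
    fun v => by rw [← Real.sigmoid_neg, neg_sub]
  rw [lexpect, tsum_fintype, Fintype.sum_bool]
  simp only [preferenceLaw, PMF.ofFintype_apply, if_true, Bool.false_eq_true, if_false, rewardLog,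
    prefSqDist, hneg]
  rw [← ENNReal.ofReal_mul (Real.sigmoid_nonneg _),
    ← ENNReal.ofReal_mul (sub_nonneg.2 (Real.sigmoid_le_one _)),
    ← ENNReal.ofReal_add (mul_nonneg (Real.sigmoid_nonneg _) (Real.exp_pos _).le)
      (mul_nonneg (sub_nonneg.2 (Real.sigmoid_le_one _)) (Real.exp_pos _).le)]
  rw [ENNReal.ofReal_le_one]
  exact bernoulli_likelihood_le (Real.sigmoid_pos _) (Real.sigmoid_pos _) (Real.sigmoid_lt_one _)
    (Real.sigmoid_lt_one _)

theorem mul_sqrt_div_eq {p q : ℝ} (hq : 0 ≤ q) : q * √(p / q) = √(p * q) := by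
  rcases hq.eq_or_lt with rfl | hq'
  · simp
  · rw [← Real.sqrt_sq hq, ← Real.sqrt_mul (sq_nonneg q), Real.sqrt_sq hq]
    congr 1
    field_simp

/-- The mean of `√(p / q)` under `q` is the affinity, at most `1 - tv² / 2 ≤ exp(-tv² / 2)`. A
square root, rather than the exponential of a real logarithm, gives the right value 0 where `p`
vanishes. -/
theorem lexpect_sqrt_likelihood_le {Z : Type*} (p q : PMF Z) :
    lexpect q (fun z => ENNReal.ofReal
      (√((p z).toReal / (q z).toReal) * Real.exp (tv p q ^ 2 / 2))) ≤ 1 := by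
  have hpt : ∀ z, (q z).toReal * √((p z).toReal / (q z).toReal) =
      √((p z).toReal * (q z).toReal) := fun z => mul_sqrt_div_eq ENNReal.toReal_nonneg
  have hs : Summ q fun z => Real.exp (tv p q ^ 2 / 2) * √((p z).toReal / (q z).toReal) := by
    refine Summ.const_mul ?_ _
    simpa only [Summ, hpt] using summable_sqrt_mul p q
  simp only [mul_comm _ (Real.exp (tv p q ^ 2 / 2))]
  rw [lexpect_ofReal hs fun z _ => mul_nonneg (Real.exp_pos _).le (Real.sqrt_nonneg _),
    ENNReal.ofReal_le_one, expect_const_mul, expect]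
  simp only [hpt]
  have h := tsum_sqrt_mul_le p q
  have h2 := Real.add_one_le_exp (-(tv p q ^ 2 / 2))
  calc _ ≤ Real.exp (tv p q ^ 2 / 2) * Real.exp (-(tv p q ^ 2 / 2)) :=
        mul_le_mul_of_nonneg_left (by linarith) (Real.exp_pos _).le
    _ = 1 := by rw [← Real.exp_add, add_neg_cancel, Real.exp_zero]

/-- The exponential of half the log-likelihood ratio of `P` in one trajectory,
plus half the squared total variation distance. -/
def trajRatio (M : Model X A O) (P : Transition X A O) (π : Policy X A O) (τ : Traj X A O) :
    ℝ≥0∞ :=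
  ENNReal.ofReal (√((trajLaw M.d₀ π P M.H τ).toReal / (trajLaw M.d₀ π M.P M.H τ).toReal) *
    Real.exp (tvTraj M π P ^ 2 / 2))

/-- The two trajectories of a round share a prompt and are dependent given the past. Each therefore
gets its own process, which uses only its marginal law. -/
theorem isSupermart_transition₁ (hH : 1 ≤ M.H) (P : Transition X A O) :
    IsSupermart L M η π₀ (prodAlong fun _ e => trajRatio M P e.pol₁ e.traj₁) := by
  refine isSupermart_prodAlong fun D => ?_
  rw [stepRound, lexpect_congr (G := fun e => trajRatio M P (L.main M η π₀ D) e.traj₁)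
    fun e he => by rw [(of_mem_support_roundLaw hH he).1.1],
    ← lexpect_map _ Sample.traj₁ (trajRatio M P (L.main M η π₀ D)), map_traj₁_roundLaw]
  exact lexpect_sqrt_likelihood_le _ _

theorem isSupermart_transition₂ (hH : 1 ≤ M.H) (P : Transition X A O) :
    IsSupermart L M η π₀ (prodAlong fun _ e => trajRatio M P e.pol₂ e.traj₂) := by
  refine isSupermart_prodAlong fun D => ?_
  rw [stepRound, lexpect_congr (G := fun e => trajRatio M P (L.explore D) e.traj₂)
    fun e he => by rw [(of_mem_support_roundLaw hH he).1.2],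
    ← lexpect_map _ Sample.traj₂ (trajRatio M P (L.explore D)), map_traj₂_roundLaw]
  exact lexpect_sqrt_likelihood_le _ _

/-- On `[0, 1]`, `exp(-g) ≤ 1 - g / 2`; take means and use `1 - x ≤ exp(-x)`. The resulting bound is
multiplicative: sums of means are at most twice the observed sums plus a logarithm, with no `√T`
term. -/
theorem lexpect_exp_half_expect_sub_le {Z : Type*} {p : PMF Z} {g : Z → ℝ}
    (hg : ∀ z ∈ p.support, g z ∈ Set.Icc 0 1) :
    lexpect p (fun z => ENNReal.ofReal (Real.exp (1 / 2 * expect p g - g z))) ≤ 1 := by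
  have hsg : Summ p g := summ_of_bound fun z hz => abs_le_of_mem_Icc (hg z hz)
  have hse : Summ p fun z => Real.exp (-g z) := summ_of_bound (C := 1) fun z hz => by
    rw [abs_of_pos (Real.exp_pos _), Real.exp_le_one_iff]
    linarith [(hg z hz).1]
  have hpt : ∀ z ∈ p.support, Real.exp (-g z) ≤ 1 - 1 / 2 * g z := by
    intro z hz
    obtain ⟨h0, h1⟩ := hg z hz
    have h2 := Real.add_one_le_exp (g z)
    rw [Real.exp_neg, inv_le_iff_one_le_mul₀ (Real.exp_pos _)]
    nlinarith
  have hm := expect_mono hse ((summ_const p 1).sub (hsg.const_mul (1 / 2))) hpt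
  rw [expect_sub (summ_const p 1) (hsg.const_mul (1 / 2)), expect_const, expect_const_mul] at hm
  simp only [sub_eq_add_neg, Real.exp_add]
  rw [lexpect_ofReal (hse.const_mul _) fun z _ =>
    mul_nonneg (Real.exp_pos _).le (Real.exp_pos _).le, expect_const_mul, ENNReal.ofReal_le_one]
  have h2 := Real.add_one_le_exp (-(1 / 2 * expect p g))
  calc _ ≤ Real.exp (1 / 2 * expect p g) * Real.exp (-(1 / 2 * expect p g)) :=
        mul_le_mul_of_nonneg_left (by linarith) (Real.exp_pos _).le
    _ = 1 := by rw [← Real.exp_add, add_neg_cancel, Real.exp_zero]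

theorem isSupermart_concentration {g : Data X A O → Sample X A O → ℝ}
    (hg : ∀ D, ∀ e ∈ (stepRound L M η π₀ D).support, g D e ∈ Set.Icc 0 1) :
    IsSupermart L M η π₀ (prodAlong fun D e => ENNReal.ofReal (Real.exp
      (1 / 2 * expect (stepRound L M η π₀ D) (g D) - g D e))) :=
  isSupermart_prodAlong fun D => lexpect_exp_half_expect_sub_le (hg D)

end Likelihood

/-! ### The Eluder coefficient -/

section Eluder

/-- The infimum is attained: after squaring, the condition is a family of linear lower bounds on
`d`, and `T C²` satisfies them all. -/
theorem eluderCoeff_spec {Z : Type*} {F : Set (Z → ℝ)} {fstar : Z → ℝ} {T : ℕ} {C : ℝ}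
    (hF : ∀ f ∈ F, ∀ z, |f z - fstar z| ≤ C) :
    0 ≤ eluderCoeff 1 F fstar T ∧
      ∀ (x : ℕ → Z) (f : ℕ → Z → ℝ), (∀ t ∈ Finset.Icc 1 T, f t ∈ F) →
        ∑ t ∈ Finset.Icc 2 T, |f t (x t) - fstar (x t)| ≤
          √(eluderCoeff 1 F fstar T * ∑ t ∈ Finset.Icc 2 T,
            (1 + ∑ i ∈ Finset.Ico 1 t, (f t (x i) - fstar (x i)) ^ 2)) := by
  set S := {d : ℝ | 0 ≤ d ∧ ∀ (x : ℕ → Z) (f : ℕ → Z → ℝ), (∀ t ∈ Finset.Icc 1 T, f t ∈ F) →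
    ∑ t ∈ Finset.Icc 2 T, |f t (x t) - fstar (x t)| ≤
      √(d * ∑ t ∈ Finset.Icc 2 T,
        (1 + ∑ i ∈ Finset.Ico 1 t, (f t (x i) - fstar (x i)) ^ 2))} with hS
  have hdef : eluderCoeff 1 F fstar T = sInf S := rfl
  have hne : (T * C ^ 2) ∈ S := by
    refine ⟨by positivity, fun x f hf => Real.le_sqrt_of_sq_le ?_⟩
    set n : ℝ := ((Finset.Icc 2 T).card : ℝ) with hn
    have hn0 : 0 ≤ n := Nat.cast_nonneg _
    have hnT : n ≤ T := by
      rw [hn, Nat.card_Icc]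
      exact_mod_cast (by omega : T + 1 - 2 ≤ T)
    have h1 : ∑ t ∈ Finset.Icc 2 T, |f t (x t) - fstar (x t)| ≤ n * C := by
      rw [hn, ← nsmul_eq_mul]
      refine Finset.sum_le_card_nsmul _ _ _ fun t ht => hF _ (hf t ?_) _
      rw [Finset.mem_Icc] at ht ⊢
      exact ⟨by omega, ht.2⟩
    have h2 : n ≤ ∑ t ∈ Finset.Icc 2 T,
        (1 + ∑ i ∈ Finset.Ico 1 t, (f t (x i) - fstar (x i)) ^ 2) := by
      rw [hn, ← nsmul_one]
      exact Finset.card_nsmul_le_sum _ _ _ fun t _ =>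
        le_add_of_nonneg_right (Finset.sum_nonneg fun _ _ => sq_nonneg _)
    have h0 : 0 ≤ ∑ t ∈ Finset.Icc 2 T, |f t (x t) - fstar (x t)| :=
      Finset.sum_nonneg fun _ _ => abs_nonneg _
    calc _ ≤ (n * C) ^ 2 := by gcongr
      _ = n * C ^ 2 * n := by ring
      _ ≤ T * C ^ 2 * _ := by gcongr
  refine ⟨hdef ▸ Real.sInf_nonneg fun d hd => hd.1, fun x f hf => ?_⟩
  rw [hdef]
  set r := ∑ t ∈ Finset.Icc 2 T, (1 + ∑ i ∈ Finset.Ico 1 t, (f t (x i) - fstar (x i)) ^ 2) with hr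
  have hr0 : 0 ≤ r := Finset.sum_nonneg fun t _ =>
    add_nonneg zero_le_one (Finset.sum_nonneg fun _ _ => sq_nonneg _)
  set l := ∑ t ∈ Finset.Icc 2 T, |f t (x t) - fstar (x t)|
  have hl0 : 0 ≤ l := Finset.sum_nonneg fun _ _ => abs_nonneg _
  have hsq : ∀ d ∈ S, l ^ 2 ≤ d * r := fun d hd => by
    have := hd.2 x f hf
    have h2 := pow_le_pow_left₀ hl0 this 2
    rwa [Real.sq_sqrt (mul_nonneg hd.1 hr0)] at h2
  refine Real.le_sqrt_of_sq_le ?_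
  -- If `r = 0` there is nothing to divide by; any admissible `d` then gives `l = 0`.
  rcases hr0.eq_or_lt with h | h
  · have := hsq _ hne
    rw [← h, mul_zero] at this ⊢
    exact this
  · rw [← div_le_iff₀ h]
    exact le_csInf ⟨_, hne⟩ fun d hd => (div_le_iff₀ h).2 (hsq d hd)

/-- The difference of the utility gaps of `u` and `u'` between the two trajectories of a round. -/
def pairDiff (u u' : Utility X A O) (e : Sample X A O) : ℝ :=
  (u e.traj₂ - u e.traj₁) - (u' e.traj₂ - u' e.traj₁)

/-- The two trajectories have `H` steps and the same prompt. -/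
def IsPair (H : ℕ) (e : Sample X A O) : Prop :=
  IsTraj H e.traj₁ ∧ IsTraj H e.traj₂ ∧ e.traj₁.1.1 = e.traj₂.1.1

variable {H T : ℕ} {U : Finset (Utility X A O)} {ustar : Utility X A O} {B : ℝ}

theorem abs_utilityDiff_sub_le (hU : ∀ u ∈ U, ∀ τ, IsTraj H τ → u τ ∈ Set.Icc 0 B)
    (hstar : ustar ∈ U) :
    ∀ f ∈ utilityDiff H '' (U : Set (Utility X A O)), ∀ z,
      |f z - utilityDiff H ustar z| ≤ 2 * B := by
  rintro f ⟨u, hu, rfl⟩ z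
  have h1 := abs_sub_le_of_mem_Icc (hU u hu _ z.2.2.1) (hU u hu _ z.2.1)
  have h2 := abs_sub_le_of_mem_Icc (hU ustar hstar _ z.2.2.1) (hU ustar hstar _ z.2.1)
  refine (abs_sub _ _).trans ?_
  simp only [utilityDiff]
  linarith

theorem dU_nonneg (hU : ∀ u ∈ U, ∀ τ, IsTraj H τ → u τ ∈ Set.Icc 0 B) (hstar : ustar ∈ U) :
    0 ≤ dU H U ustar T :=
  (eluderCoeff_spec (abs_utilityDiff_sub_le hU hstar)).1

/-- Repeating one pair and one utility in the Eluder inequality gives `n x² ≤ d (1 + n x²)` with `n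
= T - 1`. For `d ≤ 1/2` the right side is absorbed, so `x² ≤ 2 d`; for larger `d` the trivial bound
`x ≤ 2 B` suffices. -/
theorem abs_pairDiff_le (hU : ∀ u ∈ U, ∀ τ, IsTraj H τ → u τ ∈ Set.Icc 0 B)
    (hstar : ustar ∈ U) (hB : 1 ≤ B) (hT : 2 ≤ T) {u : Utility X A O} (hu : u ∈ U)
    {e : Sample X A O} (he : IsPair H e) :
    |pairDiff u ustar e| ≤ 3 * B * √(dU H U ustar T) := by
  have hF := abs_utilityDiff_sub_le hU hstar
  obtain ⟨hd0, hspec⟩ := eluderCoeff_spec (T := T) hF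
  let z : TrajPair X A O H := ⟨(e.traj₁, e.traj₂), he⟩
  have hmem : utilityDiff H u ∈ utilityDiff H '' (U : Set (Utility X A O)) := ⟨u, hu, rfl⟩
  have h := hspec (fun _ => z) (fun _ => utilityDiff H u) fun _ _ => hmem
  have hb := hF _ hmem z
  change |pairDiff u ustar e| ≤ 2 * B at hb
  change ∑ t ∈ Finset.Icc 2 T, |pairDiff u ustar e| ≤ √(dU H U ustar T * ∑ t ∈ Finset.Icc 2 T,
    (1 + ∑ i ∈ Finset.Ico 1 t, pairDiff u ustar e ^ 2)) at h
  change 0 ≤ dU H U ustar T at hd0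
  set d := dU H U ustar T
  rw [← sq_abs (pairDiff u ustar e)] at h
  set x := |pairDiff u ustar e|
  have hx0 : 0 ≤ x := abs_nonneg _
  set n : ℝ := ((Finset.Icc 2 T).card : ℝ) with hn
  have hn1 : 1 ≤ n := by
    rw [hn, Nat.card_Icc]
    exact_mod_cast (by omega : 1 ≤ T + 1 - 2)
  rw [Finset.sum_const, nsmul_eq_mul, ← hn] at h
  have hsum : ∑ t ∈ Finset.Icc 2 T, (1 + ∑ i ∈ Finset.Ico 1 t, x ^ 2) ≤ n * (1 + n * x ^ 2) := by
    rw [hn, ← nsmul_eq_mul]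
    refine Finset.sum_le_card_nsmul _ _ _ fun t ht => ?_
    rw [Finset.sum_const, nsmul_eq_mul]
    have : ((Finset.Ico 1 t).card : ℝ) ≤ ((Finset.Icc 2 T).card : ℝ) := by
      rw [Nat.card_Ico, Nat.card_Icc]
      rw [Finset.mem_Icc] at ht
      exact_mod_cast (by omega : t - 1 ≤ T + 1 - 2)
    gcongr
  have h1 : (n * x) ^ 2 ≤ d * (n * (1 + n * x ^ 2)) := by
    have h2 := pow_le_pow_left₀ (by positivity) h 2
    rw [Real.sq_sqrt (mul_nonneg hd0 (Finset.sum_nonneg fun t _ => by positivity))] at h2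
    exact h2.trans (mul_le_mul_of_nonneg_left hsum hd0)
  have h2 : n * x ^ 2 ≤ d * (1 + n * x ^ 2) := by
    have : n * (n * x ^ 2) ≤ n * (d * (1 + n * x ^ 2)) := by nlinarith
    exact le_of_mul_le_mul_left this (by linarith)
  have h3 : x ^ 2 ≤ (3 * B) ^ 2 * d := by
    rcases le_total d (1 / 2) with hd | hd
    · have h4 : n * x ^ 2 ≤ 2 * d := by nlinarith [mul_nonneg (by linarith : 0 ≤ n) (sq_nonneg x)]
      have h5 : x ^ 2 ≤ n * x ^ 2 := le_mul_of_one_le_left (sq_nonneg x) hn1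
      have h6 := mul_le_mul_of_nonneg_right (one_le_pow₀ hB : 1 ≤ B ^ 2) hd0
      nlinarith
    · have h4 : x ^ 2 ≤ (2 * B) ^ 2 := pow_le_pow_left₀ hx0 hb 2
      nlinarith
  rw [← Real.sqrt_sq (by positivity : 0 ≤ 3 * B), ← Real.sqrt_mul (sq_nonneg _)]
  exact Real.le_sqrt_of_sq_le h3

theorem sum_abs_pairDiff_le (hU : ∀ u ∈ U, ∀ τ, IsTraj H τ → u τ ∈ Set.Icc 0 B)
    (hstar : ustar ∈ U) (hT : 2 ≤ T) {e : ℕ → Sample X A O}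
    (he : ∀ t ∈ Finset.Icc 1 T, IsPair H (e t)) {f : ℕ → Utility X A O}
    (hf : ∀ t ∈ Finset.Icc 1 T, f t ∈ U) :
    ∑ t ∈ Finset.Icc 2 T, |pairDiff (f t) ustar (e t)| ≤
      √(dU H U ustar T * ∑ t ∈ Finset.Icc 2 T,
        (1 + ∑ i ∈ Finset.Ico 1 t, pairDiff (f t) ustar (e i) ^ 2)) := by
  classical
  have hF := abs_utilityDiff_sub_le hU hstar
  -- Indices outside `[1, T]` get the pair of round 1; they do not enter the sums.
  let z : ℕ → TrajPair X A O H := fun t =>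
    if h : t ∈ Finset.Icc 1 T then ⟨((e t).traj₁, (e t).traj₂), he t h⟩
    else ⟨((e 1).traj₁, (e 1).traj₂), he 1 (Finset.mem_Icc.2 ⟨le_rfl, by omega⟩)⟩
  have hz : ∀ t ∈ Finset.Icc 1 T, ∀ u : Utility X A O,
      utilityDiff H u (z t) - utilityDiff H ustar (z t) = pairDiff u ustar (e t) := by
    intro t ht u
    have : z t = ⟨((e t).traj₁, (e t).traj₂), he t ht⟩ := dif_pos ht
    rw [this]
    rfl
  have h := (eluderCoeff_spec (T := T) hF).2 z (fun t => utilityDiff H (f t))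
    fun t ht => ⟨f t, hf t ht, rfl⟩
  have e1 : ∀ t ∈ Finset.Icc 2 T, t ∈ Finset.Icc 1 T := fun t ht =>
    Finset.mem_Icc.2 ⟨by linarith [(Finset.mem_Icc.1 ht).1], (Finset.mem_Icc.1 ht).2⟩
  have e2 : ∑ t ∈ Finset.Icc 2 T, |utilityDiff H (f t) (z t) - utilityDiff H ustar (z t)| =
      ∑ t ∈ Finset.Icc 2 T, |pairDiff (f t) ustar (e t)| :=
    Finset.sum_congr rfl fun t ht => by rw [hz t (e1 t ht)]
  have e3 : ∑ t ∈ Finset.Icc 2 T, (1 + ∑ i ∈ Finset.Ico 1 t,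
        (utilityDiff H (f t) (z i) - utilityDiff H ustar (z i)) ^ 2) =
      ∑ t ∈ Finset.Icc 2 T, (1 + ∑ i ∈ Finset.Ico 1 t, pairDiff (f t) ustar (e i) ^ 2) := by
    refine Finset.sum_congr rfl fun t ht => ?_
    congr 1
    refine Finset.sum_congr rfl fun i hi => ?_
    rw [hz i (Finset.mem_Icc.2 ⟨(Finset.mem_Ico.1 hi).1,
      (Finset.mem_Ico.1 hi).2.le.trans (Finset.mem_Icc.1 ht).2⟩)]
  rw [e2, e3] at h
  exact h

/-- The sum of expected gaps, from a concentration bound and bounds for the in-sample errors. -/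
theorem sum_expected_gap_le (hU : ∀ u ∈ U, ∀ τ, IsTraj H τ → u τ ∈ Set.Icc 0 B)
    (hstar : ustar ∈ U) (hB : 1 ≤ B) (hT : 2 ≤ T) {e : ℕ → Sample X A O}
    (he : ∀ t ∈ Finset.Icc 1 T, IsPair H (e t)) {f : ℕ → Utility X A O}
    (hf : ∀ t ∈ Finset.Icc 1 T, f t ∈ U) {m : ℕ → ℝ} {k ℓ R : ℝ} (hk : 1 ≤ k) (hℓ : 1 / 2 ≤ ℓ)
    (hR : R = 3 * B * √(dU H U ustar T))
    (hm : ∀ t ∈ Finset.Icc 1 T, m t ≤ R)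
    (hconc : ∑ t ∈ Finset.Icc 1 T,
      (1 / 2 * (m t / R) - |pairDiff (f t) ustar (e t)| / R) ≤ 4 * ℓ)
    (hin : ∀ t ∈ Finset.Icc 1 T,
      ∑ i ∈ Finset.Ico 1 t, pairDiff (f t) ustar (e i) ^ 2 ≤ 48 * k ^ 2 * ℓ) :
    ∑ t ∈ Finset.Icc 1 T, m t ≤ 28 * k * B * √(dU H U ustar T * T * ℓ) := by
  have hd0 : 0 ≤ dU H U ustar T := dU_nonneg hU hstar
  have hR0 : 0 ≤ R := by rw [hR]; positivity
  have hel := sum_abs_pairDiff_le hU hstar hT he hf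
  have h1mem : 1 ∈ Finset.Icc 1 T := Finset.mem_Icc.2 ⟨le_rfl, by omega⟩
  have hfirst := abs_pairDiff_le hU hstar hB hT (hf 1 h1mem) (he 1 h1mem)
  rw [← hR] at hfirst
  have hT0 : (0 : ℝ) ≤ T := Nat.cast_nonneg T
  set d := dU H U ustar T
  set s := √(d * T * ℓ) with hs
  have hs0 : 0 ≤ s := Real.sqrt_nonneg _
  have hRs : R * √(T * ℓ) = 3 * B * s := by
    rw [hR, hs, mul_assoc (3 * B), ← Real.sqrt_mul hd0, mul_assoc d]
  -- If the Eluder coefficient vanishes, so do the range and hence all positive contributions.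
  rcases hR0.eq_or_lt with h0 | hRpos
  · refine (Finset.sum_nonpos fun t ht => ?_).trans (by positivity)
    rw [h0]
    exact hm t ht
  have hT2 : ∑ t ∈ Finset.Icc 2 T, |pairDiff (f t) ustar (e t)| ≤ 8 * k * s := by
    refine hel.trans ?_
    rw [← Real.sqrt_sq (by positivity : 0 ≤ 8 * k), hs, ← Real.sqrt_mul (sq_nonneg _)]
    refine Real.sqrt_le_sqrt ?_
    have hk2 : 1 ≤ k ^ 2 := one_le_pow₀ hk
    have h2 : ∑ t ∈ Finset.Icc 2 T,
        (1 + ∑ i ∈ Finset.Ico 1 t, pairDiff (f t) ustar (e i) ^ 2) ≤ T * (50 * k ^ 2 * ℓ) := by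
      have hc : ((Finset.Icc 2 T).card : ℝ) ≤ T := by
        rw [Nat.card_Icc]
        exact_mod_cast (by omega : T + 1 - 2 ≤ T)
      refine (Finset.sum_le_card_nsmul _ _ (50 * k ^ 2 * ℓ) fun t ht => ?_).trans ?_
      · have := hin t (Finset.mem_Icc.2
          ⟨by linarith [(Finset.mem_Icc.1 ht).1], (Finset.mem_Icc.1 ht).2⟩)
        nlinarith
      · rw [nsmul_eq_mul]
        have : 0 ≤ 50 * k ^ 2 * ℓ := by positivity
        gcongr
    calc _ ≤ d * (T * (50 * k ^ 2 * ℓ)) := mul_le_mul_of_nonneg_left h2 hd0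
      _ = 50 * (k ^ 2 * (d * T * ℓ)) := by ring
      _ ≤ 64 * (k ^ 2 * (d * T * ℓ)) := by
        have : 0 ≤ k ^ 2 * (d * T * ℓ) := by positivity
        linarith
      _ = _ := by ring
  -- The Eluder sum starts at round 2, so the first round is paid for by the range `R`.
  have hsplit : ∑ t ∈ Finset.Icc 1 T, |pairDiff (f t) ustar (e t)| ≤ R + 8 * k * s := by
    have hI : Finset.Icc 1 T = insert 1 (Finset.Icc 2 T) := by
      ext t
      simp only [Finset.mem_Icc, Finset.mem_insert]
      omega
    rw [hI, Finset.sum_insert (by simp)]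
    exact add_le_add hfirst hT2
  -- Concentration costs `8 R ℓ`, and the doubled first round `2 R` is at most `4 R ℓ` since `ℓ ≥
  -- 1/2`.
  have hm1 : ∑ t ∈ Finset.Icc 1 T, m t ≤ 12 * R * ℓ + 16 * k * s := by
    rw [Finset.sum_sub_distrib, ← Finset.mul_sum, ← Finset.sum_div, ← Finset.sum_div] at hconc
    have : 1 / 2 * ∑ t ∈ Finset.Icc 1 T, m t - ∑ t ∈ Finset.Icc 1 T, |pairDiff (f t) ustar (e t)|
        ≤ 4 * ℓ * R := by
      rw [← div_le_iff₀ hRpos]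
      refine le_of_eq_of_le ?_ hconc
      ring
    nlinarith
  have hm2 : ∑ t ∈ Finset.Icc 1 T, m t ≤ T * R := by
    refine (Finset.sum_le_card_nsmul _ _ R hm).trans_eq ?_
    rw [Nat.card_Icc, nsmul_eq_mul, Nat.add_sub_cancel]
  -- The minimum is at most the geometric mean, and `√12 ≤ 4`. This combines the trivial bound `T R`
  -- with `12 R ℓ`, so the lower-order term is of the main order `B √(d T ℓ)`.
  have hmin : min (T * R) (12 * R * ℓ) ≤ 4 * (R * √(T * ℓ)) := by
    set w := √(T * ℓ) with hw
    have hw0 : 0 ≤ w := Real.sqrt_nonneg _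
    have hw2 : w ^ 2 = T * ℓ := Real.sq_sqrt (by positivity)
    by_contra! hcon
    obtain ⟨c1, c2⟩ := lt_min_iff.1 hcon
    have c1' : 4 * w < T := by nlinarith
    have c2' : 4 * w < 12 * ℓ := by nlinarith
    nlinarith
  have hBk : 3 * B * s ≤ 3 * (k * B * s) := by
    have : B * s ≤ k * (B * s) := le_mul_of_one_le_left (by positivity) hk
    nlinarith
  have hkB : k * s ≤ k * B * s := by
    have : k * s ≤ B * (k * s) := le_mul_of_one_le_left (by positivity) hB
    nlinarith
  have hfin : ∑ t ∈ Finset.Icc 1 T, m t ≤ min (T * R) (12 * R * ℓ) + 16 * k * s := by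
    rcases min_choice (T * R) (12 * R * ℓ) with h | h <;> rw [h]
    · have : 0 ≤ 16 * k * s := by positivity
      linarith
    · exact hm1
  rw [hRs] at hmin
  nlinarith

end Eluder

/-! ### Consequences of the likelihood bounds -/

section Consequences

variable {M : Model X A O} {B : ℝ}

/-- The derivative of the sigmoid is `1 / (2 + 2 cosh z)`, and `cosh` increases with `|z|`. -/
theorem le_sigmoid_mul_one_sub {B z : ℝ} (hz : |z| ≤ B) :
    1 / (2 + Real.exp (-B) + Real.exp B) ≤ Real.sigmoid z * (1 - Real.sigmoid z) := by
  have h1 : Real.sigmoid z * (1 - Real.sigmoid z) = 1 / (2 + Real.exp (-z) + Real.exp z) := by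
    rw [Real.sigmoid_def, Real.exp_neg]
    have := Real.exp_pos z
    field_simp
    ring
  have h2 : Real.cosh z ≤ Real.cosh B := Real.cosh_le_cosh.2 (hz.trans (le_abs_self B))
  rw [Real.cosh_eq, Real.cosh_eq] at h2
  rw [h1]
  have := Real.exp_pos z
  have := Real.exp_pos (-z)
  exact one_div_le_one_div_of_le (by positivity) (by linarith)

theorem mul_abs_sub_le_abs_sigmoid_sub {B x y : ℝ} (hx : |x| ≤ B) (hy : |y| ≤ B) :
    1 / (2 + Real.exp (-B) + Real.exp B) * |x - y| ≤ |Real.sigmoid x - Real.sigmoid y| := by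
  wlog hxy : y ≤ x generalizing x y
  · rw [abs_sub_comm x, abs_sub_comm (Real.sigmoid x)]
    exact this hy hx (le_of_not_ge hxy)
  rw [abs_of_nonneg (sub_nonneg.2 hxy)]
  refine le_trans ?_ (le_abs_self _)
  refine (convex_Icc (-B) B).mul_sub_le_image_sub_of_le_deriv
    (_root_.continuous_sigmoid.continuousOn) (_root_.differentiable_sigmoid.differentiableOn)
    (fun z hz => ?_) y (abs_le.1 hy) x (abs_le.1 hx) hxy
  rw [Real.deriv_sigmoid]
  have hz' : z ∈ Set.Icc (-B) B := interior_subset hz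
  exact le_sigmoid_mul_one_sub (abs_le.2 hz')

theorem sq_pairDiff_le {u u' : Utility X A O} {e : Sample X A O}
    (h₁ : u e.traj₁ ∈ Set.Icc 0 B) (h₂ : u e.traj₂ ∈ Set.Icc 0 B)
    (h₁' : u' e.traj₁ ∈ Set.Icc 0 B) (h₂' : u' e.traj₂ ∈ Set.Icc 0 B) :
    pairDiff u u' e ^ 2 ≤ ((1 / (2 + Real.exp (-B) + Real.exp B))⁻¹) ^ 2 * prefSqDist u u' e := by
  have h := mul_abs_sub_le_abs_sigmoid_sub (abs_sub_le_of_mem_Icc h₁ h₂)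
    (abs_sub_le_of_mem_Icc h₁' h₂')
  set κ := 1 / (2 + Real.exp (-B) + Real.exp B) with hκ
  have hκ0 : 0 < κ := by positivity
  have e1 : pairDiff u u' e ^ 2 = |u e.traj₁ - u e.traj₂ - (u' e.traj₁ - u' e.traj₂)| ^ 2 := by
    rw [sq_abs, pairDiff]; ring
  rw [e1, prefSqDist, ← sq_abs (Real.sigmoid _ - _), ← mul_pow]
  refine pow_le_pow_left₀ (abs_nonneg _) ?_ 2
  rwa [inv_mul_eq_div, le_div_iff₀ hκ0, mul_comm]

theorem sumAlong_le_of_prodAlong_le {φ : Data X A O → Sample X A O → ℝ≥0∞}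
    {ψ : Data X A O → Sample X A O → ℝ} {D : Data X A O}
    (h : ∀ e D', e :: D' <:+ D → ENNReal.ofReal (Real.exp (ψ D' e)) ≤ φ D' e)
    {n T : ℕ} {δ : ℝ} (hn : 1 ≤ n) (hT : 2 ≤ T) (hδ : 0 < δ) (hδ1 : δ ≤ 1)
    (hD : prodAlong φ D ≤ n * ENNReal.ofReal (5 / δ)) :
    sumAlong ψ D ≤ 4 * Real.log (n * T / δ) := by
  have hn' : (1 : ℝ) ≤ n := by exact_mod_cast hn
  have hT' : (2 : ℝ) ≤ T := by exact_mod_cast hT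
  have h1 := (exp_sumAlong_le_prodAlong h).trans hD
  rw [← ENNReal.ofReal_natCast, ← ENNReal.ofReal_mul (by positivity),
    ENNReal.ofReal_le_ofReal_iff (by positivity)] at h1
  set y : ℝ := n * T / δ with hy
  have hy2 : 2 ≤ y := by
    rw [hy, le_div_iff₀ hδ]
    nlinarith
  -- Since `T ≥ 2` and `y ≥ 2`, the threshold is at most `5 y / 2 ≤ y⁴`; this exponent is the
  -- constant 4 in front of the logarithm.
  have h2 : (n : ℝ) * (5 / δ) ≤ y ^ 4 := by
    have h3 : (n : ℝ) * (5 / δ) * 2 ≤ 5 * y := by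
      rw [hy, mul_div_assoc', mul_div_assoc', div_mul_eq_mul_div]
      refine div_le_div_of_nonneg_right ?_ hδ.le
      nlinarith
    have h4 : (2 : ℝ) ^ 3 ≤ y ^ 3 := pow_le_pow_left₀ (by norm_num) hy2 3
    nlinarith
  have h5 := (Real.le_log_iff_exp_le (by positivity)).2 (h1.trans h2)
  rwa [Real.log_pow] at h5

theorem rewardLogLik_eq_sumAlong (D : Data X A O) (u : Utility X A O) :
    rewardLogLik D u = sumAlong (fun _ e => rewardLog u e) D := by
  induction D with
  | nil => rfl
  | cons e D ih =>
    rw [sumAlong, ← ih]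
    rfl

/-- `log P^π(τ)`. -/
def trajLog (M : Model X A O) (P : Transition X A O) (π : Policy X A O) (τ : Traj X A O) : ℝ :=
  Real.log (trajLaw M.d₀ π P M.H τ).toReal

/-- The trajectories of the round have positive probability under the transitions `P`. -/
def IsPossible (M : Model X A O) (P : Transition X A O) (e : Sample X A O) : Prop :=
  trajLaw M.d₀ e.pol₁ P M.H e.traj₁ ≠ 0 ∧ trajLaw M.d₀ e.pol₂ P M.H e.traj₂ ≠ 0

theorem transitionLogLik_eq_coe {D : Data X A O} {P : Transition X A O}
    (h : ∀ e ∈ D, IsPossible M P e) :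
    transitionLogLik M.H M.d₀ D P = ((sumAlong (fun _ e =>
      trajLog M P e.pol₁ e.traj₁ + trajLog M P e.pol₂ e.traj₂) D : ℝ) : EReal) := by
  induction D with
  | nil => rfl
  | cons e D ih =>
    obtain ⟨h1, h2⟩ := h e List.mem_cons_self
    have ih' := ih fun e' he' => h e' (List.mem_cons_of_mem e he')
    rw [transitionLogLik] at ih' ⊢
    rw [List.map_cons, List.sum_cons, ih', sumAlong, EReal.coe_add, EReal.coe_add,
      ENNReal.log_pos_real h1 (PMF.apply_ne_top _ _), ENNReal.log_pos_real h2 (PMF.apply_ne_top _ _)]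
    rfl

theorem isPossible_of_transitionLogLik_ne_bot {D : Data X A O} {P : Transition X A O}
    (h : transitionLogLik M.H M.d₀ D P ≠ ⊥) : ∀ e ∈ D, IsPossible M P e := by
  induction D with
  | nil => simp
  | cons e D ih =>
    rw [transitionLogLik, List.map_cons, List.sum_cons, Ne, EReal.add_eq_bot_iff,
      EReal.add_eq_bot_iff, ENNReal.log_eq_bot_iff, ENNReal.log_eq_bot_iff] at h
    push Not at h
    intro e' he'
    rcases List.mem_cons.1 he' with rfl | he'
    · exact h.1
    · exact ih h.2 e' he'

/-- Positivity of both likelihoods is essential, because `Real.log 0 = 0` would hide a zero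
likelihood. -/
theorem exp_le_trajRatio {P : Transition X A O} {π : Policy X A O} {τ : Traj X A O}
    (h : trajLaw M.d₀ π P M.H τ ≠ 0) (h' : trajLaw M.d₀ π M.P M.H τ ≠ 0) :
    ENNReal.ofReal (Real.exp (1 / 2 * (trajLog M P π τ - trajLog M M.P π τ)
      + tvTraj M π P ^ 2 / 2)) ≤ trajRatio M P π τ := by
  have hp := ENNReal.toReal_pos h (PMF.apply_ne_top _ _)
  have hq := ENNReal.toReal_pos h' (PMF.apply_ne_top _ _)
  have := mul_exp_half_log_sub hp hq
  rw [← mul_sqrt_div_eq hq.le] at this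
  rw [trajRatio, Real.exp_add, trajLog, trajLog, mul_left_cancel₀ hq.ne' this]

theorem reward_bound {D : Data X A O} {u : Utility X A O} {n T : ℕ} {δ : ℝ} (hn : 1 ≤ n)
    (hT : 2 ≤ T) (hδ : 0 < δ) (hδ1 : δ ≤ 1)
    (hD : prodAlong (fun _ e => ENNReal.ofReal (Real.exp
      (1 / 2 * (rewardLog u e - rewardLog M.u e) + prefSqDist u M.u e / 4))) D ≤
        n * ENNReal.ofReal (5 / δ)) :
    1 / 2 * (rewardLogLik D u - rewardLogLik D M.u)
      + 1 / 4 * sumAlong (fun _ e => prefSqDist u M.u e) D ≤ 4 * Real.log (n * T / δ) := by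
  refine le_of_eq_of_le ?_ (sumAlong_le_of_prodAlong_le (fun _ _ _ => le_rfl) hn hT hδ hδ1 hD)
  rw [rewardLogLik_eq_sumAlong, rewardLogLik_eq_sumAlong, ← sumAlong_sub, ← sumAlong_const_mul,
    ← sumAlong_const_mul, ← sumAlong_add]
  congr 1
  funext D e
  ring

theorem transition_bound {D : Data X A O} {P : Transition X A O} {n T : ℕ} {δ : ℝ} (hn : 1 ≤ n)
    (hT : 2 ≤ T) (hδ : 0 < δ) (hδ1 : δ ≤ 1) (hP : ∀ e ∈ D, IsPossible M P e)
    (hM : ∀ e ∈ D, IsPossible M M.P e)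
    (hD₁ : prodAlong (fun _ e => trajRatio M P e.pol₁ e.traj₁) D ≤ n * ENNReal.ofReal (5 / δ))
    (hD₂ : prodAlong (fun _ e => trajRatio M P e.pol₂ e.traj₂) D ≤ n * ENNReal.ofReal (5 / δ)) :
    1 / 2 * (sumAlong (fun _ e => trajLog M P e.pol₁ e.traj₁ + trajLog M P e.pol₂ e.traj₂) D
      - sumAlong (fun _ e => trajLog M M.P e.pol₁ e.traj₁ + trajLog M M.P e.pol₂ e.traj₂) D)
      + 1 / 2 * sumAlong (fun _ e => tvTraj M e.pol₁ P ^ 2 + tvTraj M e.pol₂ P ^ 2) D ≤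
      8 * Real.log (n * T / δ) := by
  have hmem : ∀ (e : Sample X A O) D', e :: D' <:+ D → e ∈ D := fun e D' h =>
    h.subset List.mem_cons_self
  have h1 := sumAlong_le_of_prodAlong_le (fun e D' h =>
    exp_le_trajRatio (hP e (hmem e D' h)).1 (hM e (hmem e D' h)).1) hn hT hδ hδ1 hD₁
  have h2 := sumAlong_le_of_prodAlong_le (fun e D' h =>
    exp_le_trajRatio (hP e (hmem e D' h)).2 (hM e (hmem e D' h)).2) hn hT hδ hδ1 hD₂
  have h3 := add_le_add h1 h2
  rw [← sumAlong_add] at h3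
  refine le_of_eq_of_le ?_ (h3.trans_eq (by ring))
  rw [← sumAlong_sub, ← sumAlong_const_mul, ← sumAlong_const_mul, ← sumAlong_add]
  congr 1
  funext D e
  ring

/-- The rounds of a nonempty data set, indexed by their time. -/
theorem exists_rounds {D : Data X A O} {T : ℕ} (hD : D.length = T) (hT : 1 ≤ T) :
    ∃ (e : ℕ → Sample X A O) (pre : ℕ → Data X A O), pre 1 = [] ∧ pre (T + 1) = D ∧
      ∀ t ∈ Finset.Icc 1 T, pre (t + 1) = e t :: pre t := by
  have hne : 0 < D.length := by omega
  -- Newest first, round `t` sits at position `T - t`; the default entry only makes the function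
  -- total.
  refine ⟨fun t => D.getD (T - t) D[0], fun t => D.drop (T + 1 - t), ?_, ?_, ?_⟩
  · exact List.drop_eq_nil_of_le (by omega)
  · simp
  · intro t ht
    obtain ⟨h1, h2⟩ := Finset.mem_Icc.1 ht
    have hlt : T - t < D.length := by omega
    have e1 : T + 1 - (t + 1) = T - t := by omega
    have e2 : T + 1 - t = T - t + 1 := by omega
    simp only [e1, e2, List.getD_eq_getElem D _ hlt]
    exact List.drop_eq_getElem_cons hlt

theorem sumAlong_eq_sum_Ico {e : ℕ → Sample X A O} {pre : ℕ → Data X A O} {T : ℕ}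
    (h1 : pre 1 = []) (hpre : ∀ t ∈ Finset.Icc 1 T, pre (t + 1) = e t :: pre t)
    (ψ : Data X A O → Sample X A O → ℝ) {t : ℕ} (ht : 1 ≤ t) (htT : t ≤ T + 1) :
    sumAlong ψ (pre t) = ∑ i ∈ Finset.Ico 1 t, ψ (pre i) (e i) := by
  induction t, ht using Nat.le_induction with
  | base => simp [h1, sumAlong]
  | succ t ht ih =>
    rw [hpre t (Finset.mem_Icc.2 ⟨ht, by omega⟩), sumAlong, ih (by omega),
      Finset.sum_Ico_succ_top ht, add_comm]

theorem suffix_of_rounds {e : ℕ → Sample X A O} {pre : ℕ → Data X A O} {T : ℕ} {D : Data X A O}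
    (hD : pre (T + 1) = D) (hpre : ∀ t ∈ Finset.Icc 1 T, pre (t + 1) = e t :: pre t)
    {t : ℕ} (ht : 1 ≤ t) (htT : t ≤ T + 1) : pre t <:+ D := by
  induction htT using Nat.decreasingInduction with
  | self => rw [hD]
  | of_succ t h ih =>
    refine List.IsSuffix.trans ?_ (ih (by omega))
    rw [hpre t (Finset.mem_Icc.2 ⟨ht, by omega⟩)]
    exact List.suffix_cons _ _

end Consequences

/-! ### The high-probability event -/

section GoodEvent

variable {L : Learner X A O} {M : Model X A O} {η R δ : ℝ} {π₀ : Policy X A O}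
  {U : Finset (Utility X A O)} {Ps : Finset (Transition X A O)} {T : ℕ}

/-- Exponential process of the likelihood ratio of `u`. -/
def rewardProcess (M : Model X A O) (u : Utility X A O) : Data X A O → ℝ≥0∞ :=
  prodAlong fun _ e => ENNReal.ofReal (Real.exp
    (1 / 2 * (rewardLog u e - rewardLog M.u e) + prefSqDist u M.u e / 4))

/-- Exponential process of the likelihood ratio of `P` in the first trajectories. -/
def transitionProcess₁ (M : Model X A O) (P : Transition X A O) : Data X A O → ℝ≥0∞ :=
  prodAlong fun _ e => trajRatio M P e.pol₁ e.traj₁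

/-- Exponential process of the likelihood ratio of `P` in the second trajectories. -/
def transitionProcess₂ (M : Model X A O) (P : Transition X A O) : Data X A O → ℝ≥0∞ :=
  prodAlong fun _ e => trajRatio M P e.pol₂ e.traj₂

/-- Difference of the expected and the observed gap of the utility `f D`, at scale `R`. -/
def gapDeviation (L : Learner X A O) (M : Model X A O) (η : ℝ) (π₀ : Policy X A O) (R : ℝ)
    (f : Data X A O → Utility X A O) (D : Data X A O) (e : Sample X A O) : ℝ :=
  1 / 2 * expect (stepRound L M η π₀ D) (fun e => |pairDiff (f D) M.u e| / R)
    - |pairDiff (f D) M.u e| / R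

/-- Exponential process of the deviations of the gaps. -/
def gapProcess (L : Learner X A O) (M : Model X A O) (η : ℝ) (π₀ : Policy X A O) (R : ℝ)
    (f : Data X A O → Utility X A O) : Data X A O → ℝ≥0∞ :=
  prodAlong fun D e => ENNReal.ofReal (Real.exp (gapDeviation L M η π₀ R f D e))

/-- All the exponential processes are below their thresholds. -/
structure WithinBudget (L : Learner X A O) (M : Model X A O) (η : ℝ) (π₀ : Policy X A O) (R : ℝ)
    (U : Finset (Utility X A O)) (Ps : Finset (Transition X A O))
    (f₁ f₂ : Data X A O → Utility X A O) (c : ℝ≥0∞) (D : Data X A O) : Prop where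
  reward : ∀ u ∈ U, rewardProcess M u D ≤ U.card * c
  transition₁ : ∀ P ∈ Ps, transitionProcess₁ M P D ≤ Ps.card * c
  transition₂ : ∀ P ∈ Ps, transitionProcess₂ M P D ≤ Ps.card * c
  gap₁ : gapProcess L M η π₀ R f₁ D ≤ c
  gap₂ : gapProcess L M η π₀ R f₂ D ≤ c

theorem le_card_mul_of_sum_le {ι : Type*} {s : Finset ι} {W : ι → ℝ≥0∞} {c : ℝ≥0∞}
    (h : ∑ i ∈ s, (s.card : ℝ≥0∞)⁻¹ * W i ≤ c) {i : ι} (hi : i ∈ s) : W i ≤ s.card * c := by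
  have h0 : (s.card : ℝ≥0∞) ≠ 0 := Nat.cast_ne_zero.2 (Finset.card_pos.2 ⟨i, hi⟩).ne'
  have h1 : (s.card : ℝ≥0∞)⁻¹ * W i ≤ c :=
    (Finset.single_le_sum (f := fun i => (s.card : ℝ≥0∞)⁻¹ * W i) (fun _ _ => zero_le) hi).trans h
  calc W i = s.card * ((s.card : ℝ≥0∞)⁻¹ * W i) := by
        rw [← mul_assoc, ENNReal.mul_inv_cancel h0 (ENNReal.natCast_ne_top _), one_mul]
    _ ≤ s.card * c := mul_le_mul_right h1 _

theorem sum_inv_card {ι : Type*} {s : Finset ι} (hs : s.Nonempty) :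
    ∑ _i ∈ s, (s.card : ℝ≥0∞)⁻¹ * 1 = 1 := by
  rw [Finset.sum_const, nsmul_eq_mul, mul_one]
  exact ENNReal.mul_inv_cancel (Nat.cast_ne_zero.2 (Finset.card_pos.2 hs).ne')
    (ENNReal.natCast_ne_top _)

/-- The union bound is made inside one supermartingale: three class averages and two gap processes,
of total initial value 5. Ville at level `5 / δ` covers all prefixes together, and undoing an
average costs the cardinality of its class. -/
theorem le_toOuterMeasure_withinBudget (hH : 1 ≤ M.H) (hδ : 0 < δ) (hU : U.Nonempty)
    (hPs : Ps.Nonempty) {f₁ f₂ : Data X A O → Utility X A O}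
    (h₁ : ∀ D, ∀ e ∈ (stepRound L M η π₀ D).support, |pairDiff (f₁ D) M.u e| / R ∈ Set.Icc 0 1)
    (h₂ : ∀ D, ∀ e ∈ (stepRound L M η π₀ D).support, |pairDiff (f₂ D) M.u e| / R ∈ Set.Icc 0 1) :
    ENNReal.ofReal (1 - δ) ≤ (dataLaw L M η π₀ T).toOuterMeasure
      {D | ∀ D', D' <:+ D →
        WithinBudget L M η π₀ R U Ps f₁ f₂ (ENNReal.ofReal (5 / δ)) D'} := by
  set c := ENNReal.ofReal (5 / δ) with hc
  let W : Data X A O → ℝ≥0∞ := fun D =>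
    ∑ u ∈ U, (U.card : ℝ≥0∞)⁻¹ * rewardProcess M u D
      + ∑ P ∈ Ps, (Ps.card : ℝ≥0∞)⁻¹ * transitionProcess₁ M P D
      + ∑ P ∈ Ps, (Ps.card : ℝ≥0∞)⁻¹ * transitionProcess₂ M P D
      + gapProcess L M η π₀ R f₁ D + gapProcess L M η π₀ R f₂ D
  have hW : IsSupermart L M η π₀ W :=
    ((((IsSupermart.sum fun u _ => (isSupermart_reward u).const_mul _).add
      (IsSupermart.sum fun P _ => (isSupermart_transition₁ hH P).const_mul _)).add
      (IsSupermart.sum fun P _ => (isSupermart_transition₂ hH P).const_mul _)).add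
      (isSupermart_concentration h₁)).add (isSupermart_concentration h₂)
  have hW0 : W [] = ENNReal.ofReal 5 := by
    change ∑ u ∈ U, (U.card : ℝ≥0∞)⁻¹ * 1 + ∑ P ∈ Ps, (Ps.card : ℝ≥0∞)⁻¹ * 1
      + ∑ P ∈ Ps, (Ps.card : ℝ≥0∞)⁻¹ * 1 + 1 + 1 = ENNReal.ofReal 5
    rw [sum_inv_card hU, sum_inv_card hPs]
    norm_num
  have hmax := hW.maximal c T
  rw [hW0] at hmax
  have hbad : (dataLaw L M η π₀ T).toOuterMeasure {D | ∃ D', D' <:+ D ∧ c ≤ W D'} ≤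
      ENNReal.ofReal δ := by
    have hc0 : c ≠ 0 := by
      rw [hc, Ne, ENNReal.ofReal_eq_zero, not_le]
      positivity
    rw [← ENNReal.mul_le_mul_iff_right hc0 ENNReal.ofReal_ne_top]
    refine hmax.trans_eq ?_
    rw [hc, ← ENNReal.ofReal_mul (by positivity), div_mul_cancel₀ _ hδ.ne']
  have hcover : (Set.univ : Set (Data X A O)) ⊆
      {D | ∀ D', D' <:+ D → WithinBudget L M η π₀ R U Ps f₁ f₂ c D'} ∪
        {D | ∃ D', D' <:+ D ∧ c ≤ W D'} := by
    intro D _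
    by_cases h : ∃ D', D' <:+ D ∧ c ≤ W D'
    · exact Or.inr h
    · refine Or.inl fun D' hD' => ?_
      have hle : W D' ≤ c := le_of_not_ge fun hc' => h ⟨D', hD', hc'⟩
      have l1 := le_self_add.trans hle
      have l2 := le_self_add.trans l1
      have l3 := le_self_add.trans l2
      exact ⟨fun u hu => le_card_mul_of_sum_le (le_self_add.trans l3) hu,
        fun P hP => le_card_mul_of_sum_le (le_add_self.trans l3) hP,
        fun P hP => le_card_mul_of_sum_le (le_add_self.trans l2) hP,
        le_add_self.trans l1, le_add_self.trans hle⟩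
  have hone : (1 : ℝ≥0∞) = (dataLaw L M η π₀ T).toOuterMeasure Set.univ :=
    ((PMF.toOuterMeasure_apply_eq_one_iff _ _).2 (Set.subset_univ _)).symm
  rw [ENNReal.ofReal_sub _ hδ.le, ENNReal.ofReal_one, tsub_le_iff_right, hone]
  exact (MeasureTheory.measure_mono hcover).trans
    ((MeasureTheory.measure_union_le _ _).trans (add_le_add le_rfl hbad))

end GoodEvent

/-! ### Confidence sets -/

section Confidence

variable {L : Learner X A O} {M : Model X A O} {η R δ : ℝ} {π₀ : Policy X A O}
  {U : Finset (Utility X A O)} {Ps : Finset (Transition X A O)} {T : ℕ}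
  {f₁ f₂ : Data X A O → Utility X A O} {D : Data X A O}

theorem sumAlong_nonneg {ψ : Data X A O → Sample X A O → ℝ} (h : ∀ D e, 0 ≤ ψ D e)
    (D : Data X A O) : 0 ≤ sumAlong ψ D := by
  induction D with
  | nil => exact le_rfl
  | cons e D ih => exact add_nonneg (h D e) ih

theorem two_le_card_mul_div {n : ℕ} (hn : 1 ≤ n) (hT : 2 ≤ T) (hδ : 0 < δ) (hδ1 : δ ≤ 1) :
    2 ≤ (n : ℝ) * T / δ := by
  have hn' : (1 : ℝ) ≤ n := by exact_mod_cast hn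
  have hT' : (2 : ℝ) ≤ T := by exact_mod_cast hT
  rw [le_div_iff₀ hδ]
  nlinarith

theorem half_le_log {y : ℝ} (hy : 2 ≤ y) : 1 / 2 ≤ Real.log y :=
  (by linarith [Real.log_two_gt_d9] : 1 / 2 ≤ Real.log 2).trans
    (Real.log_le_log (by norm_num) hy)

theorem true_mem_rewardConf (hT : 2 ≤ T) (hδ : 0 < δ) (hδ1 : δ ≤ 1) (hM : M.u ∈ U)
    (hD : WithinBudget L M η π₀ R U Ps f₁ f₂ (ENNReal.ofReal (5 / δ)) D)
    {uHat : Utility X A O} (hu : uHat ∈ U) :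
    M.u ∈ rewardConf U D uHat (16 * Real.log (U.card * T / δ)) := by
  refine ⟨hM, ?_⟩
  have h := reward_bound (Finset.card_pos.2 ⟨_, hM⟩) hT hδ hδ1 (hD.reward uHat hu)
  have h0 := sumAlong_nonneg (ψ := fun _ e => prefSqDist uHat M.u e) (fun _ _ => sq_nonneg _) D
  have hl := half_le_log (two_le_card_mul_div (Finset.card_pos.2 ⟨_, hM⟩) hT hδ hδ1)
  linarith

/-- A member of the confidence set loses at most `16 log` in likelihood to the maximizer, hence to
the truth. So a quarter of the sum is at most `(4 + 8) log`. -/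
theorem sumAlong_prefSqDist_le (hT : 2 ≤ T) (hδ : 0 < δ) (hδ1 : δ ≤ 1) (hM : M.u ∈ U)
    (hD : WithinBudget L M η π₀ R U Ps f₁ f₂ (ENNReal.ofReal (5 / δ)) D)
    {uHat u : Utility X A O} (hmax : ∀ v ∈ U, rewardLogLik D v ≤ rewardLogLik D uHat)
    (hu : u ∈ rewardConf U D uHat (16 * Real.log (U.card * T / δ))) :
    sumAlong (fun _ e => prefSqDist u M.u e) D ≤ 48 * Real.log (U.card * T / δ) := by
  have h := reward_bound (Finset.card_pos.2 ⟨_, hM⟩) hT hδ hδ1 (hD.reward u hu.1)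
  linarith [hu.2, hmax _ hM]

/-- The two trajectory processes contribute `4 log` each to half the log-likelihood ratio, so the
truth loses at most `16 log`: this fixes the width constant. -/
theorem true_mem_transitionConf (hT : 2 ≤ T) (hδ : 0 < δ) (hδ1 : δ ≤ 1) (hM : M.P ∈ Ps)
    (hD : WithinBudget L M η π₀ R U Ps f₁ f₂ (ENNReal.ofReal (5 / δ)) D)
    (hpos : ∀ e ∈ D, IsPossible M M.P e)
    {PHat : Transition X A O} (hP : PHat ∈ Ps)
    (hmax : ∀ P ∈ Ps, transitionLogLik M.H M.d₀ D P ≤ transitionLogLik M.H M.d₀ D PHat) :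
    M.P ∈ transitionConf M.H M.d₀ Ps D PHat (16 * Real.log (Ps.card * T / δ)) := by
  refine ⟨hM, ?_⟩
  have h1 := hmax _ hM
  -- The sampled data have positive likelihood under the truth, so the maximizer's log-likelihood is
  -- not `-∞` either.
  have hposHat : ∀ e ∈ D, IsPossible M PHat e := by
    refine isPossible_of_transitionLogLik_ne_bot fun hb => ?_
    rw [hb, transitionLogLik_eq_coe hpos] at h1
    exact EReal.coe_ne_bot _ (le_bot_iff.1 h1)
  have h := transition_bound (Finset.card_pos.2 ⟨_, hM⟩) hT hδ hδ1 hposHat hpos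
    (hD.transition₁ _ hP) (hD.transition₂ _ hP)
  have h0 := sumAlong_nonneg (ψ := fun _ e => tvTraj M e.pol₁ PHat ^ 2 + tvTraj M e.pol₂ PHat ^ 2)
    (fun _ _ => by positivity) D
  rw [transitionLogLik_eq_coe hpos, transitionLogLik_eq_coe hposHat, ← EReal.coe_sub,
    EReal.coe_le_coe_iff]
  linarith

/-- Half the sum is at most `8 log` from the processes plus `8 log` from the width, which gives the
32 used for `c₂`. -/
theorem sumAlong_sq_tvTraj_le (hT : 2 ≤ T) (hδ : 0 < δ) (hδ1 : δ ≤ 1) (hM : M.P ∈ Ps)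
    (hD : WithinBudget L M η π₀ R U Ps f₁ f₂ (ENNReal.ofReal (5 / δ)) D)
    (hpos : ∀ e ∈ D, IsPossible M M.P e) {PHat P : Transition X A O}
    (hmax : ∀ P ∈ Ps, transitionLogLik M.H M.d₀ D P ≤ transitionLogLik M.H M.d₀ D PHat)
    (hP : P ∈ transitionConf M.H M.d₀ Ps D PHat (16 * Real.log (Ps.card * T / δ))) :
    sumAlong (fun _ e => tvTraj M e.pol₁ P ^ 2 + tvTraj M e.pol₂ P ^ 2) D ≤
      32 * Real.log (Ps.card * T / δ) := by
  have h1 : transitionLogLik M.H M.d₀ D M.P - ((16 * Real.log (Ps.card * T / δ) : ℝ) : EReal) ≤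
      transitionLogLik M.H M.d₀ D P :=
    (EReal.sub_le_sub (hmax _ hM) le_rfl).trans hP.2
  rw [transitionLogLik_eq_coe hpos, ← EReal.coe_sub] at h1
  have hposP : ∀ e ∈ D, IsPossible M P e := by
    refine isPossible_of_transitionLogLik_ne_bot fun hb => ?_
    rw [hb] at h1
    exact EReal.coe_ne_bot _ (le_bot_iff.1 h1)
  rw [transitionLogLik_eq_coe hposP, EReal.coe_le_coe_iff] at h1
  have h := transition_bound (Finset.card_pos.2 ⟨_, hM⟩) hT hδ hδ1 hposP hpos
    (hD.transition₁ _ hP.1) (hD.transition₂ _ hP.1)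
  linarith

theorem self_mem_transitionConf {PHat : Transition X A O} (hP : PHat ∈ Ps) {β : ℝ} (hβ : 0 ≤ β) :
    PHat ∈ transitionConf M.H M.d₀ Ps D PHat β := by
  refine ⟨hP, ?_⟩
  rw [EReal.sub_le_iff_le_add (Or.inl (EReal.coe_ne_bot _)) (Or.inl (EReal.coe_ne_top _))]
  exact le_add_of_nonneg_right (by exact_mod_cast hβ)

end Confidence

/-! ### Regret as a sum over rounds -/

section Regret

variable {M : Model X A O} {η : ℝ} {π₀ πstar : Policy X A O}

/-- The KL-regularized objective as a real number. -/
def realJ (η : ℝ) (M : Model X A O) (π₀ π : Policy X A O) : ℝ :=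
  expect (trajLaw M.d₀ π M.P M.H) M.u - η * (klAlong M π π₀).toReal

theorem regret_eq_coe (hη : 0 ≤ η) (hstar : klAlong M πstar π₀ ≠ ∞) {D : Data X A O}
    (hD : ∀ e ∈ D, klAlong M e.pol₁ π₀ ≠ ∞) :
    regret η M π₀ πstar D =
      ((sumAlong (fun _ e => realJ η M π₀ πstar - realJ η M π₀ e.pol₁) D : ℝ) : EReal) := by
  induction D with
  | nil => rfl
  | cons e D ih =>
    have ih' := ih fun e' he' => hD e' (List.mem_cons_of_mem e he')
    rw [regret] at ih' ⊢
    rw [List.map_cons, List.sum_cons, ih', sumAlong, EReal.coe_add, EReal.coe_sub,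
      J_eq_coe hη hstar, J_eq_coe hη (hD e List.mem_cons_self)]
    rfl

theorem klToMain_spec {D : Data X A O} (hD : ∀ e ∈ D, klAlong M πstar e.pol₁ ≠ ∞) :
    klToMain M πstar D ≠ ∞ ∧
      (klToMain M πstar D).toReal = sumAlong (fun _ e => (klAlong M πstar e.pol₁).toReal) D := by
  induction D with
  | nil => exact ⟨ENNReal.zero_ne_top, rfl⟩
  | cons e D ih =>
    obtain ⟨ih1, ih2⟩ := ih fun e' he' => hD e' (List.mem_cons_of_mem e he')
    have he := hD e List.mem_cons_self
    have hcons : klToMain M πstar (e :: D) = klAlong M πstar e.pol₁ + klToMain M πstar D := by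
      simp only [klToMain, List.map_cons, List.sum_cons]
    rw [hcons, ENNReal.toReal_add he ih1, ih2]
    exact ⟨ENNReal.add_ne_top.2 ⟨he, ih1⟩, rfl⟩

/-- Both expectations are marginals of one round, so their difference is the mean of `pairDiff u M.u
- pairDiff u' M.u` over sampled pairs. Those pairs share a prompt, as the Eluder coefficient
requires. -/
theorem expect_sub_expect_le {B : ℝ} (hH : 1 ≤ M.H) {π₁ π₂ : Policy X A O}
    {u u' : Utility X A O} (hu : ∀ τ, IsTraj M.H τ → u τ ∈ Set.Icc 0 B)
    (hu' : ∀ τ, IsTraj M.H τ → u' τ ∈ Set.Icc 0 B)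
    (hM : ∀ τ, IsTraj M.H τ → M.u τ ∈ Set.Icc 0 B) :
    expect (trajLaw M.d₀ π₂ M.P M.H) (fun τ => u τ - u' τ)
      - expect (trajLaw M.d₀ π₁ M.P M.H) (fun τ => u τ - u' τ) ≤
    expect (roundLaw M π₁ π₂) (fun e => |pairDiff u' M.u e|)
      + expect (roundLaw M π₁ π₂) (fun e => |pairDiff u M.u e|) := by
  have hpair : ∀ e ∈ (roundLaw M π₁ π₂).support, IsPair M.H e := fun e he =>
    (of_mem_support_roundLaw hH he).2.1
  have hb₁ : ∀ e ∈ (roundLaw M π₁ π₂).support, |u e.traj₁ - u' e.traj₁| ≤ B := fun e he =>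
    abs_sub_le_of_mem_Icc (hu _ (hpair e he).1) (hu' _ (hpair e he).1)
  have hb₂ : ∀ e ∈ (roundLaw M π₁ π₂).support, |u e.traj₂ - u' e.traj₂| ≤ B := fun e he =>
    abs_sub_le_of_mem_Icc (hu _ (hpair e he).2.1) (hu' _ (hpair e he).2.1)
  have hbd : ∀ v : Utility X A O, (∀ τ, IsTraj M.H τ → v τ ∈ Set.Icc 0 B) →
      Summ (roundLaw M π₁ π₂) fun e => |pairDiff v M.u e| := by
    intro v hv
    refine summ_of_bound (C := B + B) fun e he => ?_
    rw [abs_abs]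
    exact (abs_sub _ _).trans (add_le_add
      (abs_sub_le_of_mem_Icc (hv _ (hpair e he).2.1) (hv _ (hpair e he).1))
      (abs_sub_le_of_mem_Icc (hM _ (hpair e he).2.1) (hM _ (hpair e he).1)))
  conv_lhs => rw [← map_traj₂_roundLaw π₁ π₂]
  conv_lhs => rw [← map_traj₁_roundLaw π₁ π₂]
  rw [expect_map hb₂, expect_map hb₁, ← expect_sub (summ_of_bound hb₂) (summ_of_bound hb₁),
    ← expect_add (hbd u' hu') (hbd u hu)]
  refine expect_mono ((summ_of_bound hb₂).sub (summ_of_bound hb₁)) ((hbd u' hu').add (hbd u hu))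
    fun e _ => ?_
  have h1 := neg_abs_le (pairDiff u' M.u e)
  have h2 := le_abs_self (pairDiff u M.u e)
  simp only [pairDiff] at h1 h2 ⊢
  linarith

end Regret

/-! ### The regret bound -/

section Main

variable {L : Learner X A O} {M : Model X A O} {η B δ : ℝ} {π₀ πstar : Policy X A O}
  {U : Finset (Utility X A O)} {Ps : Finset (Transition X A O)} {T : ℕ}

/-- `f₁` stands for the estimated utility and `(f₂, p₂)` for the optimistic pair. Both utilities are
required to lie in `U` at all data, while the optimality properties are needed only on reachable
data. -/
theorem regret_le_of_withinBudget {dP : ℝ} {ξ : ℝ → ℕ → ℝ → ℝ}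
    (hH : 1 ≤ M.H) (hT : 2 ≤ T) (hη : 0 < η) (hB : 1 ≤ B) (hδ : 0 < δ) (hδ1 : δ ≤ 1)
    (hU : ∀ u ∈ U, ∀ τ, IsTraj M.H τ → u τ ∈ Set.Icc 0 B)
    (hMu : M.u ∈ U) (hMP : M.P ∈ Ps) (hξ : GeneralizedEluder M Ps dP ξ)
    (hstar : klAlong M πstar π₀ ≠ ∞) (hL : L.Follows M η π₀ U Ps 16 δ T)
    {R : ℝ} (hR : R = 3 * B * √(dU M.H U M.u T))
    {f₁ f₂ : Data X A O → Utility X A O} {p₂ : Data X A O → Transition X A O}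
    (hf₁U : ∀ D, f₁ D ∈ U) (hf₂U : ∀ D, f₂ D ∈ U)
    (hf₁ : ∀ t < T, ∀ D ∈ (dataLaw L M η π₀ t).support, f₁ D = L.uHat D)
    (hf₂ : ∀ t < T, ∀ D ∈ (dataLaw L M η π₀ t).support,
      f₂ D ∈ rewardConf U D (L.uHat D) (16 * Real.log (U.card * T / δ)) ∧
      p₂ D ∈ transitionConf M.H M.d₀ Ps D (L.PHat D) (16 * Real.log (Ps.card * T / δ)) ∧
      ∀ π : Policy X A O,
        ∀ u' ∈ rewardConf U D (L.uHat D) (16 * Real.log (U.card * T / δ)),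
        ∀ P' ∈ transitionConf M.H M.d₀ Ps D (L.PHat D) (16 * Real.log (Ps.card * T / δ)),
        uncertainty η (L.model M D) π₀ (L.main M η π₀ D) π u' P' ≤
          uncertainty η (L.model M D) π₀ (L.main M η π₀ D) (L.explore D) (f₂ D) (p₂ D))
    {D : Data X A O} (hD : D ∈ (dataLaw L M η π₀ T).support)
    (hgood : ∀ D', D' <:+ D →
      WithinBudget L M η π₀ R U Ps f₁ f₂ (ENNReal.ofReal (5 / δ)) D') :
    regret η M π₀ πstar D ≤
      ((60 * ((1 / (2 + Real.exp (-B) + Real.exp B))⁻¹ * B *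
            √(dU M.H U M.u T * T * Real.log (U.card * T / δ))
          + B ^ 2 * M.H * ξ dP T (32 * Real.log (Ps.card * M.H * T / δ))) : ℝ) : EReal)
      - ((ENNReal.ofReal η * klToMain M πstar D : ENNReal) : EReal) := by
  have hB0 : 0 ≤ B := by linarith
  have hcU : 1 ≤ U.card := Finset.card_pos.2 ⟨_, hMu⟩
  have hcP : 1 ≤ Ps.card := Finset.card_pos.2 ⟨_, hMP⟩
  set k := (1 / (2 + Real.exp (-B) + Real.exp B))⁻¹ with hk
  have hk1 : 1 ≤ k := by
    rw [hk, one_div, inv_inv]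
    linarith [Real.exp_pos B, Real.exp_pos (-B)]
  set ℓ := Real.log (U.card * T / δ) with hℓ
  set ℓP := Real.log (Ps.card * T / δ) with hℓP
  have hℓ2 : 1 / 2 ≤ ℓ := half_le_log (two_le_card_mul_div hcU hT hδ hδ1)
  have hℓP2 : 1 / 2 ≤ ℓP := half_le_log (two_le_card_mul_div hcP hT hδ hδ1)
  set Δ := 32 * Real.log (Ps.card * M.H * T / δ) with hΔ
  -- The factor `H` inside the logarithm only enlarges the allowed in-sample error.
  have hΔle : 32 * ℓP ≤ Δ := by
    have h2 := two_le_card_mul_div hcP hT hδ hδ1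
    have hH' : (1 : ℝ) ≤ M.H := by exact_mod_cast hH
    refine mul_le_mul_of_nonneg_left (Real.log_le_log (by linarith) ?_) (by norm_num)
    refine div_le_div_of_nonneg_right ?_ hδ.le
    exact mul_le_mul_of_nonneg_right (le_mul_of_one_le_right (Nat.cast_nonneg _) hH')
      (Nat.cast_nonneg _)
  -- the rounds
  have hcons : ∀ e ∈ D, ∃ D', e :: D' <:+ D := fun e he => by
    obtain ⟨l, D', rfl⟩ := List.append_of_mem he
    exact ⟨D', List.suffix_append l _⟩
  obtain ⟨e, pre, hpre1, hpreT, hpre⟩ :=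
    exists_rounds (length_of_mem_support_dataLaw hD) (by omega : 1 ≤ T)
  have hsuf : ∀ t ∈ Finset.Icc 1 T, pre t <:+ D := fun t ht =>
    suffix_of_rounds hpreT hpre (Finset.mem_Icc.1 ht).1 (by have := (Finset.mem_Icc.1 ht).2; omega)
  have hround : ∀ t ∈ Finset.Icc 1 T, e t :: pre t <:+ D := fun t ht => by
    rw [← hpre t ht]
    exact suffix_of_rounds hpreT hpre (by omega) (by have := (Finset.mem_Icc.1 ht).2; omega)
  have hsupp : ∀ t ∈ Finset.Icc 1 T, (pre t).length < T ∧
      pre t ∈ (dataLaw L M η π₀ (pre t).length).support ∧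
      e t ∈ (stepRound L M η π₀ (pre t)).support := fun t ht =>
    of_cons_suffix_of_mem_support_dataLaw hD (hround t ht)
  have hsum : ∀ ψ : Data X A O → Sample X A O → ℝ,
      sumAlong ψ D = ∑ t ∈ Finset.Icc 1 T, ψ (pre t) (e t) := fun ψ => by
    rw [← hpreT, sumAlong_eq_sum_Ico hpre1 hpre ψ (by omega) le_rfl]
    rfl
  have hpol : ∀ t ∈ Finset.Icc 1 T, (e t).pol₁ = L.main M η π₀ (pre t) ∧
      (e t).pol₂ = L.explore (pre t) := fun t ht =>
    (of_mem_support_roundLaw hH (hsupp t ht).2.2).1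
  have hpair : ∀ t ∈ Finset.Icc 1 T, IsPair M.H (e t) := fun t ht =>
    (of_mem_support_roundLaw hH (hsupp t ht).2.2).2.1
  have hpossD : ∀ e ∈ D, IsPossible M M.P e := fun e he => by
    obtain ⟨D', hD'⟩ := hcons e he
    obtain ⟨⟨h1, h2⟩, -, h3, h4⟩ := of_mem_support_roundLaw hH
      (of_cons_suffix_of_mem_support_dataLaw hD hD').2.2
    exact ⟨by rw [h1]; exact h3, by rw [h2]; exact h4⟩
  have hposs : ∀ t ∈ Finset.Icc 1 T, ∀ e' ∈ pre t, IsPossible M M.P e' := fun t ht e' he' =>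
    hpossD e' ((hsuf t ht).subset he')
  have hfol := fun t (ht : t ∈ Finset.Icc 1 T) =>
    hL (pre t).length (hsupp t ht).1 (pre t) (hsupp t ht).2.1
  have hsel := fun t (ht : t ∈ Finset.Icc 1 T) =>
    hf₂ (pre t).length (hsupp t ht).1 (pre t) (hsupp t ht).2.1
  have hhat := fun t (ht : t ∈ Finset.Icc 1 T) =>
    hf₁ (pre t).length (hsupp t ht).1 (pre t) (hsupp t ht).2.1
  have hIco : ∀ t ∈ Finset.Icc 1 T, ∀ i ∈ Finset.Ico 1 t, i ∈ Finset.Icc 1 T := fun t ht i hi =>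
    Finset.mem_Icc.2 ⟨(Finset.mem_Ico.1 hi).1,
      (Finset.mem_Ico.1 hi).2.le.trans (Finset.mem_Icc.1 ht).2⟩
  have hsumpre : ∀ t ∈ Finset.Icc 1 T, ∀ ψ : Data X A O → Sample X A O → ℝ,
      sumAlong ψ (pre t) = ∑ i ∈ Finset.Ico 1 t, ψ (pre i) (e i) := fun t ht ψ =>
    sumAlong_eq_sum_Ico hpre1 hpre ψ (Finset.mem_Icc.1 ht).1
      (by have := (Finset.mem_Icc.1 ht).2; omega)
  -- utilities
  have hstepbound : ∀ f : Data X A O → Utility X A O, (∀ D, f D ∈ U) → ∀ D,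
      ∀ e ∈ (stepRound L M η π₀ D).support, |pairDiff (f D) M.u e| ≤ R := fun f hf D e he => by
    rw [hR]
    exact abs_pairDiff_le hU hMu hB hT (hf D) (of_mem_support_roundLaw hH he).2.1
  have hgap : ∀ f : Data X A O → Utility X A O, (∀ D, f D ∈ U) →
      gapProcess L M η π₀ R f D ≤ ENNReal.ofReal (5 / δ) →
      (∀ t ∈ Finset.Icc 1 T,
        f (pre t) ∈ rewardConf U (pre t) (L.uHat (pre t)) (16 * ℓ)) →
      ∑ t ∈ Finset.Icc 1 T,
        expect (stepRound L M η π₀ (pre t)) (fun e => |pairDiff (f (pre t)) M.u e|) ≤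
        28 * k * B * √(dU M.H U M.u T * T * ℓ) := by
    intro f hf hproc hconf
    refine sum_expected_gap_le (f := fun t => f (pre t)) hU hMu hB hT hpair (fun t _ => hf _)
      hk1 hℓ2 hR (fun t _ => ?_) ?_ fun t ht => ?_
    · exact (expect_mem_Icc fun e he => ⟨abs_nonneg _, hstepbound f hf _ e he⟩).2
    -- The gap process has no class to average over; its budget is weakened by `|U| ≥ 1` so that the
    -- same logarithm appears.
    · have h := sumAlong_le_of_prodAlong_le (ψ := gapDeviation L M η π₀ R f)
        (fun _ _ _ => le_rfl) hcU hT hδ hδ1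
        (hproc.trans (le_mul_of_one_le_left zero_le (by exact_mod_cast hcU)))
      rw [hsum] at h
      refine le_of_eq_of_le (Finset.sum_congr rfl fun t _ => ?_) h
      rw [gapDeviation]
      congr 2
      rw [div_eq_inv_mul, ← expect_const_mul]
      simp only [div_eq_inv_mul]
    · have h := sumAlong_prefSqDist_le hT hδ hδ1 hMu (hgood _ (hsuf t ht)) (hfol t ht).1.2
        (hconf t ht)
      rw [hsumpre t ht] at h
      calc _ ≤ ∑ i ∈ Finset.Ico 1 t, k ^ 2 * prefSqDist (f (pre t)) M.u (e i) :=
            Finset.sum_le_sum fun i hi => by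
              have hp := hpair i (hIco t ht i hi)
              exact sq_pairDiff_le (hU _ (hf _) _ hp.1) (hU _ (hf _) _ hp.2.1)
                (hU _ hMu _ hp.1) (hU _ hMu _ hp.2.1)
        _ = k ^ 2 * ∑ i ∈ Finset.Ico 1 t, prefSqDist (f (pre t)) M.u (e i) := by
            rw [Finset.mul_sum]
        _ ≤ k ^ 2 * (48 * ℓ) := mul_le_mul_of_nonneg_left h (sq_nonneg k)
        _ = 48 * k ^ 2 * ℓ := by ring
  have hgap₁ := hgap f₁ hf₁U (hgood D List.suffix_rfl).gap₁ fun t ht => by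
    rw [hhat t ht]
    exact ⟨(hfol t ht).1.1, by linarith⟩
  have hgap₂ := hgap f₂ hf₂U (hgood D List.suffix_rfl).gap₂ fun t ht => (hsel t ht).1
  -- transitions
  have htv : ∀ P' : ℕ → Transition X A O,
      (∀ t ∈ Finset.Icc 1 T,
        P' t ∈ transitionConf M.H M.d₀ Ps (pre t) (L.PHat (pre t)) (16 * ℓP)) →
      ∑ t ∈ Finset.Icc 1 T, tvTraj M (e t).pol₁ (P' t) ≤ ξ dP T Δ ∧
      ∑ t ∈ Finset.Icc 1 T, tvTraj M (e t).pol₂ (P' t) ≤ ξ dP T Δ := by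
    intro P' hP'
    have hin : ∀ t ∈ Finset.Icc 1 T, ∑ i ∈ Finset.Ico 1 t,
        (tvTraj M (e i).pol₁ (P' t) ^ 2 + tvTraj M (e i).pol₂ (P' t) ^ 2) ≤ Δ := fun t ht => by
      have h := sumAlong_sq_tvTraj_le hT hδ hδ1 hMP (hgood _ (hsuf t ht)) (hposs t ht)
        (hfol t ht).2.1.2 (hP' t ht)
      rw [hsumpre t ht] at h
      exact h.trans hΔle
    have hΔ0 : 0 < Δ := by linarith
    refine ⟨hξ.2 T Δ hΔ0 P' (fun t => (e t).pol₁) (fun t ht => (hP' t ht).1) fun t ht => ?_,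
      hξ.2 T Δ hΔ0 P' (fun t => (e t).pol₂) (fun t ht => (hP' t ht).1) fun t ht => ?_⟩
    · exact (Finset.sum_le_sum fun i _ => le_add_of_nonneg_right (sq_nonneg _)).trans (hin t ht)
    · exact (Finset.sum_le_sum fun i _ => le_add_of_nonneg_left (sq_nonneg _)).trans (hin t ht)
  -- The Eluder condition is used for both policies with both the optimistic and the estimated
  -- transitions: four sums, each at most `ξ`.
  obtain ⟨htv₁, htv₂⟩ := htv (fun t => p₂ (pre t)) fun t ht => (hsel t ht).2.1
  obtain ⟨htv₃, htv₄⟩ := htv (fun t => L.PHat (pre t)) fun t ht =>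
    self_mem_transitionConf (hfol t ht).2.1.1 (by linarith)
  -- No sign is assumed for `ξ`; it follows because `ξ` bounds a sum of distances.
  have hξ0 : 0 ≤ ξ dP T Δ := (Finset.sum_nonneg fun t _ => tvTraj_nonneg _).trans htv₁
  -- one round
  have hone : ∀ t ∈ Finset.Icc 1 T, realJ η M π₀ πstar - realJ η M π₀ (e t).pol₁ ≤
      expect (stepRound L M η π₀ (pre t)) (fun e => |pairDiff (f₁ (pre t)) M.u e|)
      + expect (stepRound L M η π₀ (pre t)) (fun e => |pairDiff (f₂ (pre t)) M.u e|)
      + 4 * B * M.H * (tvTraj M (e t).pol₁ (p₂ (pre t)) + tvTraj M (e t).pol₂ (p₂ (pre t))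
        + tvTraj M (e t).pol₁ (L.PHat (pre t)) + tvTraj M (e t).pol₂ (L.PHat (pre t)))
      - η * (klAlong M πstar (e t).pol₁).toReal := by
    intro t ht
    have hconfu : M.u ∈ rewardConf U (pre t) (L.uHat (pre t)) (16 * ℓ) :=
      true_mem_rewardConf hT hδ hδ1 hMu (hgood _ (hsuf t ht)) (hfol t ht).1.1
    have hconfP : M.P ∈ transitionConf M.H M.d₀ Ps (pre t) (L.PHat (pre t)) (16 * ℓP) :=
      true_mem_transitionConf hT hδ hδ1 hMP (hgood _ (hsuf t ht)) (hposs t ht)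
        (hfol t ht).2.1.1 (hfol t ht).2.1.2
    have hopt := (hsel t ht).2.2 πstar M.u hconfu M.P hconfP
    rw [(hpol t ht).1, (hpol t ht).2, hhat t ht]
    have h1 := regret_round_le hη hB0 hH (hU _ (hfol t ht).1.1) hstar (hU _ (hf₂U (pre t)))
      (rfl : L.main M η π₀ (pre t) = _) hopt
    have h2 := expect_sub_expect_le (π₁ := L.main M η π₀ (pre t)) (π₂ := L.explore (pre t)) hH
      (hU _ (hf₂U (pre t))) (hU _ (hfol t ht).1.1) (hU _ hMu)
    simp only [realJ, stepRound]
    linarith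
  have htotal := Finset.sum_le_sum hone
  rw [Finset.sum_sub_distrib, Finset.sum_sub_distrib, Finset.sum_add_distrib,
    Finset.sum_add_distrib, ← Finset.mul_sum, ← Finset.mul_sum, Finset.sum_add_distrib, Finset.sum_add_distrib,
    Finset.sum_add_distrib] at htotal
  -- conclusion
  have hgfin : ∀ e ∈ D, klAlong M e.pol₁ π₀ ≠ ∞ ∧ klAlong M πstar e.pol₁ ≠ ∞ := fun e he => by
    obtain ⟨D', hD'⟩ := hcons e he
    obtain ⟨hlt, hD'', he'⟩ := of_cons_suffix_of_mem_support_dataLaw hD hD'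
    have hu := hU _ (hL D'.length hlt D' hD'').1.1
    rw [(of_mem_support_roundLaw hH he').1.1]
    exact ⟨klAlong_gibbsPolicy_ne_top hη hB0 hu, klAlong_to_gibbsPolicy_ne_top hη hB0 hu hstar⟩
  obtain ⟨hkfin, hkeq⟩ := klToMain_spec fun e he => (hgfin e he).2
  rw [regret_eq_coe hη.le hstar fun e he => (hgfin e he).1, coe_ofReal_mul hη.le hkfin,
    ← EReal.coe_sub, EReal.coe_le_coe_iff, hkeq, hsum, hsum,
    Finset.sum_sub_distrib]
  have hBH : 0 ≤ B * M.H := by positivity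
  have hB2 : B * M.H * ξ dP T Δ ≤ B ^ 2 * M.H * ξ dP T Δ := by
    refine mul_le_mul_of_nonneg_right (mul_le_mul_of_nonneg_right ?_ (Nat.cast_nonneg _)) hξ0
    nlinarith
  have hBHξ : 0 ≤ B * M.H * ξ dP T Δ := mul_nonneg hBH hξ0
  have hs0 : 0 ≤ k * B * √(dU M.H U M.u T * T * ℓ) := by positivity
  have htvs := mul_le_mul_of_nonneg_left (add_le_add (add_le_add (add_le_add htv₁ htv₂) htv₃) htv₄)
    (by linarith : 0 ≤ 4 * (B * M.H))
  -- The two gap sums contribute `28 + 28` and the four variation sums `4 · 4`, both within 60.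
  refine htotal.trans (sub_le_sub_right ?_ _)
  linarith

end Main

end

end MGSHF

theorem theorem1 :
    ∃ c₁ c₂ C : ℝ, 0 < c₁ ∧ 0 < c₂ ∧ 0 < C ∧
    ∀ (X A O : Type*) (M : MGSHF.Model X A O) (π₀ πstar : MGSHF.Policy X A O)
      (η B δ : ℝ) (T : ℕ)
      (U : Finset (MGSHF.Utility X A O)) (Ps : Finset (MGSHF.Transition X A O))
      (dP : ℝ) (ξ : ℝ → ℕ → ℝ → ℝ) (L : MGSHF.Learner X A O),
      1 ≤ M.H → 2 ≤ T → 0 < η → 1 ≤ B → 0 < δ → δ ≤ 1 →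
      (∀ u ∈ U, ∀ τ, MGSHF.IsTraj M.H τ → u τ ∈ Set.Icc 0 B) →
      M.u ∈ U → M.P ∈ Ps →
      MGSHF.GeneralizedEluder M Ps dP ξ →
      MGSHF.IsOptimal η M π₀ πstar →
      L.Follows M η π₀ U Ps c₁ δ T →
      ENNReal.ofReal (1 - δ) ≤
        (MGSHF.dataLaw L M η π₀ T).toOuterMeasure
          {D | MGSHF.regret η M π₀ πstar D ≤
            ((C * ((1 / (2 + Real.exp (-B) + Real.exp B))⁻¹ * B *
                  √(MGSHF.dU M.H U M.u T * T * Real.log (U.card * T / δ))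
                + B ^ 2 * M.H * ξ dP T (c₂ * Real.log (Ps.card * M.H * T / δ))) : ℝ) : EReal)
            - ((ENNReal.ofReal η * MGSHF.klToMain M πstar D : ENNReal) : EReal)} := by
  refine ⟨16, 32, 60, by norm_num, by norm_num, by norm_num, ?_⟩
  intro X A O M π₀ πstar η B δ T U Ps dP ξ L hH hT hη hB hδ hδ1 hU hMu hMP hξ hstar hL
  classical
  -- The optimistic pair must be a function of the data for its gaps to form a supermartingale. On
  -- unreachable data the learner is unconstrained, so the true pair is substituted to stay in `U`;
  -- `f₁` below is adjusted for the same reason.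
  have hsel : ∀ D : MGSHF.Data X A O, ∃ w : MGSHF.Utility X A O × MGSHF.Transition X A O,
      w.1 ∈ U ∧ ∀ t < T, D ∈ (MGSHF.dataLaw L M η π₀ t).support →
        w.1 ∈ MGSHF.rewardConf U D (L.uHat D) (16 * Real.log (U.card * T / δ)) ∧
        w.2 ∈ MGSHF.transitionConf M.H M.d₀ Ps D (L.PHat D)
          (16 * Real.log (Ps.card * T / δ)) ∧
        ∀ π : MGSHF.Policy X A O,
          ∀ u' ∈ MGSHF.rewardConf U D (L.uHat D) (16 * Real.log (U.card * T / δ)),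
          ∀ P' ∈ MGSHF.transitionConf M.H M.d₀ Ps D (L.PHat D)
            (16 * Real.log (Ps.card * T / δ)),
          MGSHF.uncertainty η (L.model M D) π₀ (L.main M η π₀ D) π u' P' ≤
            MGSHF.uncertainty η (L.model M D) π₀ (L.main M η π₀ D) (L.explore D) w.1 w.2 := by
    intro D
    by_cases h : ∃ t < T, D ∈ (MGSHF.dataLaw L M η π₀ t).support
    · obtain ⟨t, ht, hD⟩ := h
      obtain ⟨u₂, hu₂, P₂, hP₂, hmax⟩ := (hL t ht D hD).2.2
      exact ⟨(u₂, P₂), hu₂.1, fun _ _ _ => ⟨hu₂, hP₂, hmax⟩⟩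
    · exact ⟨(M.u, M.P), hMu, fun t ht hD => absurd ⟨t, ht, hD⟩ h⟩
  choose w hwU hw using hsel
  let f₁ : MGSHF.Data X A O → MGSHF.Utility X A O := fun D =>
    if L.uHat D ∈ U then L.uHat D else M.u
  have hf₁U : ∀ D, f₁ D ∈ U := fun D => by
    by_cases h : L.uHat D ∈ U
    · simpa only [f₁, if_pos h] using h
    · simpa only [f₁, if_neg h] using hMu
  set R := 3 * B * √(MGSHF.dU M.H U M.u T) with hR
  have hR0 : 0 ≤ R := by positivity
  -- When `R = 0` the quotient is 0 by the convention for division, so the scaled gaps still lie in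
  -- `[0, 1]`.
  have hscale : ∀ f : MGSHF.Data X A O → MGSHF.Utility X A O, (∀ D, f D ∈ U) → ∀ D,
      ∀ e ∈ (MGSHF.stepRound L M η π₀ D).support,
        |MGSHF.pairDiff (f D) M.u e| / R ∈ Set.Icc 0 1 := fun f hf D e he =>
    ⟨div_nonneg (abs_nonneg _) hR0, div_le_one_of_le₀ (MGSHF.abs_pairDiff_le hU hMu hB hT (hf D)
      (MGSHF.of_mem_support_roundLaw hH he).2.1) hR0⟩
  refine (MGSHF.le_toOuterMeasure_withinBudget (T := T) hH hδ ⟨_, hMu⟩ ⟨_, hMP⟩ (hscale f₁ hf₁U)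
    (hscale (fun D => (w D).1) hwU)).trans (PMF.toOuterMeasure_mono _ fun D hD => ?_)
  exact MGSHF.regret_le_of_withinBudget hH hT hη hB hδ hδ1 hU hMu hMP hξ
    (MGSHF.klAlong_ne_top_of_isOptimal hη hstar) hL hR (p₂ := fun D => (w D).2) hf₁U hwU
    (fun t ht D hD => if_pos (hL t ht D hD).1.1) (fun t ht D hD => hw D t ht hD) hD.2 hD.1
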